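/- **Setting.** Alice and Bob share a state $\rho$ of an $N\times N$ system $\mathcal H_N^A\otimes\mathcal H_N^B$ and the auxiliary state $\Psi_K$, where $\Psi_N=N^{-1/2}\sum_{i<N}|i\rangle^A|i\rangle^B$. The fidelity of $\rho$ is $F(\rho)=\langle\Psi_N|\rho|\Psi_N\rangle$. A general entanglement purification protocol (GEPP) $\mathcal P$ acts by local quantum operations and classical communication, and either outputs $\mathsf{FAIL}$ or a state of an $M\times M$ system. The state $\rho$ is a mixed state in the diagonal subspace if it is an ensemble of pure states of the form $\sum_i\alpha_i|i\rangle^A|i\rangle^B$. The protocol $\mathcal P$ is deterministically conditionally successful with parameter $\langle N,K,M,\epsilon,\delta,p\rangle$ for mixed states in the diagonal subspace if, for every such $\rho$ with $F(\rho)=1-\epsilon$, $$\Pr[\mathcal P(\rho)=\mathsf{FAIL}]\le p\quad\text{and}\quad \Pr[F(\mathcal P(\rho))\ge 1-\delta\mid\mathcal P(\rho)\ne\mathsf{FAIL}]=1 .$$ A family of GEPPs is efficient if there is a constant $c$ such that its members are implemented by quantum circuits of size $O((\log N+\log K)^c)$, with the same constants for the whole family. **Theorem.** For all integers $n,t,d$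 with $n>t\ge 0$ and $d\ge 1$ and all real $\epsilon<1/2$ there exist efficient GEPPs that are deterministically conditionally successful, for mixed states in the diagonal subspace, with the parameters 1. $\left\langle 2^n,\ 2^n-1,\ 2^{n-t}(2^n-1),\ \epsilon,\ \frac{2\epsilon}{2^t},\ \epsilon\right\rangle$; 2. $\left\langle 2^{2n},\ 2^n+1,\ 2^n(2^n+1),\ \epsilon,\ \frac{2\epsilon}{2^n},\ \epsilon\right\rangle$; 3. $\left\langle 2^{dn},\ \frac{2^{dn}-1}{2^n-1},\ 2^{(d-1)n}\,\frac{2^{dn}-1}{2^n-1},\ \epsilon,\ \frac{2\epsilon}{2^n},\ \epsilon\right\rangle$. The protocols do not depend on $\epsilon$. With $L=2^t$ in 1 and $L=2^n$ in 2 and 3, the fifth parameter, which is $2\epsilon/L$ above, can be replaced, for the same protocols, by $\epsilon/L$ whenever $\epsilon\le L/N$. -/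

import Mathlib

open Matrix
open scoped Kronecker ComplexOrder

noncomputable section

namespace Purification

/-! ### Bipartite states -/

/-- The rank-one operator `|φ⟩⟨φ|`. -/
def dyad {ι : Type*} (φ : ι → ℂ) : Matrix ι ι ℂ := vecMulVec φ (star φ)

/-- The maximally entangled state `Ψ_N = N^{-1/2} ∑ᵢ |i⟩|i⟩`. -/
def maxEnt (N : ℕ) : Fin N × Fin N → ℂ :=
  fun a => if a.1 = a.2 then ((1 / Real.sqrt N : ℝ) : ℂ) else 0

/-- Density matrices. -/
def IsDensity {ι : Type*} [Fintype ι] (ρ : Matrix ι ι ℂ) : Prop :=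
  ρ.PosSemidef ∧ ρ.trace = 1

/-- The fidelity `F(ρ) = ⟨Ψ_N|ρ|Ψ_N⟩` of a state `ρ` of an `N × N` system. -/
def fidelity {N : ℕ} (ρ : Matrix (Fin N × Fin N) (Fin N × Fin N) ℂ) : ℝ :=
  (star (maxEnt N) ⬝ᵥ (ρ *ᵥ maxEnt N)).re

/-- `ρ` is a mixed state in the diagonal subspace: an ensemble of unit vectors, each of which is
in the span of the vectors `|i⟩|i⟩`. -/
def InDiagonal {N : ℕ} (ρ : Matrix (Fin N × Fin N) (Fin N × Fin N) ℂ) : Prop :=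
  ∃ (s : ℕ) (p : Fin s → ℝ) (φ : Fin s → Fin N × Fin N → ℂ),
    (∀ k, 0 ≤ p k) ∧ ∑ k, p k = 1 ∧
    (∀ k, ∑ a, ‖φ k a‖ ^ 2 = 1) ∧
    (∀ k (a : Fin N × Fin N), a.1 ≠ a.2 → φ k a = 0) ∧
    ρ = ∑ k, ((p k : ℝ) : ℂ) • dyad (φ k)

/-! ### Local quantum circuits with classical communication -/

/-- The two parties. -/
inductive Party
  | alice
  | bob
  deriving DecidableEq

instance : Fintype Party where
  elems := {Party.alice, Party.bob}
  complete := by intro p; cases p <;> simp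

/-- The other party. -/
def Party.other : Party → Party
  | .alice => .bob
  | .bob => .alice

/-- Computational basis states when each party holds `w` qubits. -/
abbrev Basis (w : ℕ) : Type := Party × Fin w → Bool

/-- Elementary steps. Every gate acts on the qubits of one party only; the gates are NOT, Hadamard,
the `π/8` gate, controlled NOT and Toffoli. The step `send p q r` is one bit of classical
communication: party `p` measures qubit `q` in the computational basis and announces the result,
and the other party negates its qubit `r` if the result is `1`. -/
inductive Step (w : ℕ)
  | flip (p : Party) (q : Fin w)
  | hadamard (p : Party) (q : Fin w)
  | phase (p : Party) (q : Fin w)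
  | cnot (p : Party) (c q : Fin w) (h : c ≠ q)
  | toffoli (p : Party) (b c q : Fin w) (hbc : b ≠ c) (hb : b ≠ q) (hc : c ≠ q)
  | send (p : Party) (q r : Fin w)

section

variable {w : ℕ}

/-- The operator that maps each basis state `|s⟩` to `|f s⟩`. -/
def basisMap (f : Basis w → Basis w) : Matrix (Basis w) (Basis w) ℂ :=
  Matrix.of fun s' s => if s' = f s then 1 else 0

/-- Negation of one qubit, on basis states. -/
def negate (a : Party × Fin w) (s : Basis w) : Basis w := Function.update s a (!(s a))

/-- The projection onto the basis states in which qubit `a` has the value `b`. -/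
def proj (a : Party × Fin w) (b : Bool) : Matrix (Basis w) (Basis w) ℂ :=
  Matrix.diagonal fun s => if s a = b then 1 else 0

/-- The Hadamard gate on qubit `a`. -/
def hadamardMat (a : Party × Fin w) : Matrix (Basis w) (Basis w) ℂ :=
  Matrix.of fun s' s =>
    if ∀ c, c ≠ a → s' c = s c then
      ((1 / Real.sqrt 2 : ℝ) : ℂ) * (if (s' a && s a) = true then -1 else 1)
    else 0

/-- The gate `diag(1, e^{iπ/4})` on qubit `a`. -/
def phaseMat (a : Party × Fin w) : Matrix (Basis w) (Basis w) ℂ :=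
  Matrix.diagonal fun s =>
    if s a = true then Complex.exp (((Real.pi / 4 : ℝ) : ℂ) * Complex.I) else 1

/-- The Kraus operators of a step, one for each measurement result (gates have only one). -/
def Step.kraus : Step w → List (Matrix (Basis w) (Basis w) ℂ)
  | .flip p q => [basisMap (negate (p, q))]
  | .hadamard p q => [hadamardMat (p, q)]
  | .phase p q => [phaseMat (p, q)]
  | .cnot p c q _ =>
      [basisMap fun s => Function.update s (p, q) (xor (s (p, q)) (s (p, c)))]
  | .toffoli p b c q _ _ _ =>
      [basisMap fun s => Function.update s (p, q) (xor (s (p, q)) (s (p, b) && s (p, c)))]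
  | .send p q r =>
      [proj (p, q) false, basisMap (negate (p.other, r)) * proj (p, q) true]

/-- Run a list of steps. The result is the list of the unnormalized final states, one for each
sequence of measurement results; the trace of such a state is the probability of that sequence. -/
def run : List (Step w) → Matrix (Basis w) (Basis w) ℂ → List (Matrix (Basis w) (Basis w) ℂ)
  | [], σ => [σ]
  | o :: os, σ => o.kraus.flatMap fun A => run os (A * σ * Aᴴ)

end

/-- The contents of one party's qubits at the start, for the basis states `|i⟩` of its half of the
`N × N` system and `|y⟩` of its half of the `K × K` system: the first `⌈log₂ N⌉` qubits hold `i` in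
binary, lowest bit first, the next `⌈log₂ K⌉` qubits hold `y`, and all the others are `0`. -/
def load (N K w : ℕ) (i : Fin N) (y : Fin K) (q : Fin w) : Bool :=
  if (q : ℕ) < Nat.clog 2 N then (i : ℕ).testBit q else (y : ℕ).testBit (q - Nat.clog 2 N)

/-- The isometry that loads an `N × N` system and a `K × K` system into the qubits of the
parties. -/
def loadMat (N K w : ℕ) :
    Matrix (Basis w) ((Fin N × Fin N) × (Fin K × Fin K)) ℂ :=
  Matrix.of fun s a =>
    if s = fun pq => match pq.1 with
      | .alice => load N K w a.1.1 a.2.1 pq.2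
      | .bob => load N K w a.1.2 a.2.2 pq.2
    then 1 else 0

/-- A circuit that acts by local operations and classical communication on an `N × N` system and
the auxiliary `K × K` system: each party has `width` qubits, and the steps are performed in order.
At the end, Alice measures the qubit `flag` and announces the result; `1` means failure. Otherwise
each party outputs the `M`-dimensional system that is written in binary, lowest bit first, on the
qubits `out`, and all the other qubits are discarded. -/
structure Circuit (N K M : ℕ) where
  width : ℕ
  width_le : Nat.clog 2 N + Nat.clog 2 K ≤ width
  steps : List (Step width)
  flag : Fin width
  out : Party → Fin (Nat.clog 2 M) ↪ Fin width

namespace Circuit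

variable {N K M : ℕ} (P : Circuit N K M)

/-- The size of a circuit: the number of its steps and of its qubits. -/
def size : ℕ := P.steps.length + 2 * P.width

/-- The unnormalized states before the final measurement of the flag, for all sequences of
measurement results, on the input `ρ` and the auxiliary input `Ψ_K`. -/
def branches (ρ : Matrix (Fin N × Fin N) (Fin N × Fin N) ℂ) :
    List (Matrix (Basis P.width) (Basis P.width) ℂ) :=
  run P.steps (loadMat N K P.width * (ρ ⊗ₖ dyad (maxEnt K)) * (loadMat N K P.width)ᴴ)

/-- The probability that the circuit fails on the input `ρ`. -/
def failProb (ρ : Matrix (Fin N × Fin N) (Fin N × Fin N) ℂ) : ℝ :=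
  ((P.branches ρ).map fun σ => ((proj (Party.alice, P.flag) true * σ).trace).re).sum

/-- The unnormalized final states without failure. -/
def successes (ρ : Matrix (Fin N × Fin N) (Fin N × Fin N) ℂ) :
    List (Matrix (Basis P.width) (Basis P.width) ℂ) :=
  (P.branches ρ).map fun σ =>
    proj (Party.alice, P.flag) false * σ * proj (Party.alice, P.flag) false

/-- In the basis state `s`, the output qubits of Alice hold `a.1` and those of Bob hold `a.2`. -/
def Reads (s : Basis P.width) (a : Fin M × Fin M) : Prop :=
  ∀ l : Fin (Nat.clog 2 M),
    s (Party.alice, P.out Party.alice l) = (a.1 : ℕ).testBit l ∧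
    s (Party.bob, P.out Party.bob l) = (a.2 : ℕ).testBit l

open Classical in
/-- The partial trace over all the qubits that are not output, in terms of the basis of the
`M × M` system. -/
def output (τ : Matrix (Basis P.width) (Basis P.width) ℂ) :
    Matrix (Fin M × Fin M) (Fin M × Fin M) ℂ :=
  Matrix.of fun a b => ∑ s, ∑ s',
    if P.Reads s a ∧ P.Reads s' b ∧
        (∀ p q, q ∉ Set.range (P.out p) → s (p, q) = s' (p, q))
    then τ s s' else 0

/-- The probability of success. -/
def succProb (ρ : Matrix (Fin N × Fin N) (Fin N × Fin N) ℂ) : ℝ :=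
  ((P.successes ρ).map fun τ => τ.trace.re).sum

open Classical in
/-- The probability that the circuit succeeds and that its (normalized) output state, given all
the measurement results, has fidelity at least `1 - δ`. -/
def goodProb (ρ : Matrix (Fin N × Fin N) (Fin N × Fin N) ℂ) (δ : ℝ) : ℝ :=
  ((P.successes ρ).map fun τ =>
    if 1 - δ ≤ fidelity (((τ.trace)⁻¹) • P.output τ) then τ.trace.re else 0).sum

end Circuit

/-- A general entanglement purification protocol with input in an `N × N` system, auxiliary input
`Ψ_K` and output in an `M × M` system, given by a circuit. On every input state, a circuit that
does not fail has to leave a state of the `M × M` system on its output qubits, that is, no weight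
may lie on bit strings that do not represent numbers below `M`. -/
structure GEPP (N K M : ℕ) extends Circuit N K M where
  output_mem : ∀ ρ, IsDensity ρ → ∀ τ ∈ toCircuit.successes ρ,
    (toCircuit.output τ).trace = τ.trace

/-- The protocol is deterministically conditionally successful with parameter
`⟨N, K, M, ε, δ, p⟩` for mixed states in the diagonal subspace: the probability of failure is at
most `p`, and the conditional probability, given success, that the output has fidelity at least
`1 - δ` is `1`. -/
def GEPP.DetSuccessful {N K M : ℕ} (P : GEPP N K M) (ε δ p : ℝ) : Prop :=
  ∀ ρ : Matrix (Fin N × Fin N) (Fin N × Fin N) ℂ, InDiagonal ρ → fidelity ρ = 1 - ε →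
    P.failProb ρ ≤ p ∧ P.goodProb ρ δ / P.succProb ρ = 1

end Purification

end

/-! Identify the N = 2 ^ a basis states with vectors x over the field with two elements, and let
invertible matrices A_y, for y < K, be given. From Σ α_x |x⟩|x⟩ and the maximally entangled Σ
|y⟩|y⟩, both parties compute A_y x in place. Each then measures the last t digits of A_y x in the
Hadamard basis. The run is accepted when the two strings of results agree. The output is y together
with the s = a - t digits that were not measured, so with L = 2 ^ t the output dimension M = 2 ^ s K
satisfies M L = N K.

Let μ(y, x) be the pair of y and the first s digits of A_y x. Up to a phase, each of the L accepting
branches maps the input to (L √K)⁻¹ Σ α_x |μ(y, x)⟩|μ(y, x)⟩. Suppose that any two distinct vectors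
collide under exactly λ of the K hash functions. Then the squared norm of this vector depends only
on Σ |α_x|² = 1 and |Σ α_x|² = N F (`card_mul_sum_pairs`). Its overlap with the maximally entangled
state depends only on |Σ α_x|². Both quantities are linear in the dyad of the input, so mixtures
behave in the same way. Every accepting branch therefore has output fidelity F / S, where S is the
total success probability.

Counting gives λ (N - 1) = K (L - 1), whence S = 1 - ε N (L - 1) / (L (N - 1)). This is at least 1 -
ε. The output infidelity is ε (N - L) / (L (N - 1) S), and the two bounds on δ follow from S > 1/2
and from ε N ≤ L respectively (`Circuit.Hashing.detSuccessful`).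

By linearity, the collision condition says that for each x ≠ 0 exactly λ of the vectors A_y x vanish
in the first s digits. Two families satisfy it. In the first, A_y is multiplication by the nonzero
elements of the field with 2 ^ n elements, so A_y x runs through all nonzero vectors and λ = 2 ^ t -
1 (`exists_gepp_field`). In the second, y numbers the lines through 0 in the d-dimensional space
over that field, and the unmeasured part of A_y x vanishes exactly on the y-th line. Since every
nonzero vector lies on one line, λ = 1 (`exists_gepp_lines`). The second parameter set is the case d
= 2 of the third.

For efficiency, the entries of A_y and of its inverse are computed from the digits of y by
straight-line programs of length polynomial in a. Their reversible form yields the in-place map by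
computing A_y x, erasing x with the inverse matrix and uncomputing the entries
(`exists_gates_mulVec`). `exists_gepp` turns any such family of matrices into a protocol. The
analysis stays elementary because Hadamard gates occur only just before measurements, so every
branch operator sends basis states to multiples of basis states. -/

noncomputable section

namespace Purification

section

variable {w : ℕ}

/-! ### Kraus operators of a list of steps -/

/-- The Kraus operators of a list of steps, one for each sequence of measurement results. -/
def krausList : List (Step w) → List (Matrix (Basis w) (Basis w) ℂ)
  | [] => [1]
  | o :: os => o.kraus.flatMap fun A => (krausList os).map (· * A)

theorem run_eq_map (l : List (Step w)) (σ : Matrix (Basis w) (Basis w) ℂ) :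
    run l σ = (krausList l).map fun A => A * σ * Aᴴ := by
  induction l generalizing σ with
  | nil => simp [run, krausList]
  | cons o os ih =>
    simp only [run, krausList, List.map_flatMap, List.map_map]
    congr 1
    funext A
    rw [ih]
    refine List.map_congr_left fun B _ => ?_
    simp [Matrix.mul_assoc, Matrix.conjTranspose_mul]

theorem krausList_append (l₁ l₂ : List (Step w)) :
    krausList (l₁ ++ l₂) =
      (krausList l₁).flatMap fun A => (krausList l₂).map (· * A) := by
  induction l₁ with
  | nil => simp [krausList]
  | cons o os ih =>
    simp only [List.cons_append, krausList, ih, List.flatMap_assoc, List.map_flatMap,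
      List.flatMap_map, List.map_map]
    congr 1; funext A; congr 1; funext B
    refine List.map_congr_left fun C _ => ?_
    simp [Matrix.mul_assoc]

/-! ### Monomial operators -/

/-- The operator that maps each basis state `|s⟩` to `c s • |f s⟩`. -/
def monoMat {ι κ : Type*} [DecidableEq κ] (m : (ι → ℂ) × (ι → κ)) : Matrix κ ι ℂ :=
  Matrix.of fun s' s => if s' = m.2 s then m.1 s else 0

/-- Composition of monomial operators: first `m₁`, then `m₂`. -/
def monoComp {ι κ η : Type*} (m₂ : (κ → ℂ) × (κ → η)) (m₁ : (ι → ℂ) × (ι → κ)) :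
    (ι → ℂ) × (ι → η) :=
  (fun s => m₁.1 s * m₂.1 (m₁.2 s), fun s => m₂.2 (m₁.2 s))

section mono

variable {ι κ η : Type*} [DecidableEq κ] [DecidableEq η]

theorem monoMat_mul [Fintype κ] (m₂ : (κ → ℂ) × (κ → η)) (m₁ : (ι → ℂ) × (ι → κ)) :
    monoMat m₂ * monoMat m₁ = monoMat (monoComp m₂ m₁) := by
  ext s' s
  simp only [monoMat, monoComp, Matrix.mul_apply, Matrix.of_apply]
  rw [Finset.sum_eq_single (m₁.2 s)]
  · by_cases h : s' = m₂.2 (m₁.2 s) <;> simp [h, mul_comm]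
  · intro b _ hb; simp [hb]
  · simp

theorem conjTranspose_monoMat_mul_apply [Fintype κ] (m m' : (ι → ℂ) × (ι → κ)) (s s' : ι) :
    ((monoMat m)ᴴ * monoMat m') s s' =
      if m.2 s = m'.2 s' then star (m.1 s) * m'.1 s' else 0 := by
  simp only [monoMat, Matrix.mul_apply, Matrix.conjTranspose_apply, Matrix.of_apply]
  rw [Finset.sum_eq_single (m.2 s)]
  · simp
  · intro b _ hb; simp [hb]
  · simp

theorem monoMat_mulVec [Fintype ι] (m : (ι → ℂ) × (ι → κ)) (v : ι → ℂ) (s : κ) :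
    (monoMat m *ᵥ v) s = ∑ i, if s = m.2 i then m.1 i * v i else 0 := by
  simp [monoMat, Matrix.mulVec, dotProduct]

end mono

theorem basisMap_eq_monoMat (f : Basis w → Basis w) : basisMap f = monoMat (fun _ => 1, f) := rfl

theorem conjTranspose_basisMap_mul {f : Basis w → Basis w} (hf : Function.Injective f) :
    (basisMap f)ᴴ * basisMap f = 1 := by
  ext s s'
  rw [basisMap_eq_monoMat, conjTranspose_monoMat_mul_apply]
  simp [Matrix.one_apply, hf.eq_iff]

theorem proj_eq_monoMat (a : Party × Fin w) (b : Bool) :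
    proj a b = monoMat (fun s => if s a = b then 1 else 0, id) := by
  ext s s'
  by_cases h : s = s'
  · subst h; simp [proj, monoMat]
  · simp [proj, monoMat, h]

theorem proj_mul_self (a : Party × Fin w) (b : Bool) : (proj a b)ᴴ * proj a b = proj a b := by
  simp only [proj, Matrix.diagonal_conjTranspose, Matrix.diagonal_mul_diagonal]
  congr 1; funext s; by_cases h : s a = b <;> simp [h]

theorem proj_conjTranspose (a : Party × Fin w) (b : Bool) : (proj a b)ᴴ = proj a b := by
  simp only [proj, Matrix.diagonal_conjTranspose]
  congr 1; funext s; by_cases h : s a = b <;> simp [h]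

theorem proj_false_add_proj_true (a : Party × Fin w) : proj a false + proj a true = 1 := by
  simp only [proj, Matrix.diagonal_add, ← Matrix.diagonal_one]
  congr 1; funext s; cases s a <;> simp

/-- The sign `(-1)^b`. -/
def sgn (b : Bool) : ℂ := if b then -1 else 1

/-- The amplitude `1/√2`. -/
def rt : ℂ := ((1 / Real.sqrt 2 : ℝ) : ℂ)

theorem rt_mul_rt : rt * rt = 1 / 2 := by
  rw [rt, ← Complex.ofReal_mul, div_mul_div_comm, Real.mul_self_sqrt (by norm_num)]
  norm_num

theorem star_rt : star rt = rt := by simp [rt]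

theorem star_sgn (b : Bool) : star (sgn b) = sgn b := by cases b <;> simp [sgn]

theorem sgn_mul_self (b : Bool) : sgn b * sgn b = 1 := by cases b <;> simp [sgn]

/-- The part of the Hadamard gate that leaves the value `b` on qubit `a`. -/
def hadPart (a : Party × Fin w) (b : Bool) : (Basis w → ℂ) × (Basis w → Basis w) :=
  (fun s => rt * sgn (b && s a), fun s => Function.update s a b)

theorem hadamardMat_apply (a : Party × Fin w) (s' s : Basis w) :
    hadamardMat a s' s = monoMat (hadPart a (s' a)) s' s := by
  simp only [hadamardMat, monoMat, hadPart, Matrix.of_apply, sgn, rt]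
  have : (∀ c, c ≠ a → s' c = s c) ↔ s' = Function.update s a (s' a) := by
    rw [Function.eq_update_iff]; simp
  exact if_congr this rfl rfl

theorem proj_mul_hadamardMat (a : Party × Fin w) (b : Bool) :
    proj a b * hadamardMat a = monoMat (hadPart a b) := by
  ext s' s
  rw [proj, Matrix.diagonal_mul, hadamardMat_apply]
  by_cases h : s' a = b
  · subst h; simp
  · have : s' ≠ Function.update s a b := fun h' => h (by rw [h']; simp)
    simp [h, monoMat, hadPart, this]

/-- A Hadamard gate alone is not monomial, but each of its two parts with a fixed outgoing value of
the qubit is. A measurement that follows the gate selects one of them. -/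
theorem hadamardMat_eq (a : Party × Fin w) :
    hadamardMat a = monoMat (hadPart a false) + monoMat (hadPart a true) := by
  rw [← proj_mul_hadamardMat, ← proj_mul_hadamardMat, ← Matrix.add_mul,
    proj_false_add_proj_true, Matrix.one_mul]

theorem conjTranspose_hadamardMat_mul (a : Party × Fin w) :
    (hadamardMat a)ᴴ * hadamardMat a = 1 := by
  have key : ∀ s s' : Basis w, ∀ b b' : Bool,
      Function.update s a b = Function.update s' a b' ↔ b = b' ∧ ∀ c, c ≠ a → s c = s' c := by
    intro s s' b b'
    rw [Function.update_eq_iff]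
    constructor
    · rintro ⟨h1, h2⟩
      refine ⟨by simpa using h1, fun c hc => ?_⟩
      simpa [hc] using h2 c hc
    · rintro ⟨h1, h2⟩
      refine ⟨by simpa using h1, fun c hc => ?_⟩
      simpa [hc] using h2 c hc
  ext s s'
  rw [hadamardMat_eq, Matrix.conjTranspose_add, Matrix.add_mul, Matrix.mul_add, Matrix.mul_add]
  simp only [Matrix.add_apply, conjTranspose_monoMat_mul_apply]
  simp only [hadPart, key]
  by_cases h : ∀ c, c ≠ a → s c = s' c
  · have heq : s = s' ↔ s a = s' a := by
      constructor
      · rintro rfl; rfl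
      · intro h'
        funext c
        by_cases hc : c = a
        · rw [hc, h']
        · exact h c hc
    simp only [Matrix.one_apply, heq, eq_true h, and_true, star_mul', star_rt, star_sgn]
    have h2 := rt_mul_rt
    cases s a <;> cases s' a <;> simp [sgn] <;> linear_combination 2 * h2
  · have : s ≠ s' := by rintro rfl; exact h fun _ _ => rfl
    simp only [eq_false h, and_false, if_false, add_zero, Matrix.one_apply, this]

theorem negate_injective (a : Party × Fin w) : Function.Injective (negate a) := by
  refine Function.Involutive.injective fun s => ?_
  simp [negate]

/-- Completeness of the Kraus operators, that is, trace preservation; it makes the probabilities of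
failure and success add up to 1. -/
theorem Step.sum_conjTranspose_mul (o : Step w) :
    (o.kraus.map fun A => Aᴴ * A).sum = 1 := by
  cases o with
  | flip p q => simpa [Step.kraus] using conjTranspose_basisMap_mul (negate_injective (p, q))
  | hadamard p q => simpa [Step.kraus] using conjTranspose_hadamardMat_mul (p, q)
  | phase p q =>
    simp only [Step.kraus, List.map_cons, List.map_nil, List.sum_cons, List.sum_nil, add_zero,
      phaseMat, Matrix.diagonal_conjTranspose, Matrix.diagonal_mul_diagonal,
      ← Matrix.diagonal_one]
    congr 1
    funext s
    by_cases h : s (p, q) = true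
    · simp only [h, if_true, Pi.star_apply, RCLike.star_def]
      rw [← Complex.exp_conj, ← Complex.exp_add, map_mul, Complex.conj_ofReal, Complex.conj_I]
      simp
    · simp [h]
  | cnot p c q h =>
    simp only [Step.kraus, List.map_cons, List.map_nil, List.sum_cons, List.sum_nil, add_zero]
    refine conjTranspose_basisMap_mul (Function.Involutive.injective fun s => ?_)
    have : (p, c) ≠ (p, q) := by simpa using h
    simp [Function.update_of_ne this]
  | toffoli p b c q hbc hb hc =>
    simp only [Step.kraus, List.map_cons, List.map_nil, List.sum_cons, List.sum_nil, add_zero]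
    refine conjTranspose_basisMap_mul (Function.Involutive.injective fun s => ?_)
    have h1 : (p, c) ≠ (p, q) := by simpa using hc
    have h2 : (p, b) ≠ (p, q) := by simpa using hb
    simp [Function.update_of_ne h1, Function.update_of_ne h2]
  | send p q r =>
    simp only [Step.kraus, List.map_cons, List.map_nil, List.sum_cons, List.sum_nil, add_zero,
      Matrix.conjTranspose_mul]
    rw [Matrix.mul_assoc, ← Matrix.mul_assoc _ (basisMap _),
      conjTranspose_basisMap_mul (negate_injective _), Matrix.one_mul, proj_mul_self,
      proj_mul_self, proj_false_add_proj_true]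

theorem sum_trace_run (l : List (Step w)) (σ : Matrix (Basis w) (Basis w) ℂ) :
    ((run l σ).map Matrix.trace).sum = σ.trace := by
  induction l generalizing σ with
  | nil => simp [run]
  | cons o os ih =>
    have h1 : ∀ L : List (Matrix (Basis w) (Basis w) ℂ),
        ((L.flatMap fun A => run os (A * σ * Aᴴ)).map Matrix.trace).sum =
          (((L.map fun A => Aᴴ * A).sum) * σ).trace := by
      intro L
      induction L with
      | nil => simp
      | cons A L ihL =>
        simp only [List.flatMap_cons, List.map_append, List.sum_append, ihL, ih, List.map_cons,
          List.sum_cons, Matrix.add_mul, Matrix.trace_add]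
        rw [Matrix.trace_mul_comm, Matrix.mul_assoc]
    rw [run, h1, Step.sum_conjTranspose_mul, Matrix.one_mul]

/-! ### Lists of steps with monomial Kraus operators -/

/-- All the Kraus operators of the list of steps `l` are monomial, and are given by `D`. -/
def IsMono (l : List (Step w)) (D : List ((Basis w → ℂ) × (Basis w → Basis w))) : Prop :=
  krausList l = D.map monoMat

theorem IsMono.append {l₁ l₂ : List (Step w)} {D₁ D₂} (h₁ : IsMono l₁ D₁) (h₂ : IsMono l₂ D₂) :
    IsMono (l₁ ++ l₂) (D₁.flatMap fun m₁ => D₂.map fun m₂ => monoComp m₂ m₁) := by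
  rw [IsMono, krausList_append, h₁, h₂]
  simp only [List.flatMap_map, List.map_map, List.map_flatMap]
  congr 1; funext m₁
  refine List.map_congr_left fun m₂ _ => ?_
  simp [monoMat_mul]

theorem monoMat_one : monoMat ((fun _ => 1, id) : (Basis w → ℂ) × (Basis w → Basis w)) = 1 := by
  ext s s'
  simp [monoMat, Matrix.one_apply]

theorem isMono_nil : IsMono ([] : List (Step w)) [(fun _ => 1, id)] := by
  simp [IsMono, krausList, monoMat_one]

theorem isMono_singleton {o : Step w} {f : Basis w → Basis w} (h : o.kraus = [basisMap f]) :
    IsMono [o] [(fun _ => 1, f)] := by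
  simp [IsMono, krausList, h, basisMap_eq_monoMat]

/-- The operator of a measurement of qubit `q` of party `p` in the Hadamard basis, with result `b`,
which is added to qubit `r` of the other party. -/
def measPart (p : Party) (q r : Fin w) (b : Bool) : (Basis w → ℂ) × (Basis w → Basis w) :=
  (fun s => rt * sgn (b && s (p, q)),
    fun s => Function.update (Function.update s (p, q) b) (p.other, r) (xor (s (p.other, r)) b))

theorem Party.other_ne (p : Party) : p.other ≠ p := by cases p <;> simp [Party.other]

/-- The projection onto result b keeps only the part of the Hadamard gate with outgoing value b. The
conditional negation by the other party merely permutes basis states, so both branches are monomial.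
-/
theorem isMono_meas (p : Party) (q r : Fin w) :
    IsMono [.hadamard p q, .send p q r] [measPart p q r false, measPart p q r true] := by
  have hne : (p.other, r) ≠ (p, q) := by
    intro h; exact p.other_ne (Prod.ext_iff.1 h).1
  have e1 : measPart p q r false = hadPart (p, q) false := by
    refine Prod.ext rfl ?_
    funext s
    simp only [measPart, hadPart, Bool.xor_false]
    conv_lhs => rw [← Function.update_of_ne hne false s]
    exact Function.update_eq_self _ _
  have e2 : monoMat (measPart p q r true) =
      basisMap (negate (p.other, r)) * monoMat (hadPart (p, q) true) := by
    rw [basisMap_eq_monoMat, monoMat_mul]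
    congr 1
    refine Prod.ext ?_ ?_
    · funext s; simp [measPart, hadPart, monoComp]
    · funext s; simp [measPart, hadPart, monoComp, negate, Function.update_of_ne hne]
  simp [IsMono, krausList, Step.kraus, e1, e2, Matrix.mul_assoc, proj_mul_hadamardMat]

end

section

/-! ### Dyads and fidelities -/

theorem mul_dyad_mul_conjTranspose {ι κ : Type*} [Fintype ι] (T : Matrix κ ι ℂ) (χ : ι → ℂ) :
    T * dyad χ * Tᴴ = dyad (T *ᵥ χ) := by
  rw [dyad, Matrix.mul_vecMulVec, Matrix.vecMulVec_mul, dyad, Matrix.star_mulVec]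

theorem dyad_kronecker_dyad {ι κ : Type*} (φ : ι → ℂ) (ψ : κ → ℂ) :
    dyad φ ⊗ₖ dyad ψ = dyad fun a : ι × κ => φ a.1 * ψ a.2 := by
  ext a b
  simp [dyad, vecMulVec_apply]
  ring

theorem sum_diag {n : ℕ} {β : Type*} [AddCommMonoid β] (f : Fin n × Fin n → β)
    (hf : ∀ a, a.1 ≠ a.2 → f a = 0) : ∑ a, f a = ∑ i, f (i, i) := by
  rw [Fintype.sum_prod_type]
  refine Finset.sum_congr rfl fun i _ => ?_
  rw [Finset.sum_eq_single i]
  · intro j _ hj; exact hf _ (Ne.symm hj)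
  · simp

theorem sqrt_inv_mul_self (N : ℕ) :
    ((1 / Real.sqrt N : ℝ) : ℂ) * ((1 / Real.sqrt N : ℝ) : ℂ) = 1 / (N : ℂ) := by
  rw [← Complex.ofReal_mul, div_mul_div_comm, Real.mul_self_sqrt (Nat.cast_nonneg N)]
  simp

theorem fidelity_eq {N : ℕ} (ρ : Matrix (Fin N × Fin N) (Fin N × Fin N) ℂ) :
    fidelity ρ = (1 / (N : ℂ) * ∑ i, ∑ j, ρ (i, i) (j, j)).re := by
  unfold fidelity
  congr 1
  rw [dotProduct, sum_diag]
  · rw [Finset.mul_sum]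
    refine Finset.sum_congr rfl fun i _ => ?_
    rw [Matrix.mulVec, dotProduct, sum_diag]
    · rw [Finset.mul_sum, Finset.mul_sum]
      refine Finset.sum_congr rfl fun j _ => ?_
      rw [← sqrt_inv_mul_self]
      simp [maxEnt]
      ring
    · intro a ha; simp [maxEnt, ha]
  · intro a ha; simp [maxEnt, ha]

/-! ### Vectors spanned by basis states -/

/-- Evaluates a sesquilinear expression at the vector Σ g q |F q⟩. Injectivity of F is not assumed,
since the labels of colliding inputs give the same basis state; both the norm and the overlap of a
branch come from this. -/
theorem sum_mul_star_of_sum_ite {κ Q : Type*} [Fintype κ] [DecidableEq κ] [Fintype Q]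
    (F : Q → κ) (g : Q → ℂ) (G : κ → κ → ℂ) :
    ∑ s, ∑ s', G s s' * ((∑ q, if s = F q then g q else 0) *
        star (∑ q, if s' = F q then g q else 0)) =
      ∑ q, ∑ q', G (F q) (F q') * (g q * star (g q')) := by
  have h1 : ∀ s s', G s s' * ((∑ q, if s = F q then g q else 0) *
      star (∑ q, if s' = F q then g q else 0)) =
      ∑ q, ∑ q', if s = F q then if s' = F q' then G s s' * (g q * star (g q')) else 0 else 0 := by
    intro s s'
    rw [star_sum, Finset.sum_mul_sum]
    simp only [Finset.mul_sum]
    refine Finset.sum_congr rfl fun q _ => Finset.sum_congr rfl fun q' _ => ?_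
    by_cases h : s = F q <;> by_cases h' : s' = F q' <;> simp [h, h']
  simp only [h1]
  rw [Finset.sum_congr rfl fun s _ => Finset.sum_comm]
  rw [Finset.sum_comm]
  refine Finset.sum_congr rfl fun q _ => ?_
  rw [Finset.sum_eq_single (F q)]
  · rw [Finset.sum_comm]
    refine Finset.sum_congr rfl fun q' _ => ?_
    simp
  · intro s _ hs; simp [hs]
  · simp

theorem trace_dyad_of_sum_ite {κ Q : Type*} [Fintype κ] [DecidableEq κ] [Fintype Q]
    (F : Q → κ) (g : Q → ℂ) :
    (dyad fun s => ∑ q, if s = F q then g q else 0).trace =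
      ∑ q, ∑ q', if F q = F q' then g q * star (g q') else 0 := by
  have h := sum_mul_star_of_sum_ite F g fun s s' => if s = s' then 1 else 0
  simp only [ite_mul, one_mul, zero_mul, Finset.sum_ite_eq, Finset.mem_univ, if_true] at h
  rw [← h]
  simp [Matrix.trace, dyad, vecMulVec_apply]

/-- Since μ reveals y, only pairs with equal y contribute. The product of α i and the conjugate of α
j is then counted K times if i = j and `lam` times otherwise, that is, `lam` times everywhere and K
- `lam` more times on the diagonal. -/
theorem card_mul_sum_pairs {K N : ℕ} {R : Type*} (μ : Fin K × Fin N → R) [DecidableEq R]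
    (lam : ℕ) (h₁ : ∀ q q', μ q = μ q' → q.1 = q'.1)
    (h₂ : ∀ i j, i ≠ j → (Finset.univ.filter fun y => μ (y, i) = μ (y, j)).card = lam)
    (α : Fin N → ℂ) :
    (∑ q : Fin K × Fin N, ∑ q' : Fin K × Fin N,
        if μ q = μ q' then α q.2 * star (α q'.2) else 0) =
      ((K : ℂ) - lam) * ∑ i, α i * star (α i) + lam * ((∑ i, α i) * star (∑ i, α i)) := by
  have h3 : (∑ q : Fin K × Fin N, ∑ q' : Fin K × Fin N,
        if μ q = μ q' then α q.2 * star (α q'.2) else 0) =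
      ∑ i, ∑ j, ∑ y, if μ (y, i) = μ (y, j) then α i * star (α j) else 0 := by
    rw [Fintype.sum_prod_type, Finset.sum_comm]
    refine Finset.sum_congr rfl fun i _ => ?_
    rw [Finset.sum_comm (s := Finset.univ (α := Fin N))]
    refine Finset.sum_congr rfl fun y _ => ?_
    rw [Fintype.sum_prod_type, Finset.sum_eq_single y]
    · intro y' _ hy'
      refine Finset.sum_eq_zero fun j _ => if_neg fun h => hy' ?_
      exact (h₁ _ _ h).symm
    · simp
  have h4 : ∀ i j, (∑ y, if μ (y, i) = μ (y, j) then α i * star (α j) else 0) =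
      (if i = j then ((K : ℂ) - lam) * (α i * star (α j)) else 0) +
        lam * (α i * star (α j)) := by
    intro i j
    by_cases hij : i = j
    · subst hij
      simp
      ring
    · rw [← Finset.sum_filter, Finset.sum_const, h₂ i j hij]
      simp [hij]
  rw [h3, star_sum, Finset.sum_mul_sum]
  simp only [h4, Finset.sum_add_distrib, Finset.sum_ite_eq, Finset.mem_univ, if_true,
    Finset.mul_sum]

namespace Circuit

variable {N K M : ℕ} (P : Circuit N K M)

theorem Reads.unique {P : Circuit N K M} {s : Basis P.width} {a b : Fin M × Fin M}
    (ha : P.Reads s a) (hb : P.Reads s b) : a = b := by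
  have key : ∀ m m' : Fin M, (∀ l : Fin (Nat.clog 2 M), (m : ℕ).testBit l = (m' : ℕ).testBit l) →
      m = m' := by
    intro m m' h
    have hM : M ≤ 2 ^ Nat.clog 2 M := Nat.le_pow_clog (by norm_num) M
    refine Fin.ext (Nat.eq_of_testBit_eq fun l => ?_)
    by_cases hl : l < Nat.clog 2 M
    · exact h ⟨l, hl⟩
    · have h2 : 2 ^ Nat.clog 2 M ≤ 2 ^ l := Nat.pow_le_pow_right (by norm_num) (by omega)
      rw [Nat.testBit_lt_two_pow (by omega), Nat.testBit_lt_two_pow (by omega)]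
  refine Prod.ext (key _ _ fun l => ?_) (key _ _ fun l => ?_)
  · rw [← (ha l).1, (hb l).1]
  · rw [← (ha l).2, (hb l).2]

theorem Reads.eq_of_rest {P : Circuit N K M} {s s' : Basis P.width} {a : Fin M × Fin M}
    (h : P.Reads s a) (h' : P.Reads s' a)
    (hr : ∀ p q, q ∉ Set.range (P.out p) → s (p, q) = s' (p, q)) : s = s' := by
  funext pq
  obtain ⟨p, q⟩ := pq
  by_cases hq : q ∈ Set.range (P.out p)
  · obtain ⟨l, rfl⟩ := hq
    cases p
    · rw [(h l).1, (h' l).1]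
    · rw [(h l).2, (h' l).2]
  · exact hr p q hq

/-- A basis state reads as at most one output, and it is determined by that output and the discarded
qubits. Hence every diagonal entry of τ that represents an output is counted exactly once. -/
theorem trace_output {τ : Matrix (Basis P.width) (Basis P.width) ℂ}
    (h : ∀ s, τ s s ≠ 0 → ∃ a, P.Reads s a) : (P.output τ).trace = τ.trace := by
  classical
  have h1 : ∀ a, P.output τ a a = ∑ s, if P.Reads s a then τ s s else 0 := by
    intro a
    simp only [output, Matrix.of_apply]
    refine Finset.sum_congr rfl fun s _ => ?_
    rw [Finset.sum_eq_single s]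
    · exact if_congr ⟨fun h => h.1, fun h => ⟨h, h, fun _ _ _ => rfl⟩⟩ rfl rfl
    · intro s' _ hs'
      refine if_neg ?_
      rintro ⟨h2, h3, h4⟩
      exact hs' (h3.eq_of_rest h2 fun p q hq => (h4 p q hq).symm)
    · simp
  simp only [Matrix.trace, Matrix.diag_apply, h1]
  rw [Finset.sum_comm]
  refine Finset.sum_congr rfl fun s _ => ?_
  by_cases hs : ∃ a, P.Reads s a
  · obtain ⟨a, ha⟩ := hs
    rw [Finset.sum_eq_single a]
    · rw [if_pos ha]
    · intro b _ hb
      exact if_neg fun h' => hb (h'.unique ha)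
    · simp
  · have : τ s s = 0 := by
      by_contra h0
      exact hs (h s h0)
    simp [this]

/-- The sum `∑ ⟨m m|output|m' m'⟩`, which is `M` times the fidelity of the output. -/
def overlap (τ : Matrix (Basis P.width) (Basis P.width) ℂ) : ℂ :=
  ∑ m, ∑ m', P.output τ (m, m) (m', m')

theorem fidelity_smul_output (c : ℂ) (τ : Matrix (Basis P.width) (Basis P.width) ℂ) :
    fidelity (c • P.output τ) = (1 / (M : ℂ) * (c * P.overlap τ)).re := by
  rw [fidelity_eq, overlap]
  simp only [Matrix.smul_apply, smul_eq_mul, Finset.mul_sum]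

theorem overlap_sum {κ : Type*} [Fintype κ] (p : κ → ℂ)
    (τ : κ → Matrix (Basis P.width) (Basis P.width) ℂ) :
    P.overlap (∑ k, p k • τ k) = ∑ k, p k * P.overlap (τ k) := by
  classical
  have : ∀ a b, P.output (∑ k, p k • τ k) a b = ∑ k, p k * P.output (τ k) a b := by
    intro a b
    simp only [output, Matrix.of_apply, Finset.mul_sum]
    rw [Finset.sum_comm (s := Finset.univ (α := κ))]
    refine Finset.sum_congr rfl fun s _ => ?_
    rw [Finset.sum_comm]
    refine Finset.sum_congr rfl fun s' _ => ?_
    split_ifs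
    · simp [Matrix.sum_apply]
    · simp
  simp only [overlap, this, Finset.mul_sum]
  rw [Finset.sum_congr rfl fun m _ => Finset.sum_comm]
  rw [Finset.sum_comm]

/-- As the discarded qubits have the same values in all the states F q, the partial trace causes no
decoherence: all cross terms survive, and the overlap is the squared modulus of the sum of the
amplitudes. -/
theorem overlap_dyad_of_sum_ite {Q : Type*} [Fintype Q] (F : Q → Basis P.width)
    (μ : Q → Fin M) (g : Q → ℂ) (hF : ∀ q, P.Reads (F q) (μ q, μ q))
    (hr : ∀ q q' p r, r ∉ Set.range (P.out p) → F q (p, r) = F q' (p, r)) :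
    P.overlap (dyad fun s => ∑ q, if s = F q then g q else 0) =
      (∑ q, g q) * star (∑ q, g q) := by
  classical
  have h1 : ∀ m m', P.output (dyad fun s => ∑ q, if s = F q then g q else 0) (m, m) (m', m') =
      ∑ q, ∑ q', (if μ q = m ∧ μ q' = m' then 1 else 0) * (g q * star (g q')) := by
    intro m m'
    have h := sum_mul_star_of_sum_ite F g fun s s' =>
      if P.Reads s (m, m) ∧ P.Reads s' (m', m') ∧
        (∀ p q, q ∉ Set.range (P.out p) → s (p, q) = s' (p, q)) then 1 else 0
    have h2 : ∀ q m, P.Reads (F q) (m, m) ↔ μ q = m := by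
      intro q m
      constructor
      · intro h'
        exact (Prod.ext_iff.1 ((hF q).unique h')).1
      · rintro rfl; exact hF q
    refine Eq.trans ?_ (h.trans ?_)
    · simp only [output, Matrix.of_apply, dyad, vecMulVec_apply, Pi.star_apply]
      refine Finset.sum_congr rfl fun s _ => Finset.sum_congr rfl fun s' _ => ?_
      split_ifs <;> simp
    · refine Finset.sum_congr rfl fun q _ => Finset.sum_congr rfl fun q' _ => ?_
      congr 1
      refine if_congr ?_ rfl rfl
      rw [h2, h2]
      have := hr q q'
      tauto
  simp only [overlap, h1]
  rw [star_sum, Finset.sum_mul_sum, Finset.sum_congr rfl fun m _ => Finset.sum_comm]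
  rw [Finset.sum_comm]
  refine Finset.sum_congr rfl fun q _ => ?_
  rw [Finset.sum_congr rfl fun m _ => Finset.sum_comm]
  rw [Finset.sum_comm]
  refine Finset.sum_congr rfl fun q' _ => ?_
  simp only [← Finset.sum_mul, ite_and]
  simp

end Circuit

end

section

/-! ### Analysis of circuits with monomial branches -/

/-- The basis state of the qubits that holds the given basis states of the two systems. -/
def loadBasis (N K w : ℕ) (a : (Fin N × Fin N) × (Fin K × Fin K)) : Basis w :=
  fun pq => match pq.1 with
      | .alice => load N K w a.1.1 a.2.1 pq.2
      | .bob => load N K w a.1.2 a.2.2 pq.2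

theorem loadMat_eq_monoMat (N K w : ℕ) :
    loadMat N K w = monoMat (fun _ => 1, loadBasis N K w) := rfl

/-- The input basis state in which both parties hold `q.2` and `q.1`. -/
def diagInput {N K : ℕ} (q : Fin K × Fin N) : (Fin N × Fin N) × (Fin K × Fin K) :=
  ((q.2, q.2), (q.1, q.1))

theorem monoMat_mulVec_diag {N K : ℕ} {κ : Type*} [DecidableEq κ]
    (m : ((Fin N × Fin N) × (Fin K × Fin K) → ℂ) × ((Fin N × Fin N) × (Fin K × Fin K) → κ))
    (φ : Fin N × Fin N → ℂ) (hφ : ∀ a : Fin N × Fin N, a.1 ≠ a.2 → φ a = 0) :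
    (monoMat m *ᵥ fun a => φ a.1 * maxEnt K a.2) = fun s =>
      ∑ q : Fin K × Fin N, if s = m.2 (diagInput q) then
        m.1 (diagInput q) * (φ (q.2, q.2) * ((1 / Real.sqrt K : ℝ) : ℂ)) else 0 := by
  funext s
  rw [monoMat_mulVec, Fintype.sum_prod_type, sum_diag, Fintype.sum_prod_type,
    Finset.sum_comm (s := (Finset.univ : Finset (Fin K)))]
  · refine Finset.sum_congr rfl fun i _ => ?_
    rw [sum_diag]
    · refine Finset.sum_congr rfl fun y _ => ?_
      simp [diagInput, maxEnt]
    · intro b hb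
      simp [maxEnt, hb]
  · intro a ha
    simp [hφ a ha]

namespace Circuit

variable {N K M : ℕ} (P : Circuit N K M)

/-- The input to the operator of a branch, followed by the projection onto success. -/
def succMono (m : (Basis P.width → ℂ) × (Basis P.width → Basis P.width)) :
    ((Fin N × Fin N) × (Fin K × Fin K) → ℂ) ×
      ((Fin N × Fin N) × (Fin K × Fin K) → Basis P.width) :=
  (fun a => m.1 (loadBasis N K P.width a) *
      (if m.2 (loadBasis N K P.width a) (Party.alice, P.flag) = false then 1 else 0),
    fun a => m.2 (loadBasis N K P.width a))

theorem proj_mul_mul_loadMat (m : (Basis P.width → ℂ) × (Basis P.width → Basis P.width)) :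
    proj (Party.alice, P.flag) false * monoMat m * loadMat N K P.width =
      monoMat (P.succMono m) := by
  rw [proj_eq_monoMat, loadMat_eq_monoMat, monoMat_mul, monoMat_mul]
  congr 1
  refine Prod.ext ?_ rfl
  funext a
  simp [monoComp, succMono]

theorem successes_eq_map {D : List ((Basis P.width → ℂ) × (Basis P.width → Basis P.width))}
    (hD : IsMono P.steps D) (ρ : Matrix (Fin N × Fin N) (Fin N × Fin N) ℂ) :
    P.successes ρ = D.map fun m => monoMat (P.succMono m) * (ρ ⊗ₖ dyad (maxEnt K)) *
      (monoMat (P.succMono m))ᴴ := by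
  rw [successes, branches, run_eq_map, hD]
  simp only [List.map_map]
  refine List.map_congr_left fun m _ => ?_
  simp only [Function.comp, ← proj_mul_mul_loadMat, Matrix.conjTranspose_mul, proj_conjTranspose,
    Matrix.mul_assoc]

/-- The flag projections sum to 1, the steps preserve the total trace, and loading is an isometry
because distinct inputs are loaded into distinct basis states. -/
theorem failProb_add_succProb (ρ : Matrix (Fin N × Fin N) (Fin N × Fin N) ℂ)
    (hK : 0 < K) (hρ : ρ.trace = 1)
    (hload : Function.Injective (loadBasis N K P.width)) :
    P.failProb ρ + P.succProb ρ = 1 := by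
  have h1 : ∀ L : List (Matrix (Basis P.width) (Basis P.width) ℂ),
      (L.map fun σ => ((proj (Party.alice, P.flag) true * σ).trace).re).sum +
        ((L.map fun σ => proj (Party.alice, P.flag) false * σ *
          proj (Party.alice, P.flag) false).map fun τ => τ.trace.re).sum =
      ((L.map Matrix.trace).sum).re := by
    intro L
    induction L with
    | nil => simp
    | cons σ L ih =>
      simp only [List.map_cons, List.sum_cons, Complex.add_re]
      rw [← ih]
      have h2 : (proj (Party.alice, P.flag) false * σ * proj (Party.alice, P.flag) false).trace =
          (proj (Party.alice, P.flag) false * σ).trace := by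
        have := proj_mul_self (Party.alice, P.flag) false
        rw [proj_conjTranspose] at this
        rw [Matrix.trace_mul_comm, ← Matrix.mul_assoc, this]
      have h3 : (proj (Party.alice, P.flag) false * σ).trace.re +
          (proj (Party.alice, P.flag) true * σ).trace.re = σ.trace.re := by
        rw [← Complex.add_re, ← Matrix.trace_add, ← Matrix.add_mul, proj_false_add_proj_true,
          Matrix.one_mul]
      rw [h2]
      linarith
  rw [failProb, succProb, successes, h1, branches, sum_trace_run, Matrix.trace_mul_comm,
    ← Matrix.mul_assoc]
  have h4 : (loadMat N K P.width)ᴴ * loadMat N K P.width = 1 := by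
    ext a b
    rw [loadMat_eq_monoMat, conjTranspose_monoMat_mul_apply]
    simp [Matrix.one_apply, hload.eq_iff]
  have h5 : (dyad (maxEnt K)).trace = 1 := by
    simp only [Matrix.trace, Matrix.diag_apply, dyad, vecMulVec_apply, Pi.star_apply]
    rw [sum_diag]
    · have : ∀ i : Fin K, maxEnt K (i, i) * star (maxEnt K (i, i)) = 1 / (K : ℂ) := by
        intro i
        rw [← sqrt_inv_mul_self]
        simp [maxEnt]
      simp only [this]
      have hK' : (K : ℂ) ≠ 0 := by exact_mod_cast hK.ne'
      simp [hK']
    · intro a ha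
      simp [maxEnt, ha]
  rw [h4, Matrix.one_mul, Matrix.trace_kronecker, hρ, h5]
  simp

theorem trace_output_of_isMono
    {D : List ((Basis P.width → ℂ) × (Basis P.width → Basis P.width))}
    (hD : IsMono P.steps D)
    (hreads : ∀ m ∈ D, ∀ a, m.2 (loadBasis N K P.width a) (Party.alice, P.flag) = false →
      ∃ b, P.Reads (m.2 (loadBasis N K P.width a)) b)
    (ρ : Matrix (Fin N × Fin N) (Fin N × Fin N) ℂ) :
    ∀ τ ∈ P.successes ρ, (P.output τ).trace = τ.trace := by
  intro τ hτ
  rw [P.successes_eq_map hD, List.mem_map] at hτ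
  obtain ⟨m, hm, rfl⟩ := hτ
  refine P.trace_output fun s hs => ?_
  rw [Matrix.mul_assoc, Matrix.mul_apply] at hs
  obtain ⟨a, _, ha⟩ := Finset.exists_ne_zero_of_sum_ne_zero hs
  have h1 : monoMat (P.succMono m) s a ≠ 0 := left_ne_zero_of_mul ha
  have h2 : s = m.2 (loadBasis N K P.width a) := by
    by_contra h3
    exact h1 (if_neg h3)
  subst h2
  refine hreads m hm a ?_
  by_contra h3
  exact h1 (by simp [monoMat, succMono, h3])

theorem mul_ensemble_mul {κ Q : Type*} [Fintype Q] {s : ℕ} (p : Fin s → ℂ)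
    (χ : Fin s → Q → ℂ) (T : Matrix κ Q ℂ) :
    T * (∑ k, p k • dyad (χ k)) * Tᴴ = ∑ k, p k • dyad (T *ᵥ χ k) := by
  rw [Matrix.mul_sum, Matrix.sum_mul]
  refine Finset.sum_congr rfl fun k _ => ?_
  rw [Matrix.mul_smul, Matrix.smul_mul, mul_dyad_mul_conjTranspose]

theorem ensemble_kronecker {ι κ : Type*} {s : ℕ} (p : Fin s → ℂ) (φ : Fin s → ι → ℂ)
    (ψ : κ → ℂ) :
    (∑ k, p k • dyad (φ k)) ⊗ₖ dyad ψ = ∑ k, p k • dyad fun a : ι × κ => φ k a.1 * ψ a.2 := by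
  simp only [← dyad_kronecker_dyad]
  ext a b
  simp [Matrix.sum_apply, Finset.sum_mul, mul_assoc]

/-- The combinatorial data of a circuit whose branches, labelled by the list `O`, are monomial:
for each `y`, the map `μ (y, ·)` hashes the `N` basis states, and the branches with `good o` map
the diagonal input `q` to a state with output `μ q`. -/
structure Hashing {Ω : Type*} (O : List Ω)
    (mono : Ω → (Basis P.width → ℂ) × (Basis P.width → Basis P.width)) (good : Ω → Bool)
    (μ : Fin K × Fin N → Fin M) (lam L : ℕ) : Prop where
  isMono : IsMono P.steps (O.map mono)
  load_injective : Function.Injective (loadBasis N K P.width)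
  reads : ∀ o ∈ O, ∀ a,
    (mono o).2 (loadBasis N K P.width a) (Party.alice, P.flag) = false →
      P.Reads ((mono o).2 (loadBasis N K P.width a)) (μ (a.2.1, a.1.1), μ (a.2.2, a.1.2))
  bad : ∀ o ∈ O, good o = false → ∀ q,
    (mono o).2 (loadBasis N K P.width (diagInput q)) (Party.alice, P.flag) = true
  flag_good : ∀ o ∈ O, good o = true → ∀ q,
    (mono o).2 (loadBasis N K P.width (diagInput q)) (Party.alice, P.flag) = false
  coeff_good : ∀ o ∈ O, good o = true → ∃ c : ℂ, c * star c = 1 ∧ ∀ q,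
    (mono o).1 (loadBasis N K P.width (diagInput q)) = c / L
  rest : ∀ o ∈ O, good o = true → ∀ q q' p r, r ∉ Set.range (P.out p) →
    (mono o).2 (loadBasis N K P.width (diagInput q)) (p, r) =
      (mono o).2 (loadBasis N K P.width (diagInput q')) (p, r)
  count : (O.filter good).length = L
  fst_eq : ∀ q q', μ q = μ q' → q.1 = q'.1
  card_eq : ∀ i j, i ≠ j → (Finset.univ.filter fun y => μ (y, i) = μ (y, j)).card = lam
  K_pos : 0 < K
  L_pos : 0 < L
  N_two : 2 ≤ N
  M_mul : M * L = N * K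
  lam_mul : lam * (N - 1) = K * (L - 1)

/-! ### Success probability and output fidelity of a hashing circuit. -/

namespace Hashing

variable {P} {Ω : Type*} {O : List Ω}
  {mono : Ω → (Basis P.width → ℂ) × (Basis P.width → Basis P.width)} {good : Ω → Bool}
  {μ : Fin K × Fin N → Fin M} {lam L : ℕ} (H : P.Hashing O mono good μ lam L)

include H

theorem output_mem (ρ : Matrix (Fin N × Fin N) (Fin N × Fin N) ℂ) :
    ∀ τ ∈ P.successes ρ, (P.output τ).trace = τ.trace := by
  refine P.trace_output_of_isMono H.isMono ?_ ρ
  intro m hm a ha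
  obtain ⟨o, ho, rfl⟩ := List.mem_map.1 hm
  exact ⟨_, H.reads o ho a ha⟩


/-- In a good branch the output qubits show μ q and all others are independent of q, so interference
happens exactly at collisions of μ. -/
theorem apply_eq_iff {o : Ω} (ho : o ∈ O) (hg : good o = true) (q q' : Fin K × Fin N) :
    (mono o).2 (loadBasis N K P.width (diagInput q)) =
      (mono o).2 (loadBasis N K P.width (diagInput q')) ↔ μ q = μ q' := by
  have h1 := H.reads o ho (diagInput q) (H.flag_good o ho hg q)
  have h2 := H.reads o ho (diagInput q') (H.flag_good o ho hg q')
  constructor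
  · intro h
    rw [h] at h1
    exact (Prod.ext_iff.1 (h1.unique h2)).1
  · intro h
    refine Circuit.Reads.eq_of_rest (a := (μ q, μ q)) h1 ?_ fun p r hr =>
      H.rest o ho hg q q' p r hr
    rw [h]
    exact h2

theorem succMono_mulVec {o : Ω} (ho : o ∈ O) (hg : good o = true) {φ : Fin N × Fin N → ℂ}
    (hφ : ∀ a : Fin N × Fin N, a.1 ≠ a.2 → φ a = 0) :
    ∃ c : ℂ, c * star c = 1 ∧
      (monoMat (P.succMono (mono o)) *ᵥ fun a => φ a.1 * maxEnt K a.2) = fun s =>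
        ∑ q : Fin K × Fin N, if s = (mono o).2 (loadBasis N K P.width (diagInput q)) then
          c / L * ((1 / Real.sqrt K : ℝ) : ℂ) * φ (q.2, q.2) else 0 := by
  obtain ⟨c, hc, h⟩ := H.coeff_good o ho hg
  refine ⟨c, hc, ?_⟩
  rw [monoMat_mulVec_diag _ _ hφ]
  funext s
  refine Finset.sum_congr rfl fun q _ => if_congr Iff.rfl ?_ rfl
  simp only [succMono, H.flag_good o ho hg q, h q, if_true]
  ring

theorem coeff_mul_star {c : ℂ} (hc : c * star c = 1) :
    (c / L * ((1 / Real.sqrt K : ℝ) : ℂ)) * star (c / L * ((1 / Real.sqrt K : ℝ) : ℂ)) =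
      1 / ((L : ℂ) ^ 2 * K) := by
  have h1 : star (((1 / Real.sqrt K : ℝ) : ℂ)) = ((1 / Real.sqrt K : ℝ) : ℂ) := by
    simp
  have h2 : star (c / L) = star c / L := by simp
  rw [star_mul', h1, h2]
  have h3 := sqrt_inv_mul_self K
  have hL : (L : ℂ) ≠ 0 := by exact_mod_cast H.L_pos.ne'
  have hK : (K : ℂ) ≠ 0 := by exact_mod_cast H.K_pos.ne'
  calc _ = (c * star c) / (L * L) *
        (((1 / Real.sqrt K : ℝ) : ℂ) * ((1 / Real.sqrt K : ℝ) : ℂ)) := by ring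
    _ = _ := by
      rw [hc, h3]
      field_simp

theorem trace_dyad {o : Ω} (ho : o ∈ O) (hg : good o = true) {φ : Fin N × Fin N → ℂ}
    (hφ : ∀ a : Fin N × Fin N, a.1 ≠ a.2 → φ a = 0) (hn : ∑ a, ‖φ a‖ ^ 2 = 1) :
    (dyad (monoMat (P.succMono (mono o)) *ᵥ fun a => φ a.1 * maxEnt K a.2)).trace =
      1 / ((L : ℂ) ^ 2 * K) *
        ((K - lam) + lam * ((∑ i, φ (i, i)) * star (∑ i, φ (i, i)))) := by
  obtain ⟨c, hc, h⟩ := H.succMono_mulVec ho hg hφ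
  have hn' : ∑ i, φ (i, i) * star (φ (i, i)) = 1 := by
    rw [sum_diag] at hn
    · have : ∀ i, φ (i, i) * star (φ (i, i)) = ((‖φ (i, i)‖ ^ 2 : ℝ) : ℂ) := by
        intro i
        rw [RCLike.star_def, Complex.mul_conj, Complex.normSq_eq_norm_sq]
      simp only [this]
      rw [← Complex.ofReal_sum, hn, Complex.ofReal_one]
    · intro a ha; simp [hφ a ha]
  have h2 := card_mul_sum_pairs μ lam H.fst_eq H.card_eq fun i => φ (i, i)
  rw [hn', mul_one] at h2
  rw [h, trace_dyad_of_sum_ite, ← h2, ← H.coeff_mul_star hc, Finset.mul_sum]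
  refine Finset.sum_congr rfl fun q _ => ?_
  rw [Finset.mul_sum]
  refine Finset.sum_congr rfl fun q' _ => ?_
  rw [if_congr (H.apply_eq_iff ho hg q q') rfl rfl]
  split_ifs
  · rw [star_mul']; ring
  · simp

theorem overlap_dyad {o : Ω} (ho : o ∈ O) (hg : good o = true) {φ : Fin N × Fin N → ℂ}
    (hφ : ∀ a : Fin N × Fin N, a.1 ≠ a.2 → φ a = 0) :
    P.overlap (dyad (monoMat (P.succMono (mono o)) *ᵥ fun a => φ a.1 * maxEnt K a.2)) =
      K / (L : ℂ) ^ 2 * ((∑ i, φ (i, i)) * star (∑ i, φ (i, i))) := by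
  obtain ⟨c, hc, h⟩ := H.succMono_mulVec ho hg hφ
  rw [h, P.overlap_dyad_of_sum_ite _ μ]
  · rw [← Finset.mul_sum, Fintype.sum_prod_type]
    simp only [Finset.sum_const, Finset.card_univ, Fintype.card_fin, nsmul_eq_mul]
    rw [star_mul', mul_mul_mul_comm, H.coeff_mul_star hc, star_mul']
    have hL : (L : ℂ) ≠ 0 := by exact_mod_cast H.L_pos.ne'
    have hK : (K : ℂ) ≠ 0 := by exact_mod_cast H.K_pos.ne'
    rw [star_natCast]
    field_simp
  · intro q
    exact H.reads o ho (diagInput q) (H.flag_good o ho hg q)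
  · intro q q' p r hr
    exact H.rest o ho hg q q' p r hr

-- By linearity in the ensemble, the average of |Σ φ(i, i)|² is N times the fidelity. This is the
-- only way in which the mixture enters the branch probabilities and overlaps.
omit H in
theorem sum_ensemble {s : ℕ} {p : Fin s → ℝ} {φ : Fin s → Fin N × Fin N → ℂ} (hN : N ≠ 0) :
    ∑ k, (p k : ℂ) * ((∑ i, φ k (i, i)) * star (∑ i, φ k (i, i))) =
      ((N * fidelity (∑ k, ((p k : ℝ) : ℂ) • dyad (φ k)) : ℝ) : ℂ) := by
  have h1 : ∑ k, (p k : ℂ) * ((∑ i, φ k (i, i)) * star (∑ i, φ k (i, i))) =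
      ((∑ k, p k * Complex.normSq (∑ i, φ k (i, i)) : ℝ) : ℂ) := by
    rw [Complex.ofReal_sum]
    refine Finset.sum_congr rfl fun k _ => ?_
    rw [RCLike.star_def, Complex.mul_conj, Complex.ofReal_mul]
  have h2 : ∑ i, ∑ j, (∑ k, ((p k : ℝ) : ℂ) • dyad (φ k)) (i, i) (j, j) =
      ∑ k, (p k : ℂ) * ((∑ i, φ k (i, i)) * star (∑ i, φ k (i, i))) := by
    simp only [star_sum, Finset.sum_mul_sum, Matrix.sum_apply, Matrix.smul_apply, smul_eq_mul,
      dyad, vecMulVec_apply, Pi.star_apply]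
    rw [Finset.sum_congr rfl fun i _ => Finset.sum_comm (s := (Finset.univ : Finset (Fin N))),
      Finset.sum_comm]
    refine Finset.sum_congr rfl fun k _ => ?_
    rw [Finset.mul_sum]
    exact Finset.sum_congr rfl fun i _ => by rw [Finset.mul_sum]
  have hN' : (N : ℝ) ≠ 0 := by exact_mod_cast hN
  rw [fidelity_eq, h2, h1]
  congr 1
  have h3 : (1 / (N : ℂ) * ((∑ k, p k * Complex.normSq (∑ i, φ k (i, i)) : ℝ) : ℂ)).re =
      1 / (N : ℝ) * (∑ k, p k * Complex.normSq (∑ i, φ k (i, i))) := by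
    rw [← Complex.ofReal_natCast, ← Complex.ofReal_one, ← Complex.ofReal_div,
      ← Complex.ofReal_mul, Complex.ofReal_re]
  rw [h3]
  field_simp

/-- The unnormalized final state of the branch `o`. -/
def state (mono : Ω → (Basis P.width → ℂ) × (Basis P.width → Basis P.width))
    (ρ : Matrix (Fin N × Fin N) (Fin N × Fin N) ℂ) (o : Ω) :
    Matrix (Basis P.width) (Basis P.width) ℂ :=
  monoMat (P.succMono (mono o)) * (ρ ⊗ₖ dyad (maxEnt K)) * (monoMat (P.succMono (mono o)))ᴴ

theorem successes_eq (ρ : Matrix (Fin N × Fin N) (Fin N × Fin N) ℂ) :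
    P.successes ρ = O.map (state mono ρ) := by
  rw [P.successes_eq_map H.isMono, List.map_map]
  rfl

theorem trace_state {o : Ω} (ho : o ∈ O) (hg : good o = true)
    {ρ : Matrix (Fin N × Fin N) (Fin N × Fin N) ℂ} (hρ : InDiagonal ρ) :
    (state mono ρ o).trace =
      ((1 / ((L : ℝ) ^ 2 * K) * ((K - lam) + lam * (N * fidelity ρ)) : ℝ) : ℂ) := by
  obtain ⟨s, p, φ, -, hp, hn, hφ, rfl⟩ := hρ
  have h1 := sum_ensemble (p := p) (φ := φ) (N := N) (by have := H.N_two; omega)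
  rw [state, ensemble_kronecker, mul_ensemble_mul, Matrix.trace_sum]
  simp only [Matrix.trace_smul, smul_eq_mul, H.trace_dyad ho hg (hφ _) (hn _)]
  simp only [Complex.ofReal_mul, Complex.ofReal_add] at h1 ⊢
  rw [← h1]
  have h2 : ∑ k, (p k : ℂ) = 1 := by rw [← Complex.ofReal_sum, hp, Complex.ofReal_one]
  have h3 : ∀ k, (p k : ℂ) * (1 / ((L : ℂ) ^ 2 * K) *
        ((K - lam) + lam * ((∑ i, φ k (i, i)) * star (∑ i, φ k (i, i))))) =
      1 / ((L : ℂ) ^ 2 * K) * ((K - lam) * p k + lam * (p k *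
        ((∑ i, φ k (i, i)) * star (∑ i, φ k (i, i))))) := by
    intro k; ring
  simp only [h3]
  rw [← Finset.mul_sum, Finset.sum_add_distrib, ← Finset.mul_sum, ← Finset.mul_sum, h2]
  push_cast
  ring

theorem overlap_state {o : Ω} (ho : o ∈ O) (hg : good o = true)
    {ρ : Matrix (Fin N × Fin N) (Fin N × Fin N) ℂ} (hρ : InDiagonal ρ) :
    P.overlap (state mono ρ o) = ((K / (L : ℝ) ^ 2 * (N * fidelity ρ) : ℝ) : ℂ) := by
  obtain ⟨s, p, φ, -, hp, hn, hφ, rfl⟩ := hρ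
  have h1 := sum_ensemble (p := p) (φ := φ) (N := N) (by have := H.N_two; omega)
  rw [state, ensemble_kronecker, mul_ensemble_mul, Circuit.overlap_sum]
  simp only [H.overlap_dyad ho hg (hφ _)]
  rw [Complex.ofReal_mul, ← h1, Finset.mul_sum]
  refine Finset.sum_congr rfl fun k _ => ?_
  push_cast
  ring

theorem state_eq_zero {o : Ω} (ho : o ∈ O) (hg : good o = false)
    {ρ : Matrix (Fin N × Fin N) (Fin N × Fin N) ℂ} (hρ : InDiagonal ρ) :
    state mono ρ o = 0 := by
  obtain ⟨s, p, φ, -, hp, hn, hφ, rfl⟩ := hρ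
  rw [state, ensemble_kronecker, mul_ensemble_mul]
  refine Finset.sum_eq_zero fun k _ => ?_
  rw [monoMat_mulVec_diag _ _ (hφ k)]
  have : ∀ q, (P.succMono (mono o)).1 (diagInput q) = 0 := by
    intro q
    simp [succMono, H.bad o ho hg q]
  ext a b
  simp [this, dyad, vecMulVec_apply]

/-- The probability of success in terms of the fidelity `f` of the input. -/
def successProb (K N lam L : ℕ) (f : ℝ) : ℝ := 1 / ((L : ℝ) * K) * ((K - lam) + lam * (N * f))

omit H in
theorem sum_map_eq_of_filter {f : Ω → ℝ} {c : ℝ} (O : List Ω)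
    (h1 : ∀ o ∈ O, good o = true → f o = c) (h0 : ∀ o ∈ O, good o = false → f o = 0) :
    (O.map f).sum = (O.filter good).length * c := by
  induction O with
  | nil => simp
  | cons o O ih =>
    have ih' := ih (fun x hx => h1 x (List.mem_cons_of_mem _ hx))
      fun x hx => h0 x (List.mem_cons_of_mem _ hx)
    rw [List.map_cons, List.sum_cons, ih']
    cases hg : good o
    · rw [h0 o List.mem_cons_self hg]
      simp [hg]
    · rw [h1 o List.mem_cons_self hg]
      simp [hg]
      ring

theorem succProb_eq {ρ : Matrix (Fin N × Fin N) (Fin N × Fin N) ℂ} (hρ : InDiagonal ρ) :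
    P.succProb ρ = successProb K N lam L (fidelity ρ) := by
  rw [succProb, H.successes_eq, List.map_map, sum_map_eq_of_filter (good := good)
    (c := 1 / ((L : ℝ) ^ 2 * K) * ((K - lam) + lam * (N * fidelity ρ))) O, H.count, successProb]
  · have hL : (L : ℝ) ≠ 0 := by exact_mod_cast H.L_pos.ne'
    have hK : (K : ℝ) ≠ 0 := by exact_mod_cast H.K_pos.ne'
    field_simp
  · intro o ho hg
    rw [Function.comp, H.trace_state ho hg hρ, Complex.ofReal_re]
  · intro o ho hg
    rw [Function.comp, H.state_eq_zero ho hg hρ]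
    simp

/-- A branch has trace S / L and overlap K N F / L², where F is the input fidelity and S is
`successProb`. After division by M times the trace, M L = N K leaves F / S, the same for all good
branches. -/
theorem fidelity_output {o : Ω} (ho : o ∈ O) (hg : good o = true)
    {ρ : Matrix (Fin N × Fin N) (Fin N × Fin N) ℂ} (hρ : InDiagonal ρ) :
    fidelity (((state mono ρ o).trace)⁻¹ • P.output (state mono ρ o)) =
      fidelity ρ / successProb K N lam L (fidelity ρ) := by
  rw [fidelity_smul_output, H.trace_state ho hg hρ, H.overlap_state ho hg hρ,
    ← Complex.ofReal_inv, ← Complex.ofReal_mul, ← Complex.ofReal_natCast, ← Complex.ofReal_one,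
    ← Complex.ofReal_div, ← Complex.ofReal_mul, Complex.ofReal_re, successProb]
  have hL : (L : ℝ) ≠ 0 := by exact_mod_cast H.L_pos.ne'
  have hK : (K : ℝ) ≠ 0 := by exact_mod_cast H.K_pos.ne'
  have hML : (M : ℝ) * L = N * K := by exact_mod_cast H.M_mul
  have hM : (M : ℝ) ≠ 0 := by
    intro h
    have hN := H.N_two
    have : (N : ℝ) * K ≠ 0 := mul_ne_zero (by positivity) hK
    rw [h, zero_mul] at hML
    exact this hML.symm
  have hN : (N : ℝ) * K / (M * L) = 1 := by rw [← hML]; exact div_self (mul_ne_zero hM hL)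
  rw [← mul_one (fidelity ρ / _), ← hN]
  generalize ((K : ℝ) - lam) + lam * (N * fidelity ρ) = X
  -- If the branch probability is 0, both sides are 0 by the convention for inverses.
  rcases eq_or_ne X 0 with rfl | hX
  · simp
  · have hN0 : (N : ℝ) ≠ 0 := by
      have := H.N_two
      positivity
    field_simp
    rw [hML]

-- Cauchy–Schwarz bounds |Σ φ(i, i)|² by N for each member of the ensemble. In `detSuccessful` this
-- yields 0 ≤ ε.
omit H in
theorem fidelity_le_one {ρ : Matrix (Fin N × Fin N) (Fin N × Fin N) ℂ} (hρ : InDiagonal ρ)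
    (hN : N ≠ 0) : fidelity ρ ≤ 1 := by
  obtain ⟨s, p, φ, hp0, hp, hn, hφ, rfl⟩ := hρ
  have h1 := sum_ensemble (p := p) (φ := φ) hN
  have h2 : ∀ k, (∑ i, φ k (i, i)) * star (∑ i, φ k (i, i)) =
      ((‖∑ i, φ k (i, i)‖ ^ 2 : ℝ) : ℂ) := by
    intro k
    rw [RCLike.star_def, Complex.mul_conj, Complex.normSq_eq_norm_sq]
  simp only [h2, ← Complex.ofReal_mul, ← Complex.ofReal_sum] at h1
  have h3 := Complex.ofReal_injective h1
  have h4 : ∀ k, ‖∑ i, φ k (i, i)‖ ^ 2 ≤ N := by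
    intro k
    have hk := hn k
    rw [sum_diag] at hk
    · calc ‖∑ i, φ k (i, i)‖ ^ 2 ≤ (∑ i, ‖φ k (i, i)‖) ^ 2 := by
            gcongr
            exact norm_sum_le _ _
        _ ≤ (Finset.univ : Finset (Fin N)).card * ∑ i, ‖φ k (i, i)‖ ^ 2 :=
            sq_sum_le_card_mul_sum_sq
        _ = N := by rw [hk]; simp
    · intro a ha; simp [hφ k a ha]
  have h5 : ∑ k, p k * ‖∑ i, φ k (i, i)‖ ^ 2 ≤ ∑ k, p k * N :=
    Finset.sum_le_sum fun k _ => mul_le_mul_of_nonneg_left (h4 k) (hp0 k)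
  rw [h3, ← Finset.sum_mul, hp, one_mul] at h5
  have hN' : (0 : ℝ) < N := by positivity
  nlinarith

/-- Every branch that can occur without failure has output fidelity (1 - ε) / S, so only the two
inequalities 1 - ε ≤ S and S - (1 - ε) ≤ δ S are needed. -/
theorem detSuccessful {P' : GEPP N K M} (hP : P'.toCircuit = P) {ε δ : ℝ}
    (hε : ε < 1 / 2) (hδ : δ = 2 * ε / L ∨ (ε ≤ L / N ∧ δ = ε / L)) :
    P'.DetSuccessful ε δ ε := by
  subst hP
  intro ρ hρ hf
  have hN2 : (2 : ℝ) ≤ N := by exact_mod_cast H.N_two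
  have hL1 : (1 : ℝ) ≤ L := by exact_mod_cast H.L_pos
  have hK1 : (1 : ℝ) ≤ K := by exact_mod_cast H.K_pos
  have hlam : (lam : ℝ) * (N - 1) = K * (L - 1) := by
    have h := H.lam_mul
    have hN := H.N_two
    have hL := H.L_pos
    rw [← Nat.cast_one, ← Nat.cast_sub (by omega), ← Nat.cast_sub (by omega)]
    exact_mod_cast h
  set S := successProb K N lam L (fidelity ρ) with hS
  have hSucc := H.succProb_eq hρ
  -- Eliminating `lam` by `lam * (N - 1) = K * (L - 1)` also removes K: S = 1 - ε N (L - 1) / (L (N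
  -- - 1)).
  have hSval : S * (L * (N - 1)) = L * (N - 1) - ε * N * (L - 1) := by
    have h1 : S * (L * K) = (K - lam) + lam * (N * (1 - ε)) := by
      rw [hS, successProb, hf]
      field_simp
    have h2 : S * (L * (N - 1)) * K = (L * (N - 1) - ε * N * (L - 1)) * K := by
      calc _ = (S * (L * K)) * (N - 1) := by ring
        _ = K * (N - 1) + (lam * (N - 1)) * (N * (1 - ε) - 1) := by rw [h1]; ring
        _ = _ := by rw [hlam]; ring
    exact mul_right_cancel₀ (by positivity) h2
  have hML : (P'.toCircuit).failProb ρ + (P'.toCircuit).succProb ρ = 1 := by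
    refine failProb_add_succProb _ ρ H.K_pos ?_ H.load_injective
    obtain ⟨s, p, φ, -, hp, hn, hφ, rfl⟩ := hρ
    have h1 : ∀ k, (dyad (φ k)).trace = 1 := by
      intro k
      have : ∀ a, φ k a * star (φ k a) = ((‖φ k a‖ ^ 2 : ℝ) : ℂ) := by
        intro a
        rw [RCLike.star_def, Complex.mul_conj, Complex.normSq_eq_norm_sq]
      simp only [Matrix.trace, Matrix.diag_apply, dyad, vecMulVec_apply, Pi.star_apply, this]
      rw [← Complex.ofReal_sum, hn, Complex.ofReal_one]
    rw [Matrix.trace_sum]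
    simp only [Matrix.trace_smul, h1, smul_eq_mul, mul_one]
    rw [← Complex.ofReal_sum, hp, Complex.ofReal_one]
  -- A collision count is at most K, so `lam * (N - 1) = K * (L - 1)` would fail for L > N.
  have hLN : (L : ℝ) ≤ N := by
    by_contra! h
    have h1 : (lam : ℝ) ≤ K := by
      have hNf : Nontrivial (Fin N) := Fin.nontrivial_iff_two_le.2 H.N_two
      obtain ⟨i, j, hij⟩ := exists_pair_ne (Fin N)
      rw [← H.card_eq i j hij]
      have := Finset.card_le_univ (Finset.univ.filter fun y => μ (y, i) = μ (y, j))
      rw [Fintype.card_fin] at this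
      exact_mod_cast this
    nlinarith
  have hε0 : 0 ≤ ε := by
    have := fidelity_le_one hρ (by have := H.N_two; omega)
    linarith
  have hD : 0 < (L : ℝ) * (N - 1) := by
    have : (0 : ℝ) < N - 1 := by linarith
    positivity
  have hdiff : (S - (1 - ε)) * (L * (N - 1)) = ε * (N - L) := by linear_combination hSval
  have hS1 : 1 - ε ≤ S := by
    by_contra! h
    have h1 : (S - (1 - ε)) * (L * (N - 1)) < 0 := mul_neg_of_neg_of_pos (by linarith) hD
    have h2 : 0 ≤ ε * (N - L) := mul_nonneg hε0 (by linarith)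
    linarith
  have hδS : S - (1 - ε) ≤ δ * S := by
    have h1 : ε * (N - L) ≤ δ * S * (L * (N - 1)) := by
      -- For δ = 2ε/L it suffices that 2S ≥ 2(1 - ε) > 1 and N - 1 ≥ N - L. For δ = ε/L the
      -- assumption ε N ≤ L turns the formula for S into S L (N - 1) ≥ L (N - 1) - L (L - 1) = L (N
      -- - L).
      rcases hδ with rfl | ⟨hεL, rfl⟩
      · have h2 : 2 * ε / L * S * (L * (N - 1)) = ε * (2 * S * (N - 1)) := by field_simp
        rw [h2]
        refine mul_le_mul_of_nonneg_left ?_ hε0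
        nlinarith
      · have h2 : ε / L * S * (L * (N - 1)) * L = ε * (S * (L * (N - 1))) := by field_simp
        have h3 : ε * N ≤ L := by rwa [le_div_iff₀ (by linarith)] at hεL
        have h4 : (N - L) * L ≤ S * (L * (N - 1)) := by
          rw [hSval]
          nlinarith
        have h5 : ε * (N - L) * L ≤ ε / L * S * (L * (N - 1)) * L := by
          rw [h2, mul_assoc]
          exact mul_le_mul_of_nonneg_left h4 hε0
        exact le_of_mul_le_mul_right h5 (by linarith)
    rw [← hdiff] at h1
    exact le_of_mul_le_mul_right h1 hD
  have hS0 : 0 < S := by linarith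
  refine ⟨by linarith, ?_⟩
  -- Branches with disagreeing results have success weight 0, so it does not matter on which side of
  -- the threshold their meaningless output falls.
  have hgood : (P'.toCircuit).goodProb ρ δ = (P'.toCircuit).succProb ρ := by
    rw [goodProb, succProb, H.successes_eq, List.map_map, List.map_map]
    refine congrArg List.sum (List.map_congr_left fun o ho => ?_)
    simp only [Function.comp]
    cases hg : good o
    · simp [H.state_eq_zero ho hg hρ]
    · rw [H.fidelity_output ho hg hρ, ← hS, hf]
      refine if_pos ?_
      rw [le_div_iff₀ hS0]
      linarith
  rw [hgood, hSucc]
  exact div_self hS0.ne'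

end Hashing

end Circuit

end

section

/-! ### Classical reversible circuits -/

/-- Classical reversible gates on wires that are labelled by natural numbers. -/
inductive Gate
  | not (q : ℕ)
  | cnot (c q : ℕ)
  | toff (b c q : ℕ)

namespace Gate

/-- The wires of a gate. -/
def wires : Gate → List ℕ
  | .not q => [q]
  | .cnot c q => [q, c]
  | .toff b c q => [q, b, c]

/-- The wire that is changed by a gate. -/
def target : Gate → ℕ
  | .not q => q
  | .cnot _ q => q
  | .toff _ _ q => q

/-- The value that a gate adds to its target. -/
def value : Gate → (ℕ → ZMod 2) → ZMod 2
  | .not _, _ => 1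
  | .cnot c _, u => u c
  | .toff b c _, u => u b * u c

/-- The action of a gate. -/
def eval (g : Gate) (u : ℕ → ZMod 2) : ℕ → ZMod 2 :=
  Function.update u g.target (u g.target + g.value u)

theorem target_mem_wires (g : Gate) : g.target ∈ g.wires := by
  cases g <;> simp [target, wires]

theorem value_congr {g : Gate} {u u' : ℕ → ZMod 2} (hg : g.wires.Nodup)
    (h : ∀ q ∈ g.wires, q ≠ g.target → u q = u' q) : g.value u = g.value u' := by
  cases g with
  | not q => rfl
  | cnot c q =>
    simp only [wires, List.nodup_cons, List.mem_cons, List.not_mem_nil, or_false] at hg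
    exact h c (by simp [wires]) (Ne.symm hg.1)
  | toff b c q =>
    simp only [wires, List.nodup_cons, List.mem_cons, List.not_mem_nil, or_false, not_or] at hg
    simp only [value]
    rw [h b (by simp [wires]) (Ne.symm hg.1.1), h c (by simp [wires]) (Ne.symm hg.1.2)]

theorem eval_of_ne {g : Gate} {u : ℕ → ZMod 2} {q : ℕ} (h : q ≠ g.target) :
    g.eval u q = u q := Function.update_of_ne h _ _

theorem eval_eval {g : Gate} (hg : g.wires.Nodup) (u : ℕ → ZMod 2) : g.eval (g.eval u) = u := by
  have h : g.value (g.eval u) = g.value u := value_congr hg fun q _ hq => eval_of_ne hq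
  funext q
  by_cases hq : q = g.target
  · subst hq
    rw [eval, h]
    simp [eval, add_assoc, CharTwo.add_self_eq_zero]
  · rw [eval_of_ne hq, eval_of_ne hq]

/-- The action of a list of gates. -/
def evalL (l : List Gate) (u : ℕ → ZMod 2) : ℕ → ZMod 2 := l.foldl (fun u g => g.eval u) u

@[simp] theorem evalL_nil (u : ℕ → ZMod 2) : evalL [] u = u := rfl

@[simp] theorem evalL_cons (g : Gate) (l : List Gate) (u : ℕ → ZMod 2) :
    evalL (g :: l) u = evalL l (g.eval u) := rfl

theorem evalL_append (l l' : List Gate) (u : ℕ → ZMod 2) :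
    evalL (l ++ l') u = evalL l' (evalL l u) := List.foldl_append

theorem evalL_of_forall_ne {l : List Gate} {u : ℕ → ZMod 2} {q : ℕ}
    (h : ∀ g ∈ l, q ≠ g.target) : evalL l u q = u q := by
  induction l generalizing u with
  | nil => rfl
  | cons g l ih =>
    rw [evalL_cons, ih fun g' hg' => h g' (List.mem_cons_of_mem _ hg'),
      eval_of_ne (h g List.mem_cons_self)]

theorem evalL_reverse_evalL {l : List Gate} (hl : ∀ g ∈ l, g.wires.Nodup) (u : ℕ → ZMod 2) :
    evalL l.reverse (evalL l u) = u := by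
  induction l generalizing u with
  | nil => rfl
  | cons g l ih =>
    rw [List.reverse_cons, evalL_append, evalL_cons g l u,
      ih fun g' hg' => hl g' (List.mem_cons_of_mem _ hg')]
    exact eval_eval (hl g List.mem_cons_self) u

/-- Gates that avoid the wires in `T` act on the other wires only. -/
theorem evalL_override {l : List Gate} {T : Set ℕ} [DecidablePred (· ∈ T)]
    (hl : ∀ g ∈ l, ∀ q ∈ g.wires, q ∉ T) (u z : ℕ → ZMod 2) :
    evalL l (fun q => if q ∈ T then z q else u q) =
      fun q => if q ∈ T then z q else evalL l u q := by
  induction l generalizing u with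
  | nil => rfl
  | cons g l ih =>
    have hg := hl g List.mem_cons_self
    have h1 : g.eval (fun q => if q ∈ T then z q else u q) =
        fun q => if q ∈ T then z q else g.eval u q := by
      have h2 : g.value (fun q => if q ∈ T then z q else u q) = g.value u := by
        cases g with
        | not q => rfl
        | cnot c q => simp [value, hg c (by simp [wires])]
        | toff b c q => simp [value, hg c (by simp [wires]), hg b (by simp [wires])]
      have ht := hg _ g.target_mem_wires
      funext q
      by_cases hq : q = g.target
      · subst hq
        simp [eval, ht, h2]
      · rw [eval_of_ne hq, eval_of_ne hq]
    rw [evalL_cons, h1, ih fun g' hg' => hl g' (List.mem_cons_of_mem _ hg'), evalL_cons]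

/-- A list of Toffoli gates none of whose controls is a target adds up the products of the
controls. -/
theorem evalL_map_toff {T : Set ℕ} (l : List (ℕ × ℕ × ℕ))
    (hl : ∀ x ∈ l, x.1 ∉ T ∧ x.2.1 ∉ T ∧ x.2.2 ∈ T) (u : ℕ → ZMod 2) (q : ℕ) :
    evalL (l.map fun x => .toff x.1 x.2.1 x.2.2) u q =
      u q + (l.map fun x => if x.2.2 = q then u x.1 * u x.2.1 else 0).sum := by
  induction l generalizing u with
  | nil => simp
  | cons x l ih =>
    have hl' : ∀ x ∈ l, x.1 ∉ T ∧ x.2.1 ∉ T ∧ x.2.2 ∈ T :=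
      fun x hx => hl x (List.mem_cons_of_mem _ hx)
    have hx := hl x List.mem_cons_self
    have hu : ∀ r ∉ T, (Gate.toff x.1 x.2.1 x.2.2).eval u r = u r := fun r hr =>
      eval_of_ne fun h => hr (by rw [h]; exact hx.2.2)
    rw [List.map_cons, evalL_cons, ih hl', List.map_cons, List.sum_cons, ← add_assoc]
    congr 1
    · by_cases h : x.2.2 = q
      · subst h
        simp [eval, target, value]
      · rw [if_neg h, add_zero]
        exact eval_of_ne (g := .toff x.1 x.2.1 x.2.2) (Ne.symm h)
    · congr 1
      refine List.map_congr_left fun x' hx' => ?_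
      rw [hu _ (hl' x' hx').1, hu _ (hl' x' hx').2.1]

end Gate

/-! ### Straight-line programs -/

/-- The binary digits of a natural number. -/
def bitZ (n i : ℕ) : ZMod 2 := if n.testBit i then 1 else 0

/-- `Prog a l`: the functions in the list `l`, from the end to the start, can be computed one
after the other from the first `a` binary digits of the argument; each step is a constant, a
digit, or a sum or product of earlier functions. -/
inductive Prog (a : ℕ) {K : ℕ} : List (Fin K → ZMod 2) → Prop
  | nil : Prog a []
  | one {l} : Prog a l → Prog a (1 :: l)
  | bit {l} (i : ℕ) (hi : i < a) : Prog a l → Prog a ((fun y => bitZ y i) :: l)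
  | add {l} (f g) (hf : f ∈ l) (hg : g ∈ l) : Prog a l → Prog a ((f + g) :: l)
  | mul {l} (f g) (hf : f ∈ l) (hg : g ∈ l) : Prog a l → Prog a ((f * g) :: l)

/-- The gates `gs` compute the functions in `l` on the wires `B, B + 1, …`. -/
structure Computes (a B : ℕ) {K : ℕ} (l : List (Fin K → ZMod 2)) (gs : List Gate) : Prop where
  length_le : gs.length ≤ 2 * l.length
  nodup : ∀ g ∈ gs, g.wires.Nodup
  wires : ∀ g ∈ gs, ∀ q ∈ g.wires, (a ≤ q ∧ q < 2 * a) ∨ (B ≤ q ∧ q < B + l.length)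
  target : ∀ g ∈ gs, B ≤ g.target
  value : ∀ f ∈ l, ∃ q, B ≤ q ∧ q < B + l.length ∧ ∀ (y : Fin K) (u : ℕ → ZMod 2),
    (∀ i < a, u (a + i) = bitZ y i) → (∀ r, B ≤ r → u r = 0) → Gate.evalL gs u q = f y

/-- One more program step uses the next free scratch wire as the target of at most two gates.
Earlier results remain intact because no other wire is changed. -/
theorem Computes.snoc {a B K : ℕ} {l : List (Fin K → ZMod 2)} {gs : List Gate}
    (h : Computes a B l gs) {f : Fin K → ZMod 2} (gs' : List Gate) (hlen : gs'.length ≤ 2)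
    (hnd : ∀ g ∈ gs', g.wires.Nodup) (ht : ∀ g ∈ gs', g.target = B + l.length)
    (hw : ∀ g ∈ gs', ∀ q ∈ g.wires, q = g.target ∨ (a ≤ q ∧ q < 2 * a) ∨
      (B ≤ q ∧ q < B + l.length))
    (hf : ∀ (y : Fin K) (u : ℕ → ZMod 2),
      (∀ i < a, u (a + i) = bitZ y i) → (∀ r, B ≤ r → u r = 0) →
        Gate.evalL gs' (Gate.evalL gs u) (B + l.length) = f y) :
    Computes a B (f :: l) (gs ++ gs') where
  length_le := by
    have := h.length_le
    simp only [List.length_append, List.length_cons]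
    omega
  nodup g hg := by
    rcases List.mem_append.1 hg with hg | hg
    exacts [h.nodup g hg, hnd g hg]
  wires g hg q hq := by
    rw [List.length_cons]
    rcases List.mem_append.1 hg with hg | hg
    · have := h.wires g hg q hq
      omega
    · have h1 := hw g hg q hq
      have h2 := ht g hg
      omega
  target g hg := by
    rcases List.mem_append.1 hg with hg | hg
    · exact h.target g hg
    · rw [ht g hg]; omega
  value f' hf' := by
    rw [List.length_cons]
    rcases List.mem_cons.1 hf' with rfl | hf'
    · refine ⟨B + l.length, by omega, by omega, fun y u h1 h2 => ?_⟩
      rw [Gate.evalL_append, hf y u h1 h2]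
    · obtain ⟨q, hq1, hq2, hq⟩ := h.value f' hf'
      refine ⟨q, hq1, by omega, fun y u h1 h2 => ?_⟩
      rw [Gate.evalL_append, Gate.evalL_of_forall_ne, hq y u h1 h2]
      intro g hg
      rw [ht g hg]
      omega

theorem Computes.fresh {a B K : ℕ} {l : List (Fin K → ZMod 2)} {gs : List Gate}
    (h : Computes a B l gs) (hB : 2 * a ≤ B) {u : ℕ → ZMod 2} (hu : ∀ r, B ≤ r → u r = 0) :
    Gate.evalL gs u (B + l.length) = 0 := by
  rw [Gate.evalL_of_forall_ne, hu _ (by omega)]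
  intro g hg
  have := h.wires g hg _ g.target_mem_wires
  omega

theorem Prog.exists_computes {a B K : ℕ} (hB : 2 * a ≤ B) {l : List (Fin K → ZMod 2)}
    (hl : Prog a l) : ∃ gs, Computes a B l gs := by
  induction hl with
  | nil => exact ⟨[], by constructor <;> simp⟩
  | @one l _ ih =>
    obtain ⟨gs, h⟩ := ih
    refine ⟨_, h.snoc [.not (B + l.length)] (by simp) ?_ ?_ ?_ ?_⟩
    · simp [Gate.wires]
    · simp [Gate.target]
    · simp [Gate.wires, Gate.target]
    · intro y u _ h2
      simp [Gate.eval, Gate.target, Gate.value, h.fresh hB h2]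
  | @bit l i hi _ ih =>
    obtain ⟨gs, h⟩ := ih
    refine ⟨_, h.snoc [.cnot (a + i) (B + l.length)] (by simp) ?_ ?_ ?_ ?_⟩
    · simp [Gate.wires]; omega
    · simp [Gate.target]
    · simp [Gate.wires, Gate.target]; omega
    · intro y u h1 h2
      have h3 : Gate.evalL gs u (a + i) = bitZ y i := by
        rw [Gate.evalL_of_forall_ne, h1 i hi]
        intro g hg
        have := h.target g hg
        omega
      simp [Gate.eval, Gate.target, Gate.value, h.fresh hB h2, h3]
  | @add l f g hf hg _ ih =>
    obtain ⟨gs, h⟩ := ih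
    obtain ⟨q, hq1, hq2, hq⟩ := h.value f hf
    obtain ⟨r, hr1, hr2, hr⟩ := h.value g hg
    refine ⟨_, h.snoc [.cnot q (B + l.length), .cnot r (B + l.length)] (by simp) ?_ ?_ ?_ ?_⟩
    · simp [Gate.wires]; omega
    · simp [Gate.target]
    · simp [Gate.wires, Gate.target]; omega
    · intro y u h1 h2
      have : r ≠ B + l.length := by omega
      simp [Gate.eval, Gate.target, Gate.value, h.fresh hB h2, hq y u h1 h2, hr y u h1 h2, this]
  | @mul l f g hf hg _ ih =>
    obtain ⟨gs, h⟩ := ih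
    obtain ⟨q, hq1, hq2, hq⟩ := h.value f hf
    obtain ⟨r, hr1, hr2, hr⟩ := h.value g hg
    -- A Toffoli gate needs distinct controls. When both factors sit on the same wire, their product
    -- is that wire itself, as x = x * x in `ZMod 2`, and a CNOT copies it.
    by_cases hqr : q = r
    · refine ⟨_, h.snoc [.cnot q (B + l.length)] (by simp) ?_ ?_ ?_ ?_⟩
      · simp [Gate.wires]; omega
      · simp [Gate.target]
      · simp [Gate.wires, Gate.target]; omega
      · intro y u h1 h2
        have h3 := hq y u h1 h2
        have h4 := hr y u h1 h2
        rw [← hqr, h3] at h4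
        have h5 : ∀ x : ZMod 2, x = x * x := by decide
        simp [Gate.eval, Gate.target, Gate.value, h.fresh hB h2, h3, ← h4, ← h5]
    · refine ⟨_, h.snoc [.toff q r (B + l.length)] (by simp) ?_ ?_ ?_ ?_⟩
      · simp [Gate.wires]; omega
      · simp [Gate.target]
      · simp [Gate.wires, Gate.target]; omega
      · intro y u h1 h2
        simp [Gate.eval, Gate.target, Gate.value, h.fresh hB h2, hq y u h1 h2, hr y u h1 h2]

/-! ### In-place linear maps that depend on the auxiliary register -/

/-- Given programs for the entries of the matrices `A y` and of their inverses `A' y`, a circuit of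
polynomial size maps `|x⟩|y⟩|0⟩` to `|0⟩|y⟩|A y x⟩`. -/
theorem exists_gates_mulVec {a B K : ℕ} (hB : 3 * a ≤ B)
    {A A' : Fin K → Matrix (Fin a) (Fin a) (ZMod 2)} (hA : ∀ y, A' y * A y = 1)
    {l : List (Fin K → ZMod 2)} (hl : Prog a l) (hlA : ∀ i j, (fun y => A y i j) ∈ l)
    (hlA' : ∀ i j, (fun y => A' y i j) ∈ l) :
    ∃ gs : List Gate, gs.length ≤ 4 * l.length + 2 * a ^ 2 ∧
      (∀ g ∈ gs, g.wires.Nodup ∧ ∀ q ∈ g.wires, q < B + l.length) ∧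
      ∀ (y : Fin K) (u : ℕ → ZMod 2), (∀ i < a, u (a + i) = bitZ y i) →
        (∀ r, 2 * a ≤ r → u r = 0) →
        (∀ i < a, Gate.evalL gs u i = 0) ∧
        (∀ i : Fin a, Gate.evalL gs u (2 * a + i) = (A y *ᵥ fun k => u k) i) ∧
        (∀ q, a ≤ q → (q < 2 * a ∨ 3 * a ≤ q) → Gate.evalL gs u q = u q) := by
  classical
  obtain ⟨C, hC⟩ := hl.exists_computes (B := B) (by omega)
  choose wA hA1 hA2 hA3 using fun i j => hC.value _ (hlA i j)
  choose wB hB1 hB2 hB3 using fun i j => hC.value _ (hlA' i j)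
  let ps : List (Fin a × Fin a) := Finset.univ.toList
  have hps : ps.length = a ^ 2 := by simp [ps, sq]
  let l₁ : List (ℕ × ℕ × ℕ) := ps.map fun x => (wA x.1 x.2, (x.2 : ℕ), 2 * a + x.1)
  let l₂ : List (ℕ × ℕ × ℕ) := ps.map fun x => (wB x.1 x.2, 2 * a + (x.2 : ℕ), (x.1 : ℕ))
  let m₁ : List Gate := l₁.map fun x => .toff x.1 x.2.1 x.2.2
  let m₂ : List Gate := l₂.map fun x => .toff x.1 x.2.1 x.2.2
  have hm₁ : ∀ g ∈ m₁, ∃ i k : Fin a, g = .toff (wA i k) k (2 * a + i) := by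
    intro g hg
    simp only [m₁, l₁, List.mem_map] at hg
    obtain ⟨x, ⟨ik, _, rfl⟩, rfl⟩ := hg
    exact ⟨ik.1, ik.2, rfl⟩
  have hm₂ : ∀ g ∈ m₂, ∃ i k : Fin a, g = .toff (wB i k) (2 * a + k) i := by
    intro g hg
    simp only [m₂, l₂, List.mem_map] at hg
    obtain ⟨x, ⟨ik, _, rfl⟩, rfl⟩ := hg
    exact ⟨ik.1, ik.2, rfl⟩
  have hCw : ∀ g ∈ C, g.wires.Nodup ∧ ∀ q ∈ g.wires, q < B + l.length := by
    intro g hg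
    refine ⟨hC.nodup g hg, fun q hq => ?_⟩
    have := hC.wires g hg q hq
    omega
  -- C writes the matrix entries on scratch wires, `m₁` adds A y x to the zero block at 2a, and `m₂`
  -- adds A' y (A y x) = x to the block at 0, which clears it in characteristic two. The reverse of
  -- C restores the scratch wires.
  refine ⟨C ++ (m₁ ++ m₂) ++ C.reverse, ?_, ?_, ?_⟩
  · have := hC.length_le
    simp only [List.length_append, List.length_reverse, m₁, m₂, l₁, l₂, List.length_map, hps]
    omega
  · intro g hg
    simp only [List.mem_append, List.mem_reverse] at hg
    rcases hg with (hg | hg | hg) | hg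
    · exact hCw g hg
    · obtain ⟨i, k, rfl⟩ := hm₁ g hg
      have h1 := hA1 i k
      have h2 := hA2 i k
      have h3 := i.2
      have h4 := k.2
      constructor
      · simp [Gate.wires]
        omega
      · intro q hq
        simp only [Gate.wires, List.mem_cons, List.not_mem_nil, or_false] at hq
        omega
    · obtain ⟨i, k, rfl⟩ := hm₂ g hg
      have h1 := hB1 i k
      have h2 := hB2 i k
      have h3 := i.2
      have h4 := k.2
      constructor
      · simp [Gate.wires]
        omega
      · intro q hq
        simp only [Gate.wires, List.mem_cons, List.not_mem_nil, or_false] at hq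
        omega
    · exact hCw g hg
  · intro y u hy hu
    set u₁ := Gate.evalL C u with hu₁
    set u₂ := Gate.evalL m₁ u₁ with hu₂
    set u₃ := Gate.evalL m₂ u₂ with hu₃
    have e₁ : ∀ q < B, u₁ q = u q := by
      intro q hq
      refine Gate.evalL_of_forall_ne fun g hg => ?_
      have := hC.target g hg
      omega
    have e₂ : ∀ q, u₂ q = u₁ q + (l₁.map fun x => if x.2.2 = q then u₁ x.1 * u₁ x.2.1 else 0).sum :=
      Gate.evalL_map_toff (T := {q | 2 * a ≤ q ∧ q < 3 * a}) l₁ (by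
        intro x hx
        obtain ⟨ik, _, rfl⟩ := List.mem_map.1 hx
        have h1 := hA1 ik.1 ik.2
        have h3 := ik.1.2
        have h4 := ik.2.2
        simp only [Set.mem_ofPred_eq]
        omega) u₁
    have e₃ : ∀ q, u₃ q = u₂ q + (l₂.map fun x => if x.2.2 = q then u₂ x.1 * u₂ x.2.1 else 0).sum :=
      Gate.evalL_map_toff (T := {q | q < a}) l₂ (by
        intro x hx
        obtain ⟨ik, _, rfl⟩ := List.mem_map.1 hx
        have h1 := hB1 ik.1 ik.2
        have h3 := ik.1.2
        have h4 := ik.2.2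
        simp only [Set.mem_ofPred_eq]
        omega) u₂
    have e₂' : ∀ q, (q < 2 * a ∨ 3 * a ≤ q) → u₂ q = u₁ q := by
      intro q hq
      refine Gate.evalL_of_forall_ne fun g hg => ?_
      obtain ⟨i, k, rfl⟩ := hm₁ g hg
      have h3 := i.2
      simp only [Gate.target]
      omega
    have e₃' : ∀ q, a ≤ q → u₃ q = u₂ q := by
      intro q hq
      refine Gate.evalL_of_forall_ne fun g hg => ?_
      obtain ⟨i, k, rfl⟩ := hm₂ g hg
      have h3 := i.2
      simp only [Gate.target]
      omega
    have f₂ : ∀ i : Fin a, u₂ (2 * a + i) = (A y *ᵥ fun k => u k) i := by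
      intro i
      have hi := i.2
      rw [e₂, e₁ _ (by omega), hu _ (by omega), zero_add, List.map_map, Finset.sum_map_toList,
        Fintype.sum_prod_type, Finset.sum_eq_single i]
      · simp only [Function.comp, if_true, Matrix.mulVec, dotProduct]
        refine Finset.sum_congr rfl fun k _ => ?_
        have hk := k.2
        rw [hu₁, hA3 i k y u hy fun r hr => hu r (by omega), ← hu₁, e₁ _ (by omega)]
      · intro j _ hj
        refine Finset.sum_eq_zero fun k _ => if_neg ?_
        simp only [add_right_inj, ← Fin.ext_iff]
        exact hj
      · simp
    have f₃ : ∀ i : Fin a, u₃ i = 0 := by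
      intro i
      have hi := i.2
      rw [e₃, e₂' _ (by omega), e₁ _ (by omega), List.map_map, Finset.sum_map_toList,
        Fintype.sum_prod_type, Finset.sum_eq_single i]
      · have h1 : ∀ k : Fin a, u₂ (wB i k) = A' y i k := by
          intro k
          have hk := hB1 i k
          rw [e₂' _ (by omega), hu₁, hB3 i k y u hy fun r hr => hu r (by omega)]
        simp only [Function.comp, if_true, h1, f₂]
        have h2 : (A' y *ᵥ (A y *ᵥ fun k => u k)) i = u i := by
          rw [Matrix.mulVec_mulVec, hA, Matrix.one_mulVec]
        rw [Matrix.mulVec, dotProduct] at h2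
        rw [h2, CharTwo.add_self_eq_zero]
      · intro j _ hj
        refine Finset.sum_eq_zero fun k _ => if_neg ?_
        simp only [← Fin.ext_iff]
        exact hj
      · simp
    -- T consists of the two vector blocks, the only wires that `m₁` and `m₂` change. C does not
    -- touch them, so its reverse still undoes it on all the other wires.
    let T : Set ℕ := {q | q < a ∨ (2 * a ≤ q ∧ q < 3 * a)}
    have g₃ : u₃ = fun q => if q ∈ T then u₃ q else u₁ q := by
      funext q
      by_cases hq : q ∈ T
      · rw [if_pos hq]
      · rw [if_neg hq]
        simp only [T, Set.mem_ofPred_eq] at hq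
        rw [e₃' _ (by omega), e₂' _ (by omega)]
    have g₄ : Gate.evalL (C ++ (m₁ ++ m₂) ++ C.reverse) u =
        fun q => if q ∈ T then u₃ q else u q := by
      rw [Gate.evalL_append, Gate.evalL_append, Gate.evalL_append, ← hu₁, ← hu₂, ← hu₃, g₃,
        Gate.evalL_override, hu₁, Gate.evalL_reverse_evalL hC.nodup]
      · funext q
        by_cases hq : q ∈ T <;> simp [hq]
      · intro g hg q hq
        have := hC.wires g (List.mem_reverse.1 hg) q hq
        simp only [T, Set.mem_ofPred_eq]
        omega
    rw [g₄]
    refine ⟨fun i hi => ?_, fun i => ?_, fun q hq1 hq2 => ?_⟩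
    · have : i ∈ T := Or.inl hi
      simp only [this, if_true]
      exact f₃ ⟨i, hi⟩
    · have hi := i.2
      have : 2 * a + (i : ℕ) ∈ T := Or.inr ⟨by omega, by omega⟩
      simp only [this, if_true]
      rw [e₃' _ (by omega), f₂]
    · have : q ∉ T := by simp only [T, Set.mem_ofPred_eq]; omega
      simp only [this, if_false]

end

section

variable {w : ℕ}

/-! ### Implementation of classical gates -/

/-- Elements of `ZMod 2` as Booleans. -/
def toB (x : ZMod 2) : Bool := decide (x = 1)

theorem toB_add (x y : ZMod 2) : toB (x + y) = xor (toB x) (toB y) := by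
  revert x y; decide

theorem toB_mul (x y : ZMod 2) : toB (x * y) = (toB x && toB y) := by
  revert x y; decide

theorem toB_injective : Function.Injective toB := by
  intro x y; revert x y; decide

theorem toB_bitZ (n i : ℕ) : toB (bitZ n i) = n.testBit i := by
  rw [bitZ]; cases n.testBit i <;> simp <;> decide

/-- The basis state given by the values of the wires of the two parties. -/
def wireState (uv : Party → ℕ → ZMod 2) : Basis w := fun pq => toB (uv pq.1 pq.2)

theorem update_wireState (uv : Party → ℕ → ZMod 2) (p : Party) {q : ℕ} (hq : q < w) (x : ZMod 2) :
    Function.update (wireState uv) (p, ⟨q, hq⟩) (toB x) =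
      (wireState (Function.update uv p (Function.update (uv p) q x)) : Basis w) := by
  funext pr
  obtain ⟨p', r, hr⟩ := pr
  by_cases hp : p' = p
  · subst hp
    by_cases h : r = q
    · subst h
      simp [wireState]
    · have : ((p', ⟨r, hr⟩) : Party × Fin w) ≠ (p', ⟨q, hq⟩) := by simp [h]
      rw [Function.update_of_ne this]
      simp [wireState, h]
  · have : ((p', ⟨r, hr⟩) : Party × Fin w) ≠ (p, ⟨q, hq⟩) := by simp [hp]
    rw [Function.update_of_ne this]
    simp [wireState, hp]

/-- The gate `g` is available on `w` qubits. -/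
def Gate.Fits (w : ℕ) (g : Gate) : Prop := g.wires.Nodup ∧ ∀ q ∈ g.wires, q < w

theorem Gate.exists_step (p : Party) {g : Gate} (hg : g.Fits w) :
    ∃ (o : Step w) (f : Basis w → Basis w), o.kraus = [basisMap f] ∧ ∀ uv,
      f (wireState uv) = wireState (Function.update uv p (g.eval (uv p))) := by
  obtain ⟨h1, h2⟩ := hg
  cases g with
  | not q =>
    have hq := h2 q (by simp [wires])
    refine ⟨.flip p ⟨q, hq⟩, _, rfl, fun uv => ?_⟩
    refine Eq.trans ?_ (update_wireState uv p hq (uv p q + 1))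
    rw [negate, toB_add, show toB 1 = true by decide, Bool.xor_true]
    rfl
  | cnot c q =>
    have hq := h2 q (by simp [wires])
    have hc := h2 c (by simp [wires])
    simp only [wires, List.nodup_cons, List.mem_cons, List.not_mem_nil, or_false] at h1
    refine ⟨.cnot p ⟨c, hc⟩ ⟨q, hq⟩ fun h => h1.1 (Fin.ext_iff.1 h).symm, _, rfl, fun uv => ?_⟩
    refine Eq.trans ?_ (update_wireState uv p hq (uv p q + uv p c))
    rw [toB_add]
    rfl
  | toff b c q =>
    have hq := h2 q (by simp [wires])
    have hc := h2 c (by simp [wires])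
    have hb := h2 b (by simp [wires])
    simp only [wires, List.nodup_cons, List.mem_cons, List.not_mem_nil, or_false, not_or] at h1
    refine ⟨.toffoli p ⟨b, hb⟩ ⟨c, hc⟩ ⟨q, hq⟩ (fun h => h1.2.1 (Fin.ext_iff.1 h))
      (fun h => h1.1.1 (Fin.ext_iff.1 h).symm) fun h => h1.1.2 (Fin.ext_iff.1 h).symm,
      _, rfl, fun uv => ?_⟩
    refine Eq.trans ?_ (update_wireState uv p hq (uv p q + uv p b * uv p c))
    rw [toB_add, toB_mul]
    rfl

theorem exists_steps_of_gates (p : Party) {gs : List Gate} (hg : ∀ g ∈ gs, g.Fits w) :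
    ∃ (l : List (Step w)) (f : Basis w → Basis w), l.length = gs.length ∧
      IsMono l [(fun _ => 1, f)] ∧ ∀ uv,
        f (wireState uv) = wireState (Function.update uv p (Gate.evalL gs (uv p))) := by
  induction gs with
  | nil => exact ⟨[], id, rfl, isMono_nil, fun uv => by simp⟩
  | cons g gs ih =>
    obtain ⟨l, f, h1, h2, h3⟩ := ih fun g' hg' => hg g' (List.mem_cons_of_mem _ hg')
    obtain ⟨o, f', h4, h5⟩ := Gate.exists_step p (hg g List.mem_cons_self)
    refine ⟨o :: l, f ∘ f', by simp [h1], ?_, fun uv => ?_⟩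
    · have := (isMono_singleton h4).append h2
      simpa [monoComp, Function.comp_def] using this
    · simp [h5, h3]

/-! ### The disjunction of a list of wires -/

/-- Gates that compute on wire `f + hs.length` the disjunction of wire `f` and the wires in `hs`. -/
def orGates : ℕ → List ℕ → List Gate
  | _, [] => []
  | f, h :: hs => [.cnot f (f + 1), .cnot h (f + 1), .toff f h (f + 1)] ++ orGates (f + 1) hs

theorem length_orGates (f : ℕ) (hs : List ℕ) : (orGates f hs).length = 3 * hs.length := by
  induction hs generalizing f with
  | nil => rfl
  | cons h hs ih => simp [orGates, ih]; ring

theorem orGates_fits {f : ℕ} {hs : List ℕ} (hf : ∀ h ∈ hs, h < f) (hw : f + hs.length < w) :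
    ∀ g ∈ orGates f hs, g.Fits w := by
  induction hs generalizing f with
  | nil => simp [orGates]
  | cons h hs ih =>
    have hh := hf h List.mem_cons_self
    rw [List.length_cons] at hw
    intro g hg
    rw [orGates, List.mem_append] at hg
    rcases hg with hg | hg
    · simp only [List.mem_cons, List.not_mem_nil, or_false] at hg
      rcases hg with rfl | rfl | rfl <;> refine ⟨by simp [Gate.wires] <;> omega, fun q hq => ?_⟩ <;>
        simp only [Gate.wires, List.mem_cons, List.not_mem_nil, or_false] at hq <;> omega
    · refine ih (fun h' hh' => ?_) (by omega) g hg
      have := hf h' (List.mem_cons_of_mem _ hh')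
      omega

/-- Over `ZMod 2` the disjunction is x + y + x y, accumulated along fresh wires. When all inputs are
0 the chain leaves no trace, so in accepting branches its intermediate wires do not distinguish
between inputs. -/
theorem evalL_orGates {f : ℕ} {hs : List ℕ} (hf : ∀ h ∈ hs, h < f) {u : ℕ → ZMod 2}
    (hu : ∀ q, f < q → u q = 0) :
    (Gate.evalL (orGates f hs) u (f + hs.length) = 0 ↔ u f = 0 ∧ ∀ h ∈ hs, u h = 0) ∧
      (u f = 0 → (∀ h ∈ hs, u h = 0) → Gate.evalL (orGates f hs) u = u) := by
  induction hs generalizing f u with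
  | nil => simp [orGates]
  | cons h hs ih =>
    have hh := hf h List.mem_cons_self
    have hv : Gate.evalL [.cnot f (f + 1), .cnot h (f + 1), .toff f h (f + 1)] u =
        Function.update u (f + 1) (u f + u h + u f * u h) := by
      have h1 : h ≠ f + 1 := by omega
      simp [Gate.eval, Gate.target, Gate.value, hu (f + 1) (by omega), h1]
    set v := Function.update u (f + 1) (u f + u h + u f * u h) with hvdef
    have hv1 : v (f + 1) = u f + u h + u f * u h := by simp [hvdef]
    have hv2 : ∀ q, q ≠ f + 1 → v q = u q := fun q hq => by simp [hvdef, hq]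
    have hor : ∀ x y : ZMod 2, x + y + x * y = 0 ↔ x = 0 ∧ y = 0 := by decide
    obtain ⟨i1, i2⟩ := @ih (f + 1) (fun h' hh' => by
      have := hf h' (List.mem_cons_of_mem _ hh')
      omega) v (fun q hq => by rw [hv2 q (by omega), hu q (by omega)])
    have hhs : (∀ h' ∈ hs, v h' = 0) ↔ ∀ h' ∈ hs, u h' = 0 := by
      refine forall₂_congr fun h' hh' => ?_
      have := hf h' (List.mem_cons_of_mem _ hh')
      rw [hv2 h' (by omega)]
    rw [orGates, Gate.evalL_append, hv]
    constructor
    · rw [List.length_cons, show f + (hs.length + 1) = f + 1 + hs.length by ring, i1, hv1, hor,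
        hhs, List.forall_mem_cons, and_assoc]
    · intro h1 h2
      rw [List.forall_mem_cons] at h2
      have hvu : v = u := by
        funext q
        by_cases hq : q = f + 1
        · subst hq
          rw [hv1, h1, h2.1, hu _ (by omega)]
          simp
        · exact hv2 q hq
      rw [i2 (by rw [hv1, h1, h2.1]; simp) (hhs.2 h2.2), hvu]

/-! ### Comparison of Hadamard measurements -/

/-- All sequences of `t` pairs of measurement results. -/
def outcomes : ℕ → List (List (Bool × Bool))
  | 0 => [[]]
  | t + 1 => [(false, false), (false, true), (true, false), (true, true)].flatMap
      fun ab => (outcomes t).map (ab :: ·)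

/-- The results of the two parties agree. -/
def agree (o : List (Bool × Bool)) : Bool := o.all fun ab => ab.1 == ab.2

/-- At each position two of the four pairs of results agree. This is the number L of accepting
branches. -/
theorem length_filter_agree (t : ℕ) : ((outcomes t).filter agree).length = 2 ^ t := by
  have h1 : ∀ (ab : Bool × Bool) (O : List (List (Bool × Bool))),
      ((O.map (ab :: ·)).filter agree).length =
        if ab.1 = ab.2 then (O.filter agree).length else 0 := by
    intro ab O
    rw [List.filter_map, List.length_map]
    have : agree ∘ (ab :: ·) = fun o => (ab.1 == ab.2) && agree o := by
      funext o; simp [agree]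
    rw [this]
    obtain ⟨a, b⟩ := ab
    cases a <;> cases b <;> simp
  induction t with
  | zero => rfl
  | succ t ih =>
    rw [outcomes, List.filter_flatMap, List.length_flatMap]
    simp only [List.map_cons, List.map_nil, h1, ih, List.sum_cons, List.sum_nil]
    simp
    ring

/-- The results `ab` of the Hadamard measurements of qubit `q` by Alice, then by Bob. -/
def comparePart (q : Fin w) (ab : Bool × Bool) : (Basis w → ℂ) × (Basis w → Basis w) :=
  monoComp (measPart .bob q q ab.2) (measPart .alice q q ab.1)

theorem isMono_compare (q : Fin w) :
    IsMono [.hadamard .alice q, .send .alice q q, .hadamard .bob q, .send .bob q q]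
      ([(false, false), (false, true), (true, false), (true, true)].map (comparePart q)) := by
  simpa [comparePart] using (isMono_meas Party.alice q q).append (isMono_meas Party.bob q q)

/-- Booleans as elements of `ZMod 2`. -/
def toZ (b : Bool) : ZMod 2 := if b then 1 else 0

theorem toB_toZ (b : Bool) : toB (toZ b) = b := by revert b; decide

theorem comparePart_snd {q : ℕ} (hq : q < w) (ab : Bool × Bool) (uv : Party → ℕ → ZMod 2) :
    (comparePart (⟨q, hq⟩ : Fin w) ab).2 (wireState uv) = wireState fun p =>
      Function.update (uv p) q (if p = .alice then toZ ab.1 + toZ ab.2 else toZ ab.2) := by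
  funext pr
  obtain ⟨p, r, hr⟩ := pr
  obtain ⟨a, b⟩ := ab
  cases p
  · by_cases h : r = q
    · subst h
      simp [comparePart, monoComp, measPart, Party.other, wireState, toB_add, toB_toZ]
    · simp [comparePart, monoComp, measPart, Party.other, wireState, h]
  · by_cases h : r = q
    · subst h
      simp [comparePart, monoComp, measPart, Party.other, wireState, toB_toZ]
    · simp [comparePart, monoComp, measPart, Party.other, wireState, h]

/-- If both parties hold the bit x, Alice's result a contributes the sign (-1)^(a x). Her message
turns Bob's bit into x + a, so his equal result contributes (-1)^(a (x + a)). The dependence on x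
cancels, and the coherence between different values of the measured digit is kept. -/
theorem comparePart_fst {q : ℕ} (hq : q < w) (a : Bool) {uv : Party → ℕ → ZMod 2}
    (huv : uv .alice q = uv .bob q) :
    (comparePart (⟨q, hq⟩ : Fin w) (a, a)).1 (wireState uv) = sgn a / 2 := by
  simp only [comparePart, monoComp, measPart, Party.other, wireState, huv]
  have h := rt_mul_rt
  cases a <;> cases toB (uv .bob q) <;> simp [sgn] <;>
    first | linear_combination h | linear_combination -h

/-- The order of the quantifiers is the point: the values β left on Bob's wires and the phase c
depend on the results only, not on the input. Alice's wires end as the sums of the two results, and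
hence are all 0 precisely when the results agree. -/
theorem exists_compare_steps {qs : List ℕ} (hqs : qs.Nodup) (hw : ∀ q ∈ qs, q < w) :
    ∃ (l : List (Step w)) (mono : List (Bool × Bool) → (Basis w → ℂ) × (Basis w → Basis w)),
      l.length = 4 * qs.length ∧ IsMono l ((outcomes qs.length).map mono) ∧
      ∀ o ∈ outcomes qs.length, ∃ (β : ℕ → ZMod 2) (c : ℂ), c * star c = 1 ∧
        ∀ uv, ∃ uv', (mono o).2 (wireState uv) = wireState uv' ∧
          (∀ p, ∀ q ∉ qs, uv' p q = uv p q) ∧ (∀ q ∈ qs, uv' .bob q = β q) ∧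
          (agree o = true → ∀ q ∈ qs, uv' .alice q = 0) ∧
          (agree o = false → ∃ q ∈ qs, uv' .alice q ≠ 0) ∧
          (agree o = true → (∀ q ∈ qs, uv .alice q = uv .bob q) →
            (mono o).1 (wireState uv) = c / 2 ^ qs.length) := by
  induction qs with
  | nil =>
    refine ⟨[], fun _ => (fun _ => 1, id), rfl, isMono_nil, fun o ho => ?_⟩
    refine ⟨0, 1, by simp, fun uv => ⟨uv, rfl, by simp, by simp, by simp, ?_, by simp⟩⟩
    simp only [outcomes, List.length_nil, List.mem_singleton] at ho
    subst ho
    simp [agree]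
  | cons q qs ih =>
    rw [List.nodup_cons] at hqs
    have hq := hw q List.mem_cons_self
    obtain ⟨l, mono, h1, h2, h3⟩ := ih hqs.2 fun r hr => hw r (List.mem_cons_of_mem _ hr)
    refine ⟨[.hadamard .alice ⟨q, hq⟩, .send .alice ⟨q, hq⟩ ⟨q, hq⟩, .hadamard .bob ⟨q, hq⟩,
        .send .bob ⟨q, hq⟩ ⟨q, hq⟩] ++ l, fun o => monoComp (mono o.tail)
      (comparePart ⟨q, hq⟩ (o.head?.getD (false, false))), ?_, ?_, ?_⟩
    · simp [h1]; ring
    · have := (isMono_compare (⟨q, hq⟩ : Fin w)).append h2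
      rw [IsMono, this]
      congr 1
      simp only [List.length_cons, outcomes, List.map_flatMap, List.flatMap_map, List.map_map]
      rfl
    · intro o ho
      simp only [List.length_cons, outcomes, List.mem_flatMap, List.mem_map] at ho
      obtain ⟨ab, -, o, ho, rfl⟩ := ho
      obtain ⟨β, c, hc, h4⟩ := h3 o ho
      refine ⟨Function.update β q (toZ ab.2), sgn ab.1 * c, ?_, fun uv => ?_⟩
      · rw [star_mul', mul_mul_mul_comm, hc, star_sgn, sgn_mul_self, one_mul]
      · set uv₁ : Party → ℕ → ZMod 2 := fun p => Function.update (uv p) q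
          (if p = .alice then toZ ab.1 + toZ ab.2 else toZ ab.2) with huv₁
        obtain ⟨uv', e1, e2, e3, e4, e5, e6⟩ := h4 uv₁
        have e7 : ∀ p r, r ≠ q → uv₁ p r = uv p r := fun p r hr => by simp [huv₁, hr]
        have e8 : uv₁ .alice q = toZ ab.1 + toZ ab.2 := by simp [huv₁]
        have e9 : uv₁ .bob q = toZ ab.2 := by simp [huv₁]
        have hab : ∀ a b : Bool, toZ a + toZ b = 0 ↔ a = b := by decide
        have hag : agree (ab :: o) = true ↔ ab.1 = ab.2 ∧ agree o = true := by simp [agree]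
        refine ⟨uv', ?_, ?_, ?_, ?_, ?_, ?_⟩
        · simp only [monoComp, List.tail_cons, List.head?_cons, Option.getD_some]
          rw [comparePart_snd hq, e1]
        · intro p r hr
          rw [List.mem_cons, not_or] at hr
          rw [e2 p r hr.2, e7 p r hr.1]
        · intro r hr
          by_cases hrq : r = q
          · subst hrq
            rw [e2 _ _ hqs.1, e9]
            simp
          · rw [Function.update_of_ne hrq]
            exact e3 r ((List.mem_cons.1 hr).resolve_left hrq)
        · intro hg r hr
          rw [hag] at hg
          rcases List.mem_cons.1 hr with rfl | hr
          · rw [e2 _ _ hqs.1, e8, hab]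
            exact hg.1
          · exact e4 hg.2 r hr
        · intro hg
          by_cases hab' : ab.1 = ab.2
          · obtain ⟨r, hr, hr'⟩ := e5 (by
              by_contra h
              rw [Bool.not_eq_false] at h
              rw [hag.2 ⟨hab', h⟩] at hg
              exact absurd hg (by simp))
            exact ⟨r, List.mem_cons_of_mem _ hr, hr'⟩
          · refine ⟨q, List.mem_cons_self, ?_⟩
            rw [e2 _ _ hqs.1, e8, Ne, hab]
            exact hab'
        · intro hg huv
          rw [hag] at hg
          obtain ⟨a, b⟩ := ab
          obtain ⟨hab', hg⟩ := hg
          simp only at hab'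
          subst hab'
          simp only [monoComp, List.tail_cons, List.head?_cons, Option.getD_some]
          rw [comparePart_fst hq a (huv q List.mem_cons_self), comparePart_snd hq, e6 hg]
          · rw [List.length_cons, pow_succ]
            field_simp
          · intro r hr
            have hrq : r ≠ q := fun h => hqs.1 (h ▸ hr)
            rw [e7 _ r hrq, e7 _ r hrq]
            exact huv r (List.mem_cons_of_mem _ hr)

end

section

/-! ### Protocols from families of linear hash functions -/

/-- The bit vector of a number below `2 ^ a`. -/
def bitVec {a : ℕ} (i : Fin (2 ^ a)) : Fin a → ZMod 2 := fun k => bitZ i k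

theorem bitZ_inj {m n j : ℕ} : bitZ m j = bitZ n j ↔ m.testBit j = n.testBit j := by
  rw [← toB_bitZ, ← toB_bitZ, toB_injective.eq_iff]

theorem bitVec_injective {a : ℕ} : Function.Injective (bitVec (a := a)) := by
  intro i j h
  refine Fin.ext (Nat.eq_of_testBit_eq fun k => ?_)
  by_cases hk : k < a
  · exact bitZ_inj.1 (congrFun h ⟨k, hk⟩)
  · have : 2 ^ a ≤ 2 ^ k := Nat.pow_le_pow_right (by norm_num) (by omega)
    rw [Nat.testBit_lt_two_pow (by omega), Nat.testBit_lt_two_pow (by omega)]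

theorem bitZ_eq_zero {n j : ℕ} (h : n < 2 ^ j) : bitZ n j = 0 := by
  simp [bitZ, Nat.testBit_lt_two_pow h]

/-- The number whose binary digits are the first `s` entries of a vector. -/
def lowBits {a s : ℕ} (hs : s ≤ a) (v : Fin a → ZMod 2) : ℕ :=
  Nat.ofBits fun l : Fin s => toB (v (Fin.castLE hs l))

theorem lowBits_lt {a s : ℕ} (hs : s ≤ a) (v : Fin a → ZMod 2) : lowBits hs v < 2 ^ s :=
  Nat.ofBits_lt_two_pow _

theorem testBit_lowBits {a s : ℕ} (hs : s ≤ a) (v : Fin a → ZMod 2) {l : ℕ} (hl : l < s) :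
    (lowBits hs v).testBit l = toB (v ⟨l, by omega⟩) := by
  rw [lowBits, Nat.testBit_ofBits_lt _ _ hl]
  rfl

theorem lowBits_eq_iff {a s : ℕ} (hs : s ≤ a) (v v' : Fin a → ZMod 2) :
    lowBits hs v = lowBits hs v' ↔ ∀ l : Fin a, (l : ℕ) < s → v l = v' l := by
  constructor
  · intro h l hl
    have := testBit_lowBits hs v hl
    rw [h, testBit_lowBits hs v' hl] at this
    exact (toB_injective this).symm
  · intro h
    rw [lowBits, lowBits]
    congr 1
    funext l
    rw [h _ l.2]

theorem two_pow_mul_add_inj {s y y' r r' : ℕ} (hr : r < 2 ^ s) (hr' : r' < 2 ^ s) :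
    2 ^ s * y + r = 2 ^ s * y' + r' ↔ y = y' ∧ r = r' := by
  constructor
  · intro h
    have h1 : (2 ^ s * y + r) / 2 ^ s = y := by
      rw [Nat.mul_add_div (by positivity), Nat.div_eq_of_lt hr, add_zero]
    have h2 : (2 ^ s * y' + r') / 2 ^ s = y' := by
      rw [Nat.mul_add_div (by positivity), Nat.div_eq_of_lt hr', add_zero]
    have h3 : y = y' := by rw [← h1, ← h2, h]
    subst h3
    exact ⟨rfl, by omega⟩
  · rintro ⟨rfl, rfl⟩; rfl

/-- The hash of `x` under the `y`-th function, together with `y`. -/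
def hashPair {a s K : ℕ} (hs : s ≤ a) (A : Fin K → Matrix (Fin a) (Fin a) (ZMod 2))
    (q : Fin K × Fin (2 ^ a)) : Fin (2 ^ s * K) :=
  ⟨2 ^ s * q.1 + lowBits hs (A q.1 *ᵥ bitVec q.2), by
    have h1 := lowBits_lt hs (A q.1 *ᵥ bitVec q.2)
    have h2 : 2 ^ s * ((q.1 : ℕ) + 1) ≤ 2 ^ s * K := Nat.mul_le_mul_left _ q.1.2
    rw [mul_add, mul_one] at h2
    omega⟩

theorem hashPair_eq_iff {a s K : ℕ} (hs : s ≤ a) (A : Fin K → Matrix (Fin a) (Fin a) (ZMod 2))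
    (q q' : Fin K × Fin (2 ^ a)) : hashPair hs A q = hashPair hs A q' ↔
      q.1 = q'.1 ∧ lowBits hs (A q.1 *ᵥ bitVec q.2) = lowBits hs (A q'.1 *ᵥ bitVec q'.2) := by
  rw [hashPair, hashPair, Fin.mk.injEq, two_pow_mul_add_inj (lowBits_lt _ _) (lowBits_lt _ _),
    Fin.ext_iff]

theorem testBit_hashPair {a s K : ℕ} (hs : s ≤ a) (A : Fin K → Matrix (Fin a) (Fin a) (ZMod 2))
    (q : Fin K × Fin (2 ^ a)) (l : ℕ) : (hashPair hs A q : ℕ).testBit l =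
      if l < s then (lowBits hs (A q.1 *ᵥ bitVec q.2)).testBit l
      else (q.1 : ℕ).testBit (l - s) := by
  rw [hashPair, Nat.testBit_two_pow_mul_add _ (lowBits_lt _ _)]

/-- The qubits on which the output is written. -/
def outEmb {a s w k : ℕ} (hs : s ≤ a) (hk : k ≤ s + a) (hw : 3 * a ≤ w) : Fin k ↪ Fin w where
  toFun l := ⟨if (l : ℕ) < s then 2 * a + l else a + (l - s), by split_ifs <;> omega⟩
  inj' l l' h := by
    have h1 := l.2
    have h2 := l'.2
    rw [Fin.mk.injEq] at h
    refine Fin.ext ?_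
    split_ifs at h <;> omega

/-- Reduces the construction of a protocol to a family of invertible matrices with two properties:
the entries have short programs, and the constant number `lam` of them maps any given nonzero vector
to one whose first s digits vanish. -/
theorem exists_gepp {a t s K : ℕ} (hst : s + t = a) (ha : 0 < a) (hK : 0 < K) (hKa : K ≤ 2 ^ a)
    {A A' : Fin K → Matrix (Fin a) (Fin a) (ZMod 2)} (hA : ∀ y, A' y * A y = 1)
    {l : List (Fin K → ZMod 2)} (hl : Prog a l) (hlA : ∀ i j, (fun y => A y i j) ∈ l)
    (hlA' : ∀ i j, (fun y => A' y i j) ∈ l) {lam : ℕ}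
    (hlam : lam * (2 ^ a - 1) = K * (2 ^ t - 1))
    (hdesign : ∀ x : Fin a → ZMod 2, x ≠ 0 →
      (Finset.univ.filter fun y => ∀ i : Fin a, (i : ℕ) < s → (A y *ᵥ x) i = 0).card = lam) :
    ∃ P : GEPP (2 ^ a) K (2 ^ s * K), P.size ≤ 10 * l.length + 4 * a ^ 2 + 15 * a + 2 ∧
      ∀ ε : ℝ, ε < 1 / 2 → P.DetSuccessful ε (2 * ε / 2 ^ t) ε ∧
        (ε ≤ 2 ^ t / 2 ^ a → P.DetSuccessful ε (ε / 2 ^ t) ε) := by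
  have hs : s ≤ a := by omega
  -- Layout for each party, in blocks of a wires: x at 0, y at a, A y x at 2a. Wire 3a starts the
  -- disjunction chain, which ends in the flag at 3a + t ≤ 4a; the scratch wires of the program
  -- start at 4a + 1.
  set w := 4 * a + 1 + l.length with hw
  obtain ⟨gs, hgs1, hgs2, hgs3⟩ := exists_gates_mulVec (B := 4 * a + 1) (by omega) hA hl hlA hlA'
  obtain ⟨lA, fA, lenA, monoA, evalA⟩ := exists_steps_of_gates (w := w) .alice hgs2
  obtain ⟨lB, fB, lenB, monoB, evalB⟩ := exists_steps_of_gates (w := w) .bob hgs2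
  -- The measured wires carry the last t digits of A y x; the first s digits, followed by those of
  -- y, become the output.
  set qs : List ℕ := (List.range t).map fun j => 2 * a + s + j with hqs
  have hqlen : qs.length = t := by simp [hqs]
  have hqmem : ∀ q, q ∈ qs ↔ 2 * a + s ≤ q ∧ q < 3 * a := by
    intro q
    simp only [hqs, List.mem_map, List.mem_range]
    constructor
    · rintro ⟨j, hj, rfl⟩; omega
    · intro h; exact ⟨q - (2 * a + s), by omega, by omega⟩
  have hqnodup : qs.Nodup := List.Nodup.map (fun i j h => by simpa using h) List.nodup_range
  obtain ⟨lC, monoC, lenC, isC, evalC⟩ := exists_compare_steps (w := w) hqnodup fun q hq => by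
    have := (hqmem q).1 hq
    omega
  rw [hqlen] at lenC isC evalC
  have hor : ∀ h ∈ qs, h < 3 * a := fun h hh => ((hqmem h).1 hh).2
  obtain ⟨lD, fD, lenD, monoD, evalD⟩ := exists_steps_of_gates (w := w) .alice
    (orGates_fits (w := w) hor (by omega))
  rw [length_orGates, hqlen] at lenD
  have hclogN : Nat.clog 2 (2 ^ a) = a := Nat.clog_pow 2 a (by norm_num)
  have hclogK : Nat.clog 2 K ≤ a := Nat.clog_le_of_le_pow hKa
  have hclogM : Nat.clog 2 (2 ^ s * K) ≤ s + a := by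
    refine Nat.clog_le_of_le_pow ?_
    rw [pow_add]
    exact Nat.mul_le_mul_left _ hKa
  let P : Circuit (2 ^ a) K (2 ^ s * K) :=
    { width := w
      width_le := by omega
      steps := lA ++ (lB ++ (lC ++ lD))
      flag := ⟨3 * a + t, by omega⟩
      out := fun _ => outEmb hs hclogM (by omega) }
  let mono : List (Bool × Bool) → (Basis w → ℂ) × (Basis w → Basis w) := fun o =>
    monoComp (monoComp (monoComp (fun _ => 1, fD) (monoC o)) (fun _ => 1, fB)) (fun _ => 1, fA)
  have hmono : IsMono P.steps ((outcomes t).map mono) := by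
    have h := monoA.append (monoB.append (isC.append monoD))
    rw [IsMono] at h ⊢
    rw [h]
    congr 1
    simp only [List.map_cons, List.map_nil, List.flatMap_cons, List.flatMap_nil, List.append_nil,
      List.map_flatMap, List.flatMap_map]
    rw [← List.map_eq_flatMap]
  -- the state of the wires after the linear maps
  let ld : (i : Fin (2 ^ a)) → (y : Fin K) → ℕ → ZMod 2 := fun i y q =>
    if q < a then bitZ i q else bitZ y (q - a)
  let xi : (Fin (2 ^ a) × Fin (2 ^ a)) × (Fin K × Fin K) → Party → Fin (2 ^ a) :=
    fun b p => match p with | .alice => b.1.1 | .bob => b.1.2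
  let yi : (Fin (2 ^ a) × Fin (2 ^ a)) × (Fin K × Fin K) → Party → Fin K :=
    fun b p => match p with | .alice => b.2.1 | .bob => b.2.2
  have hload : ∀ b, loadBasis (2 ^ a) K w b = wireState fun p => ld (xi b p) (yi b p) := by
    intro b
    funext pq
    obtain ⟨p, q⟩ := pq
    cases p
    all_goals
      simp only [loadBasis, load, wireState, ld, xi, yi, hclogN]
      split_ifs <;> rw [toB_bitZ]
  let mid : Fin (2 ^ a) → Fin K → ℕ → ZMod 2 := fun i y => Gate.evalL gs (ld i y)
  have hld : ∀ i y, (∀ j < a, ld i y (a + j) = bitZ y j) ∧ (∀ r, 2 * a ≤ r → ld i y r = 0) ∧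
      (fun k : Fin a => ld i y k) = bitVec i := by
    intro i y
    refine ⟨fun j hj => ?_, fun r hr => ?_, ?_⟩
    · simp [ld]
    · have h1 : ¬ r < a := by omega
      simp only [ld, h1, if_false]
      refine bitZ_eq_zero (lt_of_lt_of_le y.2 (hKa.trans ?_))
      exact Nat.pow_le_pow_right (by norm_num) (by omega)
    · funext k
      simp [ld, bitVec]
  have hmid0 : ∀ i y, ∀ q < a, mid i y q = 0 := fun i y =>
    (hgs3 y (ld i y) (hld i y).1 (hld i y).2.1).1
  have hmid1 : ∀ i y, ∀ j < a, mid i y (a + j) = bitZ y j := by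
    intro i y j hj
    rw [← (hld i y).1 j hj]
    exact (hgs3 y (ld i y) (hld i y).1 (hld i y).2.1).2.2 (a + j) (by omega) (by omega)
  have hmid2 : ∀ i y (j : Fin a), mid i y (2 * a + j) = (A y *ᵥ bitVec i) j := by
    intro i y j
    have := (hgs3 y (ld i y) (hld i y).1 (hld i y).2.1).2.1 j
    rw [(hld i y).2.2] at this
    exact this
  have hmid3 : ∀ i y q, 3 * a ≤ q → mid i y q = 0 := by
    intro i y q hq
    rw [← (hld i y).2.1 q (by omega)]
    exact (hgs3 y (ld i y) (hld i y).1 (hld i y).2.1).2.2 q (by omega) (by omega)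
  have hstart : ∀ b, fB (fA (loadBasis (2 ^ a) K w b)) =
      wireState fun p => mid (xi b p) (yi b p) := by
    intro b
    rw [hload, evalA, evalB]
    congr 1
    funext p
    cases p <;> simp [mid]
  -- the final state of the wires
  have hfinal : ∀ o ∈ outcomes t, ∃ (β : ℕ → ZMod 2) (c : ℂ), c * star c = 1 ∧ ∀ b,
      ((agree o = true → (∀ p, xi b p = xi b .alice) → (∀ p, yi b p = yi b .alice) →
          (mono o).1 (loadBasis (2 ^ a) K w b) = c / 2 ^ t) ∧
        ∃ uv, (mono o).2 (loadBasis (2 ^ a) K w b) = wireState uv ∧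
          (agree o = false → toB (uv .alice (3 * a + t)) = true) ∧
          (agree o = true → uv = fun p q => if q ∈ qs then if p = .alice then 0 else β q
              else mid (xi b p) (yi b p) q)) := by
    intro o ho
    obtain ⟨β, c, hc, h⟩ := evalC o ho
    refine ⟨β, c, hc, fun b => ?_⟩
    obtain ⟨uv, e1, e2, e3, e4, e5, e6⟩ := h fun p => mid (xi b p) (yi b p)
    have e0 : ∀ q, 3 * a ≤ q → uv .alice q = 0 := by
      intro q hq
      rw [e2 _ _ fun h' => by have := hor _ h'; omega]
      exact hmid3 _ _ _ hq
    obtain ⟨d1, d2⟩ := evalL_orGates hor (u := uv .alice) fun q hq => e0 q (by omega)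
    rw [hqlen] at d1
    refine ⟨fun hg hx hy => ?_, Function.update uv .alice (Gate.evalL (orGates (3 * a) qs)
      (uv .alice)), ?_, fun hg => ?_, fun hg => ?_⟩
    · have := e6 hg fun q _ => by rw [hx .bob, hy .bob]
      simp only [mono, monoComp, hstart, this]
      ring
    · simp only [mono, monoComp, hstart, e1, evalD]
    · have hne : Gate.evalL (orGates (3 * a) qs) (uv .alice) (3 * a + t) ≠ 0 := by
        intro h0
        obtain ⟨q, hq, hq'⟩ := e5 hg
        exact hq' ((d1.1 h0).2 q hq)
      have hb : ∀ x : ZMod 2, x ≠ 0 → toB x = true := by decide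
      rw [Function.update_self]
      exact hb _ hne
    · rw [d2 (e0 _ le_rfl) (e4 hg), Function.update_eq_self]
      funext p q
      by_cases hq : q ∈ qs
      · rw [if_pos hq]
        cases p
        · exact e4 hg q hq
        · exact e3 q hq
      · rw [if_neg hq, e2 p q hq]
  have hflag : ∀ o ∈ outcomes t, ∀ b,
      (mono o).2 (loadBasis (2 ^ a) K w b) (.alice, P.flag) = !(agree o) := by
    intro o ho b
    obtain ⟨β, c, hc, h⟩ := hfinal o ho
    obtain ⟨-, uv, e1, e2, e3⟩ := h b
    rw [e1]
    cases hg : agree o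
    · exact e2 hg
    · have : ¬ (3 * a + t ∈ qs) := by rw [hqmem]; omega
      rw [e3 hg]
      simp only [wireState, P, this, if_false, hmid3 _ _ (3 * a + t) (by omega)]
      rfl
  have hReads : ∀ o ∈ outcomes t, agree o = true → ∀ b,
      P.Reads ((mono o).2 (loadBasis (2 ^ a) K w b))
        (hashPair hs A (b.2.1, b.1.1), hashPair hs A (b.2.2, b.1.2)) := by
    intro o ho hg b j
    obtain ⟨β, c, hc, h⟩ := hfinal o ho
    obtain ⟨-, uv, e1, e2, e3⟩ := h b
    have hj := j.2
    have key : ∀ p, wireState uv (p, P.out p j) =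
        ((hashPair hs A (yi b p, xi b p) : ℕ)).testBit j := by
      intro p
      rw [testBit_hashPair]
      change toB (uv p ((P.out p j : Fin w) : ℕ)) = _
      by_cases hjs : (j : ℕ) < s
      · have h1 : ¬ (2 * a + (j : ℕ) ∈ qs) := by rw [hqmem]; omega
        have hv : ((P.out p j : Fin w) : ℕ) = 2 * a + j := if_pos hjs
        rw [if_pos hjs, testBit_lowBits hs _ hjs, hv, e3 hg]
        simp only [h1, if_false]
        exact congrArg toB (hmid2 _ _ ⟨j, by omega⟩)
      · have h1 : ¬ (a + ((j : ℕ) - s) ∈ qs) := by rw [hqmem]; omega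
        have hv : ((P.out p j : Fin w) : ℕ) = a + (j - s) := if_neg hjs
        rw [if_neg hjs, hv, e3 hg]
        simp only [h1, if_false]
        rw [hmid1 _ _ _ (by omega), toB_bitZ]
    rw [e1]
    exact ⟨key .alice, key .bob⟩
  have hpow : ∀ k : ℕ, 0 < 2 ^ k := fun k => by positivity
  have H : P.Hashing (outcomes t) mono agree (hashPair hs A) lam (2 ^ t) :=
    { isMono := hmono
      load_injective := by
        intro b b' h
        have key : ∀ p, xi b p = xi b' p ∧ yi b p = yi b' p := by
          intro p
          have h1 : ∀ q < w, ld (xi b p) (yi b p) q = ld (xi b' p) (yi b' p) q := by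
            intro q hq
            have h2 := congrFun h (p, ⟨q, hq⟩)
            rw [hload, hload] at h2
            exact toB_injective h2
          constructor
          · refine bitVec_injective (funext fun k => ?_)
            have := h1 k (by omega)
            simpa [ld, bitVec] using this
          · refine Fin.ext (Nat.eq_of_testBit_eq fun k => ?_)
            by_cases hk : k < a
            · have := h1 (a + k) (by omega)
              rw [(hld _ _).1 k hk, (hld _ _).1 k hk] at this
              exact bitZ_inj.1 this
            · have h3 : K ≤ 2 ^ k := hKa.trans (Nat.pow_le_pow_right (by norm_num) (by omega))
              rw [Nat.testBit_lt_two_pow (lt_of_lt_of_le (yi b p).2 h3),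
                Nat.testBit_lt_two_pow (lt_of_lt_of_le (yi b' p).2 h3)]
        exact Prod.ext (Prod.ext (key .alice).1 (key .bob).1)
          (Prod.ext (key .alice).2 (key .bob).2)
      reads := by
        intro o ho b hb
        rw [hflag o ho] at hb
        exact hReads o ho (by simpa using hb) b
      bad := by
        intro o ho hg q
        rw [hflag o ho, hg]
        rfl
      flag_good := by
        intro o ho hg q
        rw [hflag o ho, hg]
        rfl
      coeff_good := by
        intro o ho hg
        obtain ⟨β, c, hc, h⟩ := hfinal o ho
        refine ⟨c, hc, fun q => ?_⟩
        have := (h (diagInput q)).1 hg (fun p => by cases p <;> rfl) fun p => by cases p <;> rfl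
        rw [this]
        push_cast
        rfl
      rest := by
        intro o ho hg q q' p r hr
        obtain ⟨β, c, hc, h⟩ := hfinal o ho
        obtain ⟨-, uv, e1, e2, e3⟩ := h (diagInput q)
        obtain ⟨-, uv', e1', e2', e3'⟩ := h (diagInput q')
        rw [e1, e1', e3 hg, e3' hg]
        simp only [wireState]
        congr 1
        by_cases hrq : (r : ℕ) ∈ qs
        · rw [if_pos hrq, if_pos hrq]
        · rw [if_neg hrq, if_neg hrq]
          have hout : ∀ j (hj : j < Nat.clog 2 (2 ^ s * K)),
              (r : ℕ) ≠ if j < s then 2 * a + j else a + (j - s) := by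
            intro j hj h'
            exact hr ⟨⟨j, hj⟩, Fin.ext h'.symm⟩
          rw [hqmem] at hrq
          rcases lt_or_ge (r : ℕ) a with h1 | h1
          · rw [hmid0 _ _ _ h1, hmid0 _ _ _ h1]
          rcases lt_or_ge (r : ℕ) (2 * a) with h2 | h2
          · obtain ⟨j, hj⟩ := Nat.exists_eq_add_of_le h1
            rw [hj, hmid1 _ _ _ (by omega), hmid1 _ _ _ (by omega)]
            -- The output may need fewer than s + a qubits. A digit of y that is left out has a
            -- position j with K ≤ 2 ^ j, so it is always 0 and carries no information about y to
            -- the discarded qubits.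
            have h3 : Nat.clog 2 (2 ^ s * K) ≤ s + j := by
              by_contra! h3
              refine hout (s + j) h3 ?_
              rw [if_neg (by omega), hj]
              omega
            have h4 : K ≤ 2 ^ j := by
              have h5 := (Nat.le_pow_clog (by norm_num : 1 < 2) (2 ^ s * K)).trans
                (Nat.pow_le_pow_right (by norm_num) h3)
              rw [pow_add] at h5
              exact Nat.le_of_mul_le_mul_left h5 (hpow s)
            rw [bitZ_eq_zero (lt_of_lt_of_le (Fin.is_lt _) h4),
              bitZ_eq_zero (lt_of_lt_of_le (Fin.is_lt _) h4)]
          rcases lt_or_ge (r : ℕ) (2 * a + s) with h3 | h3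
          · exfalso
            obtain ⟨j, hj⟩ := Nat.exists_eq_add_of_le h2
            have h4 : s ≤ Nat.clog 2 (2 ^ s * K) := by
              refine (Nat.pow_le_pow_iff_right (by norm_num : 1 < 2)).1
                (le_trans ?_ (Nat.le_pow_clog (by norm_num : 1 < 2) _))
              exact Nat.le_mul_of_pos_right _ hK
            refine hout j (by omega) ?_
            rw [if_pos (by omega), hj]
          · rw [hmid3 _ _ _ (by omega), hmid3 _ _ _ (by omega)]
      count := length_filter_agree t
      fst_eq := fun q q' h => ((hashPair_eq_iff hs A q q').1 h).1
      card_eq := by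
        intro i j hij
        -- By linearity, i and j collide under the y-th hash function exactly when the first s
        -- digits of A y applied to their difference vanish.
        rw [← hdesign (bitVec i - bitVec j) (sub_ne_zero.2 (bitVec_injective.ne hij))]
        congr 1
        ext y
        simp only [Finset.mem_filter, Finset.mem_univ, true_and, hashPair_eq_iff, lowBits_eq_iff,
          Matrix.mulVec_sub, Pi.sub_apply, sub_eq_zero]
      K_pos := hK
      L_pos := hpow t
      N_two := by
        calc 2 = 2 ^ 1 := rfl
          _ ≤ 2 ^ a := Nat.pow_le_pow_right (by norm_num) ha
      M_mul := by rw [← hst, pow_add]; ring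
      lam_mul := hlam }
  let P' : GEPP (2 ^ a) K (2 ^ s * K) :=
    { toCircuit := P
      output_mem := fun ρ _ => H.output_mem ρ }
  refine ⟨P', ?_, fun ε hε => ⟨?_, fun hε' => ?_⟩⟩
  · change (lA ++ (lB ++ (lC ++ lD))).length + 2 * w ≤ _
    simp only [List.length_append, lenA, lenB, lenC, lenD]
    omega
  · exact H.detSuccessful (P' := P') rfl hε (Or.inl (by push_cast; rfl))
  · exact H.detSuccessful (P' := P') rfl hε (Or.inr ⟨by push_cast; exact hε', by push_cast; rfl⟩)

end

section

/-! ### Costs of straight-line programs -/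

/-- With at most `c` additional steps, a program that computes the functions in `G` can be extended
to one that also computes the functions in `F`. -/
def Ext (a : ℕ) {K : ℕ} (c : ℕ) (G F : Set (Fin K → ZMod 2)) : Prop :=
  ∀ l, Prog a l → (∀ g ∈ G, g ∈ l) →
    ∃ l', Prog a l' ∧ (∀ g ∈ l, g ∈ l') ∧ (∀ f ∈ F, f ∈ l') ∧ l'.length ≤ l.length + c

namespace Ext

variable {a K c c₁ c₂ : ℕ} {G F F₁ F₂ : Set (Fin K → ZMod 2)} {f g : Fin K → ZMod 2}

theorem mono {c' : ℕ} {G' F' : Set (Fin K → ZMod 2)} (h : Ext a c G F) (hc : c ≤ c')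
    (hG : G ⊆ G') (hF : F' ⊆ F) : Ext a c' G' F' := by
  intro l hl hg
  obtain ⟨l', h1, h2, h3, h4⟩ := h l hl fun g hg' => hg g (hG hg')
  exact ⟨l', h1, h2, fun f hf => h3 f (hF hf), by omega⟩

theorem of_subset (h : F ⊆ G) : Ext a 0 G F :=
  fun l hl hg => ⟨l, hl, fun _ h => h, fun f hf => hg f (h hf), le_rfl⟩

theorem of_mem (h : f ∈ G) : Ext a 0 G {f} := of_subset (by simpa using h)

/-- Intermediate functions are computed once and can be used any number of times, so costs add where
substituting formulas would multiply them. -/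
theorem trans (h₁ : Ext a c₁ G F₁) (h₂ : Ext a c₂ (G ∪ F₁) F₂) : Ext a (c₁ + c₂) G F₂ := by
  intro l hl hg
  obtain ⟨l₁, p1, p2, p3, p4⟩ := h₁ l hl hg
  obtain ⟨l₂, q1, q2, q3, q4⟩ := h₂ l₁ p1 fun g hg' => by
    rcases hg' with hg' | hg'
    exacts [p2 g (hg g hg'), p3 g hg']
  exact ⟨l₂, q1, fun g hg' => q2 g (p2 g hg'), q3, by omega⟩

theorem union (h₁ : Ext a c₁ G F₁) (h₂ : Ext a c₂ G F₂) : Ext a (c₁ + c₂) G (F₁ ∪ F₂) := by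
  intro l hl hg
  obtain ⟨l₁, p1, p2, p3, p4⟩ := h₁ l hl hg
  obtain ⟨l₂, q1, q2, q3, q4⟩ := h₂ l₁ p1 fun g hg' => p2 g (hg g hg')
  refine ⟨l₂, q1, fun g hg' => q2 g (p2 g hg'), fun f hf => ?_, by omega⟩
  rcases hf with hf | hf
  exacts [q2 f (p3 f hf), q3 f hf]

theorem iUnion {ι : Type*} [Fintype ι] {F : ι → Set (Fin K → ZMod 2)}
    (h : ∀ i, Ext a c G (F i)) : Ext a (Fintype.card ι * c) G (⋃ i, F i) := by
  classical
  have key : ∀ s : Finset ι, Ext a (s.card * c) G (⋃ i ∈ s, F i) := by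
    intro s
    induction s using Finset.induction_on with
    | empty => simpa using of_subset (a := a) (Set.empty_subset G)
    | insert i s hi ih =>
      refine ((h i).union ih).mono ?_ subset_rfl ?_
      · rw [Finset.card_insert_of_notMem hi]; ring_nf; rfl
      · rw [Finset.set_biUnion_insert]
  simpa using key Finset.univ

theorem one : Ext a 1 G {(1 : Fin K → ZMod 2)} := fun l hl _ =>
  ⟨1 :: l, hl.one, fun _ h => List.mem_cons_of_mem _ h, by simp, by simp⟩

theorem bit {i : ℕ} (hi : i < a) : Ext a 1 G {fun y : Fin K => bitZ y i} := fun l hl _ =>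
  ⟨_ :: l, hl.bit i hi, fun _ h => List.mem_cons_of_mem _ h, by simp, by simp⟩

theorem add (hf : Ext a c₁ G {f}) (hg : Ext a c₂ G {g}) : Ext a (c₁ + c₂ + 1) G {f + g} := by
  refine (hf.union hg).trans fun l hl h => ⟨(f + g) :: l, hl.add f g (h f ?_) (h g ?_),
    fun _ h => List.mem_cons_of_mem _ h, by simp, by simp⟩ <;> simp

theorem mul (hf : Ext a c₁ G {f}) (hg : Ext a c₂ G {g}) : Ext a (c₁ + c₂ + 1) G {f * g} := by
  refine (hf.union hg).trans fun l hl h => ⟨(f * g) :: l, hl.mul f g (h f ?_) (h g ?_),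
    fun _ h => List.mem_cons_of_mem _ h, by simp, by simp⟩ <;> simp

theorem zero : Ext a 3 G {(0 : Fin K → ZMod 2)} := by
  have : (0 : Fin K → ZMod 2) = 1 + 1 := by
    funext y
    exact (CharTwo.add_self_eq_zero (1 : ZMod 2)).symm
  rw [this]
  exact one.add one

theorem const (x : ZMod 2) : Ext a 3 G {fun _ : Fin K => x} := by
  have hx : ∀ x : ZMod 2, x = 0 ∨ x = 1 := by decide
  rcases hx x with rfl | rfl
  · exact zero
  · exact one.mono (by norm_num) subset_rfl subset_rfl

theorem sum {ι : Type*} [Fintype ι] {f : ι → Fin K → ZMod 2} (h : ∀ i, Ext a c G {f i}) :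
    Ext a (Fintype.card ι * (c + 1) + 3) G {∑ i, f i} := by
  classical
  have key : ∀ s : Finset ι, Ext a (s.card * (c + 1) + 3) G {∑ i ∈ s, f i} := by
    intro s
    induction s using Finset.induction_on with
    | empty => simpa using zero (a := a) (G := G)
    | insert i s hi ih =>
      rw [Finset.sum_insert hi, Finset.card_insert_of_notMem hi]
      refine ((h i).add ih).mono ?_ subset_rfl subset_rfl
      ring_nf; rfl
  exact key Finset.univ

theorem prod {ι : Type*} [Fintype ι] {f : ι → Fin K → ZMod 2} (h : ∀ i, Ext a c G {f i}) :
    Ext a (Fintype.card ι * (c + 1) + 1) G {∏ i, f i} := by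
  classical
  have key : ∀ s : Finset ι, Ext a (s.card * (c + 1) + 1) G {∏ i ∈ s, f i} := by
    intro s
    induction s using Finset.induction_on with
    | empty => simpa using one (a := a) (G := G)
    | insert i s hi ih =>
      rw [Finset.prod_insert hi, Finset.card_insert_of_notMem hi]
      refine ((h i).mul ih).mono ?_ subset_rfl subset_rfl
      ring_nf; rfl
  exact key Finset.univ

theorem range {ι : Type*} [Fintype ι] {f : ι → Fin K → ZMod 2} (h : ∀ i, Ext a c G {f i}) :
    Ext a (Fintype.card ι * c) G (Set.range f) := by
  have := iUnion h
  rwa [Set.iUnion_singleton_eq_range] at this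

theorem exists_prog (h : Ext a c ∅ F) : ∃ l, Prog a l ∧ (∀ f ∈ F, f ∈ l) ∧ l.length ≤ c := by
  obtain ⟨l, h1, -, h2, h3⟩ := h [] .nil (by simp)
  exact ⟨l, h1, h2, by simpa using h3⟩

end Ext

/-! ### Arithmetic in finite fields of characteristic two -/

section Field

variable {n K : ℕ} {F : Type*} [Field F] [Algebra (ZMod 2) F] (b : Module.Basis (Fin n) (ZMod 2) F)

/-- The coordinates of a field element that depends on `y`. -/
def coords (ζ : Fin K → F) : Set (Fin K → ZMod 2) := Set.range fun k y => b.repr (ζ y) k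

variable {a : ℕ} {G : Set (Fin K → ZMod 2)}

theorem coord_mem {ζ : Fin K → F} (h : coords b ζ ⊆ G) (k : Fin n) :
    (fun y => b.repr (ζ y) k) ∈ G := h ⟨k, rfl⟩

/-- Each coordinate of a product is a bilinear form in the coordinates of the factors, with the
structure constants of the basis as coefficients. A term costs 5 steps, 3 of which are for its
coefficient, and adding it to the sum costs one more. -/
theorem Ext.field_mul {ζ η : Fin K → F} (hζ : coords b ζ ⊆ G) (hη : coords b η ⊆ G) :
    Ext a (n * (n * n * 6 + 3)) G (coords b fun y => ζ y * η y) := by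
  have h := Ext.range (a := a) (G := G) (f := fun i y => b.repr (ζ y * η y) i)
    (c := n * n * 6 + 3) fun i => ?_
  · simpa [coords] using h
  · have e : (fun y => b.repr (ζ y * η y) i) = ∑ p : Fin n × Fin n,
        (fun _ => b.repr (b p.1 * b p.2) i) *
          ((fun y => b.repr (ζ y) p.1) * fun y => b.repr (η y) p.2) := by
      funext y
      conv_lhs => rw [← b.sum_repr (ζ y), ← b.sum_repr (η y), Finset.sum_mul_sum]
      rw [Fintype.sum_prod_type, Finset.sum_apply]
      simp only [Finset.sum_apply, map_sum, Finsupp.coe_finsetSum, Pi.mul_apply,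
        smul_mul_smul_comm, map_smul, Finsupp.smul_apply, smul_eq_mul]
      refine Finset.sum_congr rfl fun k _ => Finset.sum_congr rfl fun m _ => ?_
      ring
    have h1 : ∀ p : Fin n × Fin n, Ext a 5 G {(fun _ => b.repr (b p.1 * b p.2) i) *
        ((fun y => b.repr (ζ y) p.1) * fun y => b.repr (η y) p.2)} := fun p =>
      Ext.mul (Ext.const _) (Ext.mul (Ext.of_mem (coord_mem b hζ p.1))
        (Ext.of_mem (coord_mem b hη p.2)))
    rw [e]
    exact (Ext.sum h1).mono (by simp) subset_rfl subset_rfl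

theorem Ext.field_const (x : F) : Ext a (n * 3) G (coords b fun _ : Fin K => x) := by
  have h := Ext.range (a := a) (G := G) (f := fun i (_ : Fin K) => b.repr x i) (c := 3)
    fun i => Ext.const _
  simpa [coords] using h

/-- The entries of the matrix of the multiplication by a field element. -/
def mulEntries (ζ : Fin K → F) : Set (Fin K → ZMod 2) :=
  ⋃ p : Fin n × Fin n, {fun y => Algebra.leftMulMatrix b (ζ y) p.1 p.2}

/-- Column j of the multiplication matrix is the coordinate vector of ζ times the j-th basis
element, so n field multiplications suffice. -/
theorem Ext.mulEntries {ζ : Fin K → F} (hζ : coords b ζ ⊆ G) :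
    Ext a (n * (n * 3 + n * (n * n * 6 + 3))) G (mulEntries b ζ) := by
  have h1 : ∀ j, Ext a (n * 3 + n * (n * n * 6 + 3)) G (coords b fun y => ζ y * b j) := by
    intro j
    refine (Ext.field_const b (b j)).trans ?_
    exact Ext.field_mul b (ζ := ζ) (η := fun _ => b j) (hζ.trans Set.subset_union_left)
      Set.subset_union_right
  refine (Ext.iUnion h1).mono (by simp) subset_rfl ?_
  refine Set.iUnion_subset fun p => Set.singleton_subset_iff.2 (Set.mem_iUnion.2 ⟨p.2, p.1, ?_⟩)
  funext y
  rw [Algebra.leftMulMatrix_eq_repr_mul]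

end Field

end

section

/-! ### Hashing by multiplication in a finite field -/

theorem exists_binary_field {n : ℕ} (hn : n ≠ 0) :
    ∃ (F : Type) (_ : Field F) (_ : Fintype F) (_ : Algebra (ZMod 2) F),
      Fintype.card F = 2 ^ n ∧ Nonempty (Module.Basis (Fin n) (ZMod 2) F) := by
  let _ : Fintype (GaloisField 2 n) := Fintype.ofFinite _
  refine ⟨GaloisField 2 n, inferInstance, inferInstance, inferInstance, ?_,
    ⟨Module.finBasisOfFinrankEq _ _ (GaloisField.finrank 2 hn)⟩⟩
  rw [← Nat.card_eq_fintype_card, GaloisField.card 2 n hn]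

theorem card_filter_forall_lt {n s t : ℕ} (hst : s + t = n) :
    (Finset.univ.filter fun v : Fin n → ZMod 2 => ∀ i : Fin n, (i : ℕ) < s → v i = 0).card =
      2 ^ t := by
  have h1 : (Finset.univ.filter fun v : Fin n → ZMod 2 => ∀ i : Fin n, (i : ℕ) < s → v i = 0) =
      Fintype.piFinset fun i : Fin n => if (i : ℕ) < s then {0} else Finset.univ := by
    ext v
    simp only [Finset.mem_filter, Finset.mem_univ, true_and, Fintype.mem_piFinset]
    refine forall_congr' fun i => ?_
    by_cases h : (i : ℕ) < s <;> simp [h]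
  have h2 : ∀ i : Fin n, (if (i : ℕ) < s then {0} else Finset.univ : Finset (ZMod 2)).card =
      if (i : ℕ) < s then 1 else 2 := by
    intro i
    split_ifs <;> simp [ZMod.card]
  rw [h1, Fintype.card_piFinset]
  simp only [h2]
  rw [Fin.prod_univ_eq_prod_range (fun i => if i < s then 1 else 2) n, ← hst,
    Finset.prod_range_add]
  rw [Finset.prod_eq_one fun i hi => if_pos (Finset.mem_range.1 hi)]
  simp

/-- The element whose coordinates are the complements of the binary digits of `y`. -/
def complElt {n : ℕ} {F : Type*} [Field F] [Algebra (ZMod 2) F]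
    (b : Module.Basis (Fin n) (ZMod 2) F) (y : ℕ) : F :=
  ∑ k : Fin n, (bitZ y k + 1) • b k

/-- The power `x ^ (2 ^ (k + 1) - 2)`. -/
def sqPow {F : Type*} [Field F] : ℕ → F → F
  | 0, _ => 1
  | k + 1, x => (sqPow k x * x) * (sqPow k x * x)

/-- With k = n - 1 the exponent is one less than the order of a field with 2 ^ n elements, so `sqPow
(n - 1) x` inverts x ≠ 0 with only 2 (n - 1) multiplications. -/
theorem sqPow_mul_self {F : Type*} [Field F] (k : ℕ) (x : F) :
    sqPow k x * x = x ^ (2 ^ (k + 1) - 1) := by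
  induction k with
  | zero => simp [sqPow]
  | succ k ih =>
    rw [sqPow, ih, ← pow_add, ← pow_succ]
    congr 1
    have := Nat.one_le_two_pow (n := k + 1)
    rw [pow_succ 2 (k + 1)]
    omega

/-! ### Enumeration of the nonzero field elements, and programs for their inverses. -/

section

variable {n : ℕ} {F : Type*} [Field F] [Algebra (ZMod 2) F] (b : Module.Basis (Fin n) (ZMod 2) F)

theorem repr_complElt (y : ℕ) (k : Fin n) : b.repr (complElt b y) k = bitZ y k + 1 := by
  rw [complElt, b.repr_sum_self]

theorem complElt_injOn {y y' : ℕ} (hy : y < 2 ^ n) (hy' : y' < 2 ^ n)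
    (h : complElt b y = complElt b y') : y = y' := by
  refine Nat.eq_of_testBit_eq fun k => ?_
  by_cases hk : k < n
  · have h1 := repr_complElt b y ⟨k, hk⟩
    rw [h, repr_complElt] at h1
    exact (bitZ_inj.1 (add_right_cancel h1)).symm
  · have : 2 ^ n ≤ 2 ^ k := Nat.pow_le_pow_right (by norm_num) (by omega)
    rw [Nat.testBit_lt_two_pow (by omega), Nat.testBit_lt_two_pow (by omega)]

theorem complElt_eq_zero : complElt b (2 ^ n - 1) = 0 := by
  rw [complElt]
  refine Finset.sum_eq_zero fun k _ => ?_
  have : bitZ (2 ^ n - 1) k = 1 := by simp [bitZ, Nat.testBit_two_pow_sub_one]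
  rw [this, CharTwo.add_self_eq_zero, zero_smul]

theorem complElt_ne_zero {y : ℕ} (hy : y < 2 ^ n - 1) : complElt b y ≠ 0 := by
  intro h
  have := complElt_injOn b (by omega) (by omega) (h.trans (complElt_eq_zero b).symm)
  omega

variable {a K : ℕ} {G : Set (Fin K → ZMod 2)}

theorem Ext.complElt (ha : n ≤ a) :
    Ext a (n * 3) G (coords b fun y : Fin K => complElt b y) := by
  have h1 : ∀ k : Fin n, Ext a 3 G {fun y : Fin K => b.repr (Purification.complElt b y) k} := by
    intro k
    have e : (fun y : Fin K => b.repr (Purification.complElt b y) k) =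
        (fun y : Fin K => bitZ y k) + 1 := by
      funext y
      rw [repr_complElt]
      rfl
    rw [e]
    exact (Ext.bit (by omega)).add Ext.one
  simpa [coords] using Ext.range h1

theorem Ext.sqPow {ζ : Fin K → F} (hζ : coords b ζ ⊆ G) (k : ℕ) :
    Ext a (n * 3 + k * (2 * (n * (n * n * 6 + 3)))) G (coords b fun y => sqPow k (ζ y)) := by
  induction k with
  | zero => simpa [Purification.sqPow] using Ext.field_const b (1 : F)
  | succ k ih =>
    refine (ih.trans ((Ext.field_mul b (ζ := fun y => Purification.sqPow k (ζ y)) (η := ζ)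
      Set.subset_union_right (hζ.trans Set.subset_union_left)).trans
      (Ext.field_mul b (ζ := fun y => Purification.sqPow k (ζ y) * ζ y)
        (η := fun y => Purification.sqPow k (ζ y) * ζ y)
      Set.subset_union_right Set.subset_union_right))).mono ?_ subset_rfl subset_rfl
    ring_nf; rfl

end

theorem exists_gepp_field {n t : ℕ} (ht : t < n) :
    ∃ P : GEPP (2 ^ n) (2 ^ n - 1) (2 ^ (n - t) * (2 ^ n - 1)), P.size ≤ 501 * n ^ 4 ∧
      ∀ ε : ℝ, ε < 1 / 2 → P.DetSuccessful ε (2 * ε / 2 ^ t) ε ∧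
        (ε ≤ 2 ^ t / 2 ^ n → P.DetSuccessful ε (ε / 2 ^ t) ε) := by
  classical
  obtain ⟨F, _, _, _, hF, ⟨b⟩⟩ := exists_binary_field (n := n) (by omega)
  let K := 2 ^ n - 1
  have h2n : 2 ≤ 2 ^ n := by
    calc 2 = 2 ^ 1 := rfl
      _ ≤ 2 ^ n := Nat.pow_le_pow_right (by norm_num) (by omega)
  -- Complementing the digits makes the one missing number 2 ^ n - 1 correspond to 0, so y < K
  -- enumerates exactly the nonzero elements.
  let ζ : Fin K → F := fun y => complElt b y
  let η : Fin K → F := fun y => sqPow (n - 1) (ζ y)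
  have hζ0 : ∀ y, ζ y ≠ 0 := fun y => complElt_ne_zero b y.2
  have hηζ : ∀ y, η y * ζ y = 1 := by
    intro y
    simp only [η]
    rw [sqPow_mul_self, Nat.sub_add_cancel (by omega), ← hF]
    exact FiniteField.pow_card_sub_one_eq_one _ (hζ0 y)
  have hext := (Ext.complElt (K := K) (G := ∅) b (le_refl n)).trans
    ((Ext.mulEntries (a := n) b (ζ := ζ) (G := ∅ ∪ coords b ζ) Set.subset_union_right).union
      ((Ext.sqPow (a := n) b (ζ := ζ) (G := ∅ ∪ coords b ζ) Set.subset_union_right (n - 1)).trans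
        (Ext.mulEntries (a := n) b (ζ := η) Set.subset_union_right)))
  obtain ⟨l, hl, hmem, hlen⟩ := hext.exists_prog
  have hdesign : ∀ x : Fin n → ZMod 2, x ≠ 0 →
      (Finset.univ.filter fun y => ∀ i : Fin n, (i : ℕ) < n - t →
        (Algebra.leftMulMatrix b (ζ y) *ᵥ x) i = 0).card = 2 ^ t - 1 := by
    intro x hx
    set X : F := ∑ k : Fin n, x k • b k with hX
    have hrX : ∀ k, b.repr X k = x k := fun k => by rw [hX, b.repr_sum_self]
    have hX0 : X ≠ 0 := by
      intro h
      refine hx (funext fun k => ?_)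
      rw [← hrX, h]
      simp
    have hmul : ∀ y i, (Algebra.leftMulMatrix b (ζ y) *ᵥ x) i = b.repr (ζ y * X) i := by
      intro y i
      rw [← Algebra.leftMulMatrix_mulVec_repr]
      congr 2
      funext k
      exact (hrX k).symm
    let g : Fin K → Fin n → ZMod 2 := fun y => b.repr (ζ y * X)
    have hg : Function.Injective g := by
      intro y y' h
      have h1 : ζ y * X = ζ y' * X := b.repr.injective (DFunLike.coe_injective h)
      exact Fin.ext (complElt_injOn b (by omega) (by omega) (mul_right_cancel₀ hX0 h1))
    have hg0 : ∀ y, g y ≠ 0 := by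
      intro y h
      have h1 : b.repr (ζ y * X) = 0 := DFunLike.coe_injective h
      rw [LinearEquiv.map_eq_zero_iff] at h1
      exact mul_ne_zero (hζ0 y) hX0 h1
    -- For fixed X ≠ 0 the products ζ y * X are distinct and nonzero, and there are 2 ^ n - 1 of
    -- them. The count is thus that of all vectors with n - t vanishing digits, less the zero
    -- vector.
    have himg : Finset.univ.image g = Finset.univ.erase 0 := by
      refine Finset.eq_of_subset_of_card_le (fun v hv => ?_) ?_
      · obtain ⟨y, -, rfl⟩ := Finset.mem_image.1 hv
        exact Finset.mem_erase.2 ⟨hg0 y, Finset.mem_univ _⟩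
      · rw [Finset.card_image_of_injective _ hg, Finset.card_erase_of_mem (Finset.mem_univ _)]
        simp [K, ZMod.card]
    have hcount : (Finset.univ.filter fun y => ∀ i : Fin n, (i : ℕ) < n - t → g y i = 0).card =
        ((Finset.univ.erase 0).filter fun v : Fin n → ZMod 2 =>
          ∀ i : Fin n, (i : ℕ) < n - t → v i = 0).card := by
      rw [← himg, Finset.filter_image, Finset.card_image_of_injective _ hg]
    simp only [hmul]
    rw [hcount, Finset.filter_erase, Finset.card_erase_of_mem (by simp),
      card_filter_forall_lt (s := n - t) (t := t) (by omega)]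
  obtain ⟨P, hP, hP'⟩ := exists_gepp (a := n) (t := t) (s := n - t) (K := K) (by omega) (by omega)
    (by omega) (by omega) (A := fun y => Algebra.leftMulMatrix b (ζ y))
    (A' := fun y => Algebra.leftMulMatrix b (η y))
    (fun y => by rw [← map_mul, hηζ, map_one]) hl
    (fun i j => hmem _ (Or.inl (Set.mem_iUnion.2 ⟨(i, j), rfl⟩)))
    (fun i j => hmem _ (Or.inr (Set.mem_iUnion.2 ⟨(i, j), rfl⟩))) (lam := 2 ^ t - 1)
    (by ring) hdesign
  refine ⟨P, hP.trans ?_, hP'⟩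
  have hn : 1 ≤ n := by omega
  have h1 : n - 1 ≤ n := by omega
  have h2 : l.length ≤ 48 * n ^ 4 := by
    have e1 : n ≤ n ^ 4 := Nat.le_self_pow (by norm_num) n
    have e2 : n ^ 2 ≤ n ^ 4 := Nat.pow_le_pow_right hn (by norm_num)
    calc l.length ≤ _ := hlen
      _ ≤ n * 3 + (n * (n * 3 + n * (n * n * 6 + 3)) + (n * 3 +
          n * (2 * (n * (n * n * 6 + 3))) + n * (n * 3 + n * (n * n * 6 + 3)))) := by gcongr
      _ = 24 * n ^ 4 + 18 * n ^ 2 + 6 * n := by ring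
      _ ≤ _ := by omega
  have e1 : n ≤ n ^ 4 := Nat.le_self_pow (by norm_num) n
  have e2 : n ^ 2 ≤ n ^ 4 := Nat.pow_le_pow_right hn (by norm_num)
  have e3 : 1 ≤ n ^ 4 := Nat.one_le_pow _ _ hn
  omega

end

section

/-! ### Hashing along the lines of a vector space over a finite field -/

/-- A number below `∑ q ^ i`, where `q = 2 ^ n`, has base `q` digits `1, …, 1, 0` at the top. -/
theorem exists_pivot {n d y : ℕ} (hn : 0 < n) (hy : y < ∑ i ∈ Finset.range d, (2 ^ n) ^ i) :
    ∃ j < d, (∀ i, j < i → i < d → ∀ α < n, y.testBit (n * i + α) = decide (α = 0)) ∧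
      ∀ α < n, y.testBit (n * j + α) = false := by
  induction d generalizing y with
  | zero => simp at hy
  | succ d ih =>
    rw [Finset.sum_range_succ] at hy
    -- Either the top digit is 0 and is the pivot, or it is 1 and the remainder is below the shorter
    -- geometric sum. The digits below the pivot are unconstrained and will be the free coordinates
    -- of a direction.
    by_cases h : y < (2 ^ n) ^ d
    · refine ⟨d, by omega, fun i h1 h2 => by omega, fun α _ => ?_⟩
      refine Nat.testBit_lt_two_pow (h.trans_le ?_)
      rw [← pow_mul]
      exact Nat.pow_le_pow_right (by norm_num) (by omega)
    · obtain ⟨y', rfl⟩ := Nat.exists_eq_add_of_le (not_lt.1 h)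
      have hy' : y' < ∑ i ∈ Finset.range d, (2 ^ n) ^ i := by omega
      have h2 : 2 ≤ 2 ^ n := by
        calc 2 = 2 ^ 1 := rfl
          _ ≤ 2 ^ n := Nat.pow_le_pow_right (by norm_num) hn
      have hlt : y' < 2 ^ (n * d) := by
        rw [pow_mul]
        exact hy'.trans (Nat.geomSum_lt h2 fun k hk => Finset.mem_range.1 hk)
      have hbit : ∀ k, ((2 ^ n) ^ d + y').testBit k =
          if k < n * d then y'.testBit k else (1 : ℕ).testBit (k - n * d) := by
        intro k
        have := Nat.testBit_two_pow_mul_add 1 hlt k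
        rwa [mul_one, pow_mul] at this
      obtain ⟨j, hj, h3, h4⟩ := ih hy'
      have hlt' : ∀ i < d, ∀ α < n, n * i + α < n * d := by
        intro i hi α hα
        calc n * i + α < n * i + n := by omega
          _ = n * (i + 1) := by ring
          _ ≤ n * d := Nat.mul_le_mul_left _ hi
      refine ⟨j, by omega, fun i h5 h6 α hα => ?_, fun α hα => ?_⟩
      · rw [hbit]
        by_cases hi : i < d
        · rw [if_pos (hlt' i hi α hα)]
          exact h3 i h5 hi α hα
        · have : i = d := by omega
          subst this
          rw [if_neg (by omega), Nat.add_sub_cancel_left]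
          by_cases h0 : α = 0
          · subst h0; simp
          · have h7 : (1 : ℕ) < 2 ^ α := Nat.one_lt_two_pow h0
            rw [Nat.testBit_lt_two_pow h7]
            simp [h0]
      · rw [hbit, if_pos (hlt' j hj α hα)]
        exact h4 α hα

/-- The matrix over the prime field of a matrix over a finite field. -/
def blow {d n : ℕ} {F : Type*} [Field F] [Algebra (ZMod 2) F]
    (b : Module.Basis (Fin n) (ZMod 2) F) (T : Matrix (Fin d) (Fin d) F) :
    Matrix (Fin (d * n)) (Fin (d * n)) (ZMod 2) :=
  Matrix.of fun i k => Algebra.leftMulMatrix b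
    (T (finProdFinEquiv.symm i).1 (finProdFinEquiv.symm k).1)
    (finProdFinEquiv.symm i).2 (finProdFinEquiv.symm k).2

section

variable {d n : ℕ} {F : Type*} [Field F] [Algebra (ZMod 2) F]
  (b : Module.Basis (Fin n) (ZMod 2) F)

theorem blow_one : blow b (1 : Matrix (Fin d) (Fin d) F) = 1 := by
  ext i k
  rw [blow, Matrix.of_apply, Matrix.one_apply, Matrix.one_apply]
  by_cases h1 : (finProdFinEquiv.symm i).1 = (finProdFinEquiv.symm k).1
  · rw [if_pos h1, map_one, Matrix.one_apply]
    refine if_congr ?_ rfl rfl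
    rw [← finProdFinEquiv.symm.injective.eq_iff, Prod.ext_iff]
    exact ⟨fun h => ⟨h1, h⟩, fun h => h.2⟩
  · have : i ≠ k := fun h => h1 (by rw [h])
    rw [if_neg h1, map_zero, if_neg this]
    rfl

theorem blow_mul (T T' : Matrix (Fin d) (Fin d) F) : blow b (T * T') = blow b T * blow b T' := by
  ext i k
  rw [Matrix.mul_apply, ← finProdFinEquiv.sum_comp, Fintype.sum_prod_type]
  simp only [blow, Matrix.of_apply, Equiv.symm_apply_apply, Matrix.mul_apply, map_sum, map_mul,
    Matrix.sum_apply]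

/-- The vector over a finite field that is given by a vector over the prime field. -/
def fieldVec (x : Fin (d * n) → ZMod 2) (i : Fin d) : F :=
  ∑ α : Fin n, x (finProdFinEquiv (i, α)) • b α

/-- `blow` is restriction of scalars: each field entry becomes the n × n block of multiplication by
it. The i-th field coordinate therefore occupies the binary coordinates n i, …, n i + n - 1. -/
theorem blow_mulVec (T : Matrix (Fin d) (Fin d) F) (x : Fin (d * n) → ZMod 2) (i : Fin d)
    (α : Fin n) : (blow b T *ᵥ x) (finProdFinEquiv (i, α)) =
      b.repr ((T *ᵥ fieldVec b x) i) α := by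
  rw [Matrix.mulVec, dotProduct, ← finProdFinEquiv.sum_comp, Fintype.sum_prod_type,
    Matrix.mulVec, dotProduct, map_sum, Finsupp.coe_finsetSum, Finset.sum_apply]
  refine Finset.sum_congr rfl fun k _ => ?_
  rw [fieldVec, Finset.mul_sum, map_sum, Finsupp.coe_finsetSum, Finset.sum_apply]
  refine Finset.sum_congr rfl fun β _ => ?_
  simp only [blow, Matrix.of_apply, Equiv.symm_apply_apply, Algebra.leftMulMatrix_eq_repr_mul,
    mul_smul_comm, map_smul, Finsupp.smul_apply, smul_eq_mul]
  ring

theorem fieldVec_ne_zero {x : Fin (d * n) → ZMod 2} (hx : x ≠ 0) : fieldVec b x ≠ 0 := by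
  intro h
  refine hx (funext fun k => ?_)
  obtain ⟨⟨i, α⟩, rfl⟩ := finProdFinEquiv.surjective k
  have h1 := congrFun h i
  have h2 : b.repr (fieldVec b x i) α = x (finProdFinEquiv (i, α)) := by
    rw [fieldVec, b.repr_sum_self]
  rw [← h2, h1]
  simp

end

/-! ### Linear bijections adapted to a line. -/

section Lines

variable {e : ℕ} {F : Type*} [Field F]

/-- The linear map that subtracts multiples of the coordinate `j` according to the direction `v`
and swaps the coordinates `j` and `last`. -/
def lineMat (j : Fin (e + 1)) (v : Fin (e + 1) → F) : Matrix (Fin (e + 1)) (Fin (e + 1)) F :=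
  Matrix.of fun i k => if i = Fin.last e then (if k = j then 1 else 0) else
    (if i = k then 1 else 0) + (if k = j then v i else 0) +
      if i = j ∧ k = Fin.last e then 1 else 0

/-- The inverse of `lineMat`. -/
def lineInv (j : Fin (e + 1)) (v : Fin (e + 1) → F) : Matrix (Fin (e + 1)) (Fin (e + 1)) F :=
  Matrix.of fun i k => if i = Fin.last e then (if k = j then 1 else 0) else
    (if i = k then 1 else 0) + (if k = Fin.last e then v i else 0) +
      if i = j ∧ k = j then 1 else 0

theorem lineMat_mulVec_last (j : Fin (e + 1)) (v x : Fin (e + 1) → F) :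
    (lineMat j v *ᵥ x) (Fin.last e) = x j := by
  simp [lineMat, Matrix.mulVec, dotProduct]

theorem lineMat_mulVec (j : Fin (e + 1)) (v x : Fin (e + 1) → F) {i : Fin (e + 1)}
    (hi : i ≠ Fin.last e) :
    (lineMat j v *ᵥ x) i = x i + v i * x j + if i = j then x (Fin.last e) else 0 := by
  simp only [lineMat, Matrix.mulVec, dotProduct, Matrix.of_apply, if_neg hi, add_mul, ite_mul,
    one_mul, zero_mul, Finset.sum_add_distrib, Finset.sum_ite_eq, Finset.sum_ite_eq',
    Finset.mem_univ, if_true]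
  congr 1
  by_cases h : i = j <;> simp [h]

theorem lineInv_mulVec_last (j : Fin (e + 1)) (v x : Fin (e + 1) → F) :
    (lineInv j v *ᵥ x) (Fin.last e) = x j := by
  simp [lineInv, Matrix.mulVec, dotProduct]

theorem lineInv_mulVec (j : Fin (e + 1)) (v x : Fin (e + 1) → F) {i : Fin (e + 1)}
    (hi : i ≠ Fin.last e) :
    (lineInv j v *ᵥ x) i = x i + v i * x (Fin.last e) + if i = j then x j else 0 := by
  simp only [lineInv, Matrix.mulVec, dotProduct, Matrix.of_apply, if_neg hi, add_mul, ite_mul,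
    one_mul, zero_mul, Finset.sum_add_distrib, Finset.sum_ite_eq, Finset.sum_ite_eq',
    Finset.mem_univ, if_true]
  congr 1
  by_cases h : i = j <;> simp [h]

/-- As v j = 1 in characteristic two, row j with j ≠ last gives x j + x j + x last = x last. The map
thus moves x j to the last place, x last to place j, and adds v i * x j elsewhere; adding the same
multiples again, now of the last coordinate, undoes it. -/
theorem lineInv_mul_lineMat [CharP F 2] {j : Fin (e + 1)} {v : Fin (e + 1) → F} (hv : v j = 1) :
    lineInv j v * lineMat j v = 1 := by
  refine Matrix.ext_of_mulVec_single fun k => ?_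
  rw [← Matrix.mulVec_mulVec, Matrix.one_mulVec]
  generalize (Pi.single k 1 : Fin (e + 1) → F) = x
  have hj : (lineMat j v *ᵥ x) j = x (Fin.last e) := by
    by_cases h : j = Fin.last e
    · rw [h, lineMat_mulVec_last]
    · rw [lineMat_mulVec _ _ _ h, hv, one_mul, CharTwo.add_self_eq_zero, zero_add, if_pos rfl]
  funext i
  by_cases hi : i = Fin.last e
  · rw [hi, lineInv_mulVec_last, hj]
  · rw [lineInv_mulVec _ _ _ hi, lineMat_mulVec_last, hj, lineMat_mulVec _ _ _ hi]
    have h1 : ∀ p q r : F, p + q + r + q + r = p := by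
      intro p q r
      have h2 := CharTwo.add_self_eq_zero q
      have h3 := CharTwo.add_self_eq_zero r
      linear_combination h2 + h3
    exact h1 _ _ _

/-- Vanishing at places other than j says x i = v i * x j. If j is not last, place j instead yields
x last = 0, which agrees with v last = 0 since v vanishes above j. So the kernel of the first e
coordinates is the line spanned by v. -/
theorem lineMat_mulVec_eq_zero_iff [CharP F 2] {j : Fin (e + 1)} {v : Fin (e + 1) → F}
    (hv : v j = 1) (hv' : ∀ i, j < i → v i = 0) (x : Fin (e + 1) → F) :
    (∀ i, i ≠ Fin.last e → (lineMat j v *ᵥ x) i = 0) ↔ x = x j • v := by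
  constructor
  · intro h
    have hlast : x (Fin.last e) = v (Fin.last e) * x j := by
      by_cases hj : j = Fin.last e
      · rw [← hj, hv, one_mul]
      · have h1 := h j hj
        rw [lineMat_mulVec _ _ _ hj, hv, one_mul, CharTwo.add_self_eq_zero, zero_add,
          if_pos rfl] at h1
        rw [h1, hv' _ (Fin.lt_last_iff_ne_last.2 hj), zero_mul]
    funext i
    rw [Pi.smul_apply, smul_eq_mul, mul_comm]
    by_cases hi : i = Fin.last e
    · rw [hi, hlast]
    · by_cases hij : i = j
      · rw [hij, hv, one_mul]
      · have h1 := h i hi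
        rw [lineMat_mulVec _ _ _ hi, if_neg hij, add_zero] at h1
        exact CharTwo.add_eq_zero.1 h1
  · intro h i hi
    have h1 : ∀ i, x i = v i * x j := by
      intro i
      conv_lhs => rw [h]
      rw [Pi.smul_apply, smul_eq_mul, mul_comm]
    rw [lineMat_mulVec _ _ _ hi, ← h1, CharTwo.add_self_eq_zero, zero_add]
    by_cases hij : i = j
    · rw [if_pos hij, h1, hv' _ (Fin.lt_last_iff_ne_last.2 (hij ▸ hi)), zero_mul]
    · rw [if_neg hij]

end Lines

end

section

/-! ### Programs for sums and multiples of field elements. -/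

section

variable {n K a c c₁ c₂ : ℕ} {F : Type*} [Field F] [Algebra (ZMod 2) F]
  (b : Module.Basis (Fin n) (ZMod 2) F) {G : Set (Fin K → ZMod 2)}

theorem Ext.of_coords {ζ : Fin K → F} (h : ∀ k, Ext a c G {fun y => b.repr (ζ y) k}) :
    Ext a (n * c) G (coords b ζ) := by
  have := Ext.range h
  rwa [Fintype.card_fin] at this

theorem Ext.add_coords {ζ η : Fin K → F} (hζ : Ext a c₁ G (coords b ζ))
    (hη : Ext a c₂ G (coords b η)) :
    Ext a (c₁ + c₂ + n) G (coords b fun y => ζ y + η y) := by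
  refine ((hζ.union hη).trans (Ext.of_coords (c := 1) b fun k => ?_)).mono (by omega) subset_rfl
    subset_rfl
  have e : (fun y => b.repr (ζ y + η y) k) =
      (fun y => b.repr (ζ y) k) + fun y => b.repr (η y) k := by
    funext y
    simp
  rw [e]
  exact Ext.add (Ext.of_mem (Or.inr (Or.inl ⟨k, rfl⟩))) (Ext.of_mem (Or.inr (Or.inr ⟨k, rfl⟩)))

theorem Ext.smul_coords {f : Fin K → ZMod 2} {ζ : Fin K → F} (hf : Ext a c₁ G {f})
    (hζ : Ext a c₂ G (coords b ζ)) :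
    Ext a (c₁ + c₂ + n) G (coords b fun y => f y • ζ y) := by
  refine ((hf.union hζ).trans (Ext.of_coords (c := 1) b fun k => ?_)).mono (by omega) subset_rfl
    subset_rfl
  have e : (fun y => b.repr (f y • ζ y) k) = f * fun y => b.repr (ζ y) k := by
    funext y
    simp
  rw [e]
  exact Ext.mul (Ext.of_mem (Or.inr (Or.inl rfl))) (Ext.of_mem (Or.inr (Or.inr ⟨k, rfl⟩)))

end

/-! ### Directions of lines -/

section Directions

variable {e n K : ℕ}

/-- The position of the pivot of the direction with number `y`. -/
structure IsPivot (n : ℕ) (pv : Fin K → Fin (e + 1)) : Prop where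
  above : ∀ (y : Fin K) i, pv y < i → ∀ α < n, (y : ℕ).testBit (n * i + α) = decide (α = 0)
  at_pivot : ∀ y : Fin K, ∀ α < n, (y : ℕ).testBit (n * pv y + α) = false

theorem exists_isPivot (hn : 0 < n) (hK : K = ∑ i ∈ Finset.range (e + 1), (2 ^ n) ^ i) :
    ∃ pv : Fin K → Fin (e + 1), IsPivot n pv := by
  choose pv h1 h2 h3 using fun y : Fin K => exists_pivot hn (y.2.trans_eq hK)
  exact ⟨fun y => ⟨pv y, h1 y⟩, fun y i hi => h2 y i hi i.2, h3⟩

/-- The indicator function of the pivot. -/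
def pivotBit (pv : Fin K → Fin (e + 1)) (j : Fin (e + 1)) (y : Fin K) : ZMod 2 :=
  if j = pv y then 1 else 0

/-- All base 2 ^ n digits above the pivot are 1 and the pivot digit is 0, so their lowest bits
identify it: j is the pivot exactly when its lowest bit is 0 and those of all higher digits are 1.
-/
theorem pivotBit_eq {pv : Fin K → Fin (e + 1)} (hpv : IsPivot n pv) (hn : 0 < n)
    (j : Fin (e + 1)) : pivotBit pv j =
      (∏ i : Fin (e + 1), if j < i then fun y : Fin K => bitZ y (n * i) else 1) *
        ((fun y : Fin K => bitZ y (n * j)) + 1) := by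
  funext y
  have h1 : ∀ i, pv y < i → bitZ y (n * i) = 1 := by
    intro i hi
    have := hpv.above y i hi 0 hn
    rw [add_zero] at this
    simp [bitZ, this]
  have h2 : bitZ y (n * pv y) = 0 := by
    have := hpv.at_pivot y 0 hn
    rw [add_zero] at this
    simp [bitZ, this]
  rw [Pi.mul_apply, Finset.prod_apply, pivotBit]
  rcases lt_trichotomy j (pv y) with h | h | h
  · rw [if_neg h.ne, Finset.prod_eq_zero (Finset.mem_univ (pv y)), zero_mul]
    simp [h, h2]
  · subst h
    rw [if_pos rfl, Finset.prod_eq_one]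
    · simp [h2]
    · intro i _
      by_cases hi : pv y < i
      · simp [hi, h1 i hi]
      · simp [hi]
  · rw [if_neg h.ne']
    have h3 : (((fun y : Fin K => bitZ y (n * j)) + 1) y) = 0 := by
      rw [Pi.add_apply, h1 j h, Pi.one_apply, CharTwo.add_self_eq_zero]
    rw [h3, mul_zero]

variable {F : Type*} [Field F] [Algebra (ZMod 2) F] (b : Module.Basis (Fin n) (ZMod 2) F)

/-- The direction with number `y`: the digits of `y` below the pivot, followed by `1`. -/
def direction (pv : Fin K → Fin (e + 1)) (y : Fin K) (i : Fin (e + 1)) : F :=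
  if i < pv y then ∑ α : Fin n, bitZ y (n * i + α) • b α else if i = pv y then 1 else 0

theorem direction_pivot (pv : Fin K → Fin (e + 1)) (y : Fin K) :
    direction b pv y (pv y) = 1 := by simp [direction]

theorem direction_above {pv : Fin K → Fin (e + 1)} {y : Fin K} {i : Fin (e + 1)} (h : pv y < i) :
    direction b pv y i = 0 := by simp [direction, h.not_gt, h.ne']

/-- The case distinction becomes a polynomial: the sum of the pivot indicators over j > i is the
indicator of i lying below the pivot. -/
theorem repr_direction (pv : Fin K → Fin (e + 1)) (i : Fin (e + 1)) (α : Fin n) :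
    (fun y => b.repr (direction b pv y i) α) =
      (∑ j : Fin (e + 1), if i < j then pivotBit pv j else 0) *
        (fun y : Fin K => bitZ y (n * i + α)) + pivotBit pv i * fun _ => b.repr 1 α := by
  funext y
  have h1 : (∑ j : Fin (e + 1), if i < j then pivotBit pv j else 0) y =
      if i < pv y then 1 else 0 := by
    rw [Finset.sum_apply, Finset.sum_eq_single (pv y)]
    · split_ifs <;> simp [pivotBit]
    · intro j _ hj
      split_ifs <;> simp [pivotBit, hj]
    · simp
  rw [Pi.add_apply, Pi.mul_apply, Pi.mul_apply, h1, direction, pivotBit]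
  rcases lt_trichotomy i (pv y) with h | h | h
  · rw [if_pos h, if_pos h, if_neg h.ne, b.repr_sum_self]
    simp
  · rw [if_neg h.not_lt, if_neg h.not_lt, if_pos h, if_pos h]
    simp
  · rw [if_neg h.not_gt, if_neg h.not_gt, if_neg h.ne', if_neg h.ne']
    simp

theorem mul_add_lt (i : Fin (e + 1)) {α : ℕ} (hα : α < n) : n * i + α < (e + 1) * n := by
  calc n * (i : ℕ) + α < n * i + n := by omega
    _ = (i + 1) * n := by ring
    _ ≤ (e + 1) * n := Nat.mul_le_mul_right _ i.2

theorem Ext.pivotBits {pv : Fin K → Fin (e + 1)} (hpv : IsPivot n pv) (hn : 0 < n)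
    {G : Set (Fin K → ZMod 2)} :
    Ext ((e + 1) * n) ((e + 1) * (2 * (e + 1) + 5)) G (Set.range (pivotBit pv)) := by
  have h1 : ∀ j, Ext ((e + 1) * n) (2 * (e + 1) + 5) G {pivotBit pv j} := by
    intro j
    rw [pivotBit_eq hpv hn]
    have h2 : ∀ i : Fin (e + 1), Ext ((e + 1) * n) 1 G
        {if j < i then fun y : Fin K => bitZ y (n * i) else 1} := by
      intro i
      split_ifs
      · exact Ext.bit (mul_add_lt i hn)
      · exact Ext.one
    refine (Ext.mul (Ext.prod h2) (Ext.add (Ext.bit (mul_add_lt j hn)) Ext.one)).mono ?_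
      subset_rfl subset_rfl
    simp
    omega
  have := Ext.range h1
  rwa [Fintype.card_fin] at this

theorem Ext.direction_coords {pv : Fin K → Fin (e + 1)} {G : Set (Fin K → ZMod 2)}
    (hG : Set.range (pivotBit pv) ⊆ G) (i : Fin (e + 1)) :
    Ext ((e + 1) * n) (n * (4 * (e + 1) + 10)) G
      (coords b fun y => direction b pv y i) := by
  refine Ext.of_coords b fun α => ?_
  rw [repr_direction]
  have h1 : ∀ j : Fin (e + 1), Ext ((e + 1) * n) 3 G {if i < j then pivotBit pv j else 0} := by
    intro j
    split_ifs
    · exact (Ext.of_mem (hG ⟨j, rfl⟩)).mono (by norm_num) subset_rfl subset_rfl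
    · exact Ext.zero
  refine (Ext.add (Ext.mul (Ext.sum h1) (Ext.bit (mul_add_lt i α.2)))
    (Ext.mul (Ext.of_mem (hG ⟨i, rfl⟩)) (Ext.const _))).mono ?_ subset_rfl subset_rfl
  simp
  omega

theorem Ext.lineMat_coords {pv : Fin K → Fin (e + 1)} {G : Set (Fin K → ZMod 2)}
    (hG : Set.range (pivotBit pv) ⊆ G)
    (hG' : ∀ i, coords b (fun y => direction b pv y i) ⊆ G) (i k : Fin (e + 1)) :
    Ext ((e + 1) * n) (n * 13) G
      (coords b fun y => lineMat (pv y) (direction b pv y) i k) := by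
  have hbit : ∀ j, Ext ((e + 1) * n) 0 G {pivotBit pv j} := fun j => Ext.of_mem (hG ⟨j, rfl⟩)
  by_cases hi : i = Fin.last e
  · have h1 : (fun y => lineMat (pv y) (direction b pv y) i k) =
        fun y => pivotBit pv k y • (1 : F) := by
      funext y
      simp [lineMat, hi, pivotBit]
    rw [h1]
    refine ((Ext.smul_coords b (hbit k) (Ext.field_const b 1))).mono (by omega) subset_rfl
      subset_rfl
  · have h1 : (fun y => lineMat (pv y) (direction b pv y) i k) =
        fun y => ((if i = k then 1 else 0 : F) +
          pivotBit pv k y • direction b pv y i) +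
          pivotBit pv i y • (if k = Fin.last e then 1 else 0 : F) := by
      funext y
      simp only [lineMat, Matrix.of_apply, if_neg hi, pivotBit, ite_smul, one_smul,
        zero_smul, ite_and]
    rw [h1]
    refine (Ext.add_coords b (Ext.add_coords b (Ext.field_const b _)
      (Ext.smul_coords b (hbit k) (Ext.of_subset (hG' i))))
      (Ext.smul_coords b (hbit i) (Ext.field_const b _))).mono (by omega) subset_rfl subset_rfl

theorem Ext.lineInv_coords {pv : Fin K → Fin (e + 1)} {G : Set (Fin K → ZMod 2)}
    (hG : Set.range (pivotBit pv) ⊆ G)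
    (hG' : ∀ i, coords b (fun y => direction b pv y i) ⊆ G) (i k : Fin (e + 1)) :
    Ext ((e + 1) * n) (n * 13 + 1) G
      (coords b fun y => lineInv (pv y) (direction b pv y) i k) := by
  have hbit : ∀ j, Ext ((e + 1) * n) 0 G {pivotBit pv j} := fun j => Ext.of_mem (hG ⟨j, rfl⟩)
  by_cases hi : i = Fin.last e
  · have h1 : (fun y => lineInv (pv y) (direction b pv y) i k) =
        fun y => pivotBit pv k y • (1 : F) := by
      funext y
      simp [lineInv, hi, pivotBit]
    rw [h1]
    refine ((Ext.smul_coords b (hbit k) (Ext.field_const b 1))).mono (by omega) subset_rfl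
      subset_rfl
  · have h1 : (fun y => lineInv (pv y) (direction b pv y) i k) =
        fun y => ((if i = k then 1 else 0 : F) +
          (if k = Fin.last e then direction b pv y i else 0)) +
          (pivotBit pv i * pivotBit pv k) y • (1 : F) := by
      funext y
      simp only [lineInv, Matrix.of_apply, if_neg hi, pivotBit, ite_smul, one_smul,
        zero_smul, ite_and, Pi.mul_apply, ite_mul, one_mul, zero_mul]
    have h2 : Ext ((e + 1) * n) (n * 3) G (coords b fun y =>
        if k = Fin.last e then direction b pv y i else 0) := by
      by_cases hk : k = Fin.last e
      · simp only [hk, if_true]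
        exact (Ext.of_subset (hG' i)).mono (by omega) subset_rfl subset_rfl
      · simp only [hk, if_false]
        exact Ext.field_const b 0
    rw [h1]
    refine (Ext.add_coords b (Ext.add_coords b (Ext.field_const b _) h2)
      (Ext.smul_coords b ((hbit i).mul (hbit k)) (Ext.field_const b _))).mono (by omega)
      subset_rfl subset_rfl

/-- Every nonzero vector is a multiple of exactly one direction. -/
theorem card_direction [Fintype F] [DecidableEq F] (hF : Fintype.card F = 2 ^ n)
    {pv : Fin K → Fin (e + 1)}
    (hpv : IsPivot n pv) (hK : K * (2 ^ n - 1) = 2 ^ ((e + 1) * n) - 1)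
    (hKle : K ≤ 2 ^ ((e + 1) * n)) {x : Fin (e + 1) → F} (hx : x ≠ 0) :
    (Finset.univ.filter fun y => x = x (pv y) • direction b pv y).card = 1 := by
  -- The pivot is the position of the last nonzero coordinate of any nonzero multiple of the
  -- direction, hence is determined by the line.
  have htop : ∀ (c c' : Fˣ) (y y' : Fin K),
      (c : F) • direction b pv y = (c' : F) • direction b pv y' → pv y' ≤ pv y := by
    intro c c' y y' h
    by_contra! hlt
    have h1 := congrFun h (pv y')
    rw [Pi.smul_apply, Pi.smul_apply, direction_above b hlt, direction_pivot] at h1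
    exact c'.ne_zero (by simpa using h1.symm)
  let Ψ : Fˣ × Fin K → {x : Fin (e + 1) → F // x ≠ 0} := fun q =>
    ⟨(q.1 : F) • direction b pv q.2, by
      intro h
      have h1 := congrFun h (pv q.2)
      rw [Pi.smul_apply, direction_pivot] at h1
      simp at h1⟩
  have hinj : Function.Injective Ψ := by
    rintro ⟨c, y⟩ ⟨c', y'⟩ h
    have h : (c : F) • direction b pv y = (c' : F) • direction b pv y' := congrArg Subtype.val h
    have hp : pv y = pv y' := le_antisymm (htop c' c y' y h.symm) (htop c c' y y' h)
    have hc : (c : F) = c' := by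
      have h1 := congrFun h (pv y)
      rw [Pi.smul_apply, Pi.smul_apply, direction_pivot, hp, direction_pivot] at h1
      simpa using h1
    have hd : direction b pv y = direction b pv y' := by
      rw [hc] at h
      funext i
      have h1 := congrFun h i
      rw [Pi.smul_apply, Pi.smul_apply, smul_eq_mul, smul_eq_mul] at h1
      exact mul_left_cancel₀ c'.ne_zero h1
    refine Prod.ext (Units.ext hc) (Fin.ext (Nat.eq_of_testBit_eq fun m => ?_))
    -- The number is recovered from its direction: digits below the pivot are coordinates of the
    -- direction, and those at and above it are prescribed by the pivot.
    by_cases hm : m < (e + 1) * n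
    · obtain ⟨⟨i, α⟩, hiα⟩ := finProdFinEquiv.surjective (⟨m, hm⟩ : Fin ((e + 1) * n))
      have hm' : m = n * i + α := by
        have := congrArg Fin.val hiα
        simp only [finProdFinEquiv_apply_val] at this
        omega
      rw [hm']
      rcases lt_trichotomy i (pv y) with hi | hi | hi
      · have h1 : b.repr (direction b pv y i) α = b.repr (direction b pv y' i) α := by rw [hd]
        rw [direction, direction, if_pos hi, if_pos (hp ▸ hi), b.repr_sum_self,
          b.repr_sum_self] at h1
        exact bitZ_inj.1 h1
      · have h2 := hpv.at_pivot y' α α.2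
        rw [← hp] at h2
        rw [hi, hpv.at_pivot y α α.2, h2]
      · rw [hpv.above y i hi α α.2, hpv.above y' i (hp ▸ hi) α α.2]
    · have h1 : 2 ^ ((e + 1) * n) ≤ 2 ^ m := Nat.pow_le_pow_right (by norm_num) (by omega)
      rw [Nat.testBit_lt_two_pow (y.2.trans_le (hKle.trans h1)),
        Nat.testBit_lt_two_pow (y'.2.trans_le (hKle.trans h1))]
  -- The assumption on K makes the two sides equinumerous, so the injective map Ψ is surjective and
  -- the normalized directions reach every line.
  have hcard : Fintype.card (Fˣ × Fin K) = Fintype.card {x : Fin (e + 1) → F // x ≠ 0} := by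
    rw [Fintype.card_prod, Fintype.card_fin, Fintype.card_units, hF, mul_comm, hK,
      Fintype.card_subtype_compl, Fintype.card_fun, hF, Fintype.card_fin, ← pow_mul,
      Fintype.card_subtype_eq, mul_comm n]
  obtain ⟨⟨c, y⟩, hy⟩ := ((Fintype.bijective_iff_injective_and_card Ψ).2 ⟨hinj, hcard⟩).2 ⟨x, hx⟩
  have hy : (c : F) • direction b pv y = x := congrArg Subtype.val hy
  rw [Finset.card_eq_one]
  refine ⟨y, ?_⟩
  ext y'
  simp only [Finset.mem_filter, Finset.mem_univ, true_and, Finset.mem_singleton]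
  constructor
  · intro h
    have h0 : x (pv y') ≠ 0 := by
      intro h0
      rw [h0, zero_smul] at h
      exact hx h
    have h1 : Ψ (Units.mk0 _ h0, y') = Ψ (c, y) := by
      refine Subtype.ext ?_
      change x (pv y') • direction b pv y' = (c : F) • direction b pv y
      rw [hy, ← h]
    exact (Prod.ext_iff.1 (hinj h1)).2
  · rintro rfl
    have h1 : x (pv y') = c := by
      rw [← hy, Pi.smul_apply, direction_pivot, smul_eq_mul, mul_one]
    rw [h1, hy]

end Directions

/-! ### The protocol from lines and its size. -/

theorem lines_size_le {d n len : ℕ} (hd : 0 < d) (hn : 0 < n)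
    (hlen : len ≤ d * (2 * d + 5) + (d * (n * (4 * d + 10)) +
      (d * d * (n * 13 + n * (n * 3 + n * (n * n * 6 + 3))) +
        d * d * (n * 13 + 1 + n * (n * 3 + n * (n * n * 6 + 3)))))) :
    10 * len + 4 * (d * n) ^ 2 + 15 * (d * n) + 2 ≤ 761 * (d * n) ^ 4 := by
  have h1 : len ≤ 73 * (d * n) ^ 4 := by
    have hd1 : 1 ≤ d := hd
    have hn1 : 1 ≤ n := hn
    have e1 : d ≤ d ^ 4 := Nat.le_self_pow (by norm_num) d
    have e2 : d ^ 2 ≤ d ^ 4 := Nat.pow_le_pow_right hd1 (by norm_num)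
    have f0 : 1 ≤ n ^ 4 := Nat.one_le_pow _ _ hn1
    have f1 : n ≤ n ^ 4 := Nat.le_self_pow (by norm_num) n
    have f2 : n ^ 2 ≤ n ^ 4 := Nat.pow_le_pow_right hn1 (by norm_num)
    calc len ≤ _ := hlen
      _ = 2 * (d ^ 2 * 1) + 5 * (d * 1) + 4 * (d ^ 2 * n) + 10 * (d * n) + 26 * (d ^ 2 * n) +
          12 * (d ^ 2 * n ^ 2) + 12 * (d ^ 2 * n ^ 4) + d ^ 2 * 1 := by ring
      _ ≤ 2 * (d ^ 4 * n ^ 4) + 5 * (d ^ 4 * n ^ 4) + 4 * (d ^ 4 * n ^ 4) + 10 * (d ^ 4 * n ^ 4) +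
          26 * (d ^ 4 * n ^ 4) + 12 * (d ^ 4 * n ^ 4) + 12 * (d ^ 4 * n ^ 4) +
          d ^ 4 * n ^ 4 := by gcongr
      _ ≤ _ := by rw [mul_pow]; omega
  have h2 : d * n ≤ (d * n) ^ 4 := Nat.le_self_pow (by norm_num) _
  have ha : 0 < d * n := by positivity
  have h3 : (d * n) ^ 2 ≤ (d * n) ^ 4 := Nat.pow_le_pow_right ha (by norm_num)
  have h4 : 1 ≤ (d * n) ^ 4 := Nat.one_le_pow _ _ ha
  omega

/-- The hash of x under direction y is its class modulo the y-th line. Two distinct vectors collide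
exactly when their difference spans that line, so `lam` = 1. -/
theorem exists_gepp_lines {d n s K : ℕ} (hd : 0 < d) (hn : 0 < n) (hs : s + n = d * n)
    (hK : K * (2 ^ n - 1) = 2 ^ (d * n) - 1) :
    ∃ P : GEPP (2 ^ (d * n)) K (2 ^ s * K), P.size ≤ 761 * (d * n) ^ 4 ∧
      ∀ ε : ℝ, ε < 1 / 2 → P.DetSuccessful ε (2 * ε / 2 ^ n) ε ∧
        (ε ≤ 2 ^ n / 2 ^ (d * n) → P.DetSuccessful ε (ε / 2 ^ n) ε) := by
  classical
  obtain ⟨e, rfl⟩ : ∃ e, d = e + 1 := ⟨d - 1, by omega⟩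
  obtain ⟨F, _, _, _, hF, ⟨b⟩⟩ := exists_binary_field hn.ne'
  have hchar : CharP F 2 := charP_of_injective_algebraMap (algebraMap (ZMod 2) F).injective 2
  have h2n : 2 ≤ 2 ^ n := by
    calc 2 = 2 ^ 1 := rfl
      _ ≤ 2 ^ n := Nat.pow_le_pow_right (by norm_num) hn
  have ha : 0 < (e + 1) * n := by positivity
  have h2a : 2 ≤ 2 ^ ((e + 1) * n) := by
    calc 2 = 2 ^ 1 := rfl
      _ ≤ 2 ^ ((e + 1) * n) := Nat.pow_le_pow_right (by norm_num) ha
  have hKsum : K = ∑ i ∈ Finset.range (e + 1), (2 ^ n) ^ i := by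
    have h1 := geom_sum_mul_of_one_le (show 1 ≤ 2 ^ n by omega) (e + 1)
    rw [← pow_mul, mul_comm n, ← hK] at h1
    exact (Nat.eq_of_mul_eq_mul_right (by omega) h1).symm
  have hKpos : 0 < K := by
    rcases Nat.eq_zero_or_pos K with h | h
    · rw [h] at hK; omega
    · exact h
  have hKle : K ≤ 2 ^ ((e + 1) * n) := by
    have h1 : K * 1 ≤ K * (2 ^ n - 1) := Nat.mul_le_mul_left _ (by omega)
    omega
  obtain ⟨pv, hpv⟩ := exists_isPivot (K := K) hn hKsum
  let T : Fin K → Matrix (Fin (e + 1)) (Fin (e + 1)) F := fun y =>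
    lineMat (pv y) (direction b pv y)
  let T' : Fin K → Matrix (Fin (e + 1)) (Fin (e + 1)) F := fun y =>
    lineInv (pv y) (direction b pv y)
  have hT : ∀ y, T' y * T y = 1 := fun y => lineInv_mul_lineMat (direction_pivot b pv y)
  let G₁ : Set (Fin K → ZMod 2) := ∅ ∪ Set.range (pivotBit pv)
  let G₂ : Set (Fin K → ZMod 2) := G₁ ∪ ⋃ i, coords b fun y => direction b pv y i
  have hG₂ : Set.range (pivotBit pv) ⊆ G₂ := Set.subset_union_right.trans Set.subset_union_left
  have hG₂' : ∀ i, coords b (fun y => direction b pv y i) ⊆ G₂ := fun i =>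
    (Set.subset_iUnion (fun i => coords b fun y => direction b pv y i) i).trans
      Set.subset_union_right
  have hext₃ : Ext ((e + 1) * n) ((e + 1) * (e + 1) *
      (n * 13 + n * (n * 3 + n * (n * n * 6 + 3)))) G₂
      (⋃ p : Fin (e + 1) × Fin (e + 1), mulEntries b fun y => T y p.1 p.2) := by
    refine (Ext.iUnion (c := n * 13 + n * (n * 3 + n * (n * n * 6 + 3))) fun p => ?_).mono
      (le_of_eq (by simp)) subset_rfl subset_rfl
    exact (Ext.lineMat_coords b hG₂ hG₂' p.1 p.2).trans
      (Ext.mulEntries b (ζ := fun y => T y p.1 p.2) Set.subset_union_right)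
  have hext₄ : Ext ((e + 1) * n) ((e + 1) * (e + 1) *
      (n * 13 + 1 + n * (n * 3 + n * (n * n * 6 + 3)))) G₂
      (⋃ p : Fin (e + 1) × Fin (e + 1), mulEntries b fun y => T' y p.1 p.2) := by
    refine (Ext.iUnion (c := n * 13 + 1 + n * (n * 3 + n * (n * n * 6 + 3))) fun p => ?_).mono
      (le_of_eq (by simp)) subset_rfl subset_rfl
    exact (Ext.lineInv_coords b hG₂ hG₂' p.1 p.2).trans
      (Ext.mulEntries b (ζ := fun y => T' y p.1 p.2) Set.subset_union_right)
  have hext₂ : Ext ((e + 1) * n) ((e + 1) * (n * (4 * (e + 1) + 10))) G₁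
      (⋃ i, coords b fun y => direction b pv y i) := by
    have h := fun i => Ext.direction_coords b (pv := pv) (G := G₁) Set.subset_union_right i
    exact (Ext.iUnion h).mono (le_of_eq (by simp)) subset_rfl subset_rfl
  obtain ⟨l, hl, hmem, hlen⟩ := ((Ext.pivotBits (G := ∅) hpv hn).trans
    (hext₂.trans (hext₃.union hext₄))).exists_prog
  have hdesign : ∀ x : Fin ((e + 1) * n) → ZMod 2, x ≠ 0 →
      (Finset.univ.filter fun y => ∀ i : Fin ((e + 1) * n), (i : ℕ) < s →
        (blow b (T y) *ᵥ x) i = 0).card = 1 := by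
    intro x hx
    refine Eq.trans ?_ (card_direction b hF hpv hK hKle (fieldVec_ne_zero b hx))
    congr 1
    ext y
    simp only [Finset.mem_filter, Finset.mem_univ, true_and]
    rw [← lineMat_mulVec_eq_zero_iff (direction_pivot b pv y) fun i => direction_above b]
    -- The first s binary coordinates are thus exactly the first e field coordinates, and the
    -- measured ones form the last field coordinate.
    have hse : s = e * n := by
      have : (e + 1) * n = e * n + n := by ring
      omega
    constructor
    · intro h i hi
      have hie : (i : ℕ) < e := Fin.val_lt_last hi
      rw [← LinearEquiv.map_eq_zero_iff b.repr]
      ext α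
      rw [← blow_mulVec]
      refine h _ ?_
      rw [finProdFinEquiv_apply_val, hse]
      calc (α : ℕ) + n * i < n + n * i := by omega
        _ = (i + 1) * n := by ring
        _ ≤ e * n := Nat.mul_le_mul_right _ hie
    · intro h k hk
      obtain ⟨⟨i, α⟩, rfl⟩ := finProdFinEquiv.surjective k
      rw [blow_mulVec, h i, map_zero]
      · rfl
      · rintro rfl
        rw [finProdFinEquiv_apply_val, hse, Fin.val_last, mul_comm e n] at hk
        omega
  obtain ⟨P, hP, hP'⟩ := exists_gepp (a := (e + 1) * n) (t := n) (s := s) (K := K) hs ha hKpos hKle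
    (A := fun y => blow b (T y)) (A' := fun y => blow b (T' y))
    (fun y => by rw [← blow_mul, hT, blow_one]) hl
    (fun i j => hmem _ (Or.inl (Set.mem_iUnion.2
      ⟨((finProdFinEquiv.symm i).1, (finProdFinEquiv.symm j).1), Set.mem_iUnion.2
        ⟨((finProdFinEquiv.symm i).2, (finProdFinEquiv.symm j).2), rfl⟩⟩)))
    (fun i j => hmem _ (Or.inr (Set.mem_iUnion.2
      ⟨((finProdFinEquiv.symm i).1, (finProdFinEquiv.symm j).1), Set.mem_iUnion.2
        ⟨((finProdFinEquiv.symm i).2, (finProdFinEquiv.symm j).2), rfl⟩⟩)))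
    (by rw [one_mul, hK]) hdesign
  exact ⟨P, hP.trans (lines_size_le hd hn hlen), hP'⟩

/-- The logarithm of N alone equals a; that of K is nonnegative, including the value 0 at K = 0, and
can only help. -/
theorem size_le_logb {s C a N K : ℕ} (h : s ≤ C * a ^ 4) (hN : N = 2 ^ a) :
    (s : ℝ) ≤ (C : ℝ) * (Real.logb 2 (N : ℝ) + Real.logb 2 (K : ℝ)) ^ 4 := by
  have h1 : Real.logb 2 (N : ℝ) = a := by
    rw [hN, Nat.cast_pow, Nat.cast_ofNat, Real.logb_pow, Real.logb_self_eq_one (by norm_num),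
      mul_one]
  have h2 : 0 ≤ Real.logb 2 (K : ℝ) := by
    rcases Nat.eq_zero_or_pos K with rfl | hK
    · simp
    · exact Real.logb_nonneg (by norm_num) (by exact_mod_cast hK)
  calc (s : ℝ) ≤ C * (a : ℝ) ^ 4 := by exact_mod_cast h
    _ ≤ _ := by
      rw [h1]
      gcongr
      linarith

end

end Purification

end

theorem theorem2 :
    (∃ (C : ℝ) (c : ℕ), ∀ n t : ℕ, t < n →
      ∃ P : Purification.GEPP (2 ^ n) (2 ^ n - 1) (2 ^ (n - t) * (2 ^ n - 1)),
        (P.size : ℝ) ≤ C * (Real.logb 2 ((2 ^ n : ℕ) : ℝ) +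
          Real.logb 2 ((2 ^ n - 1 : ℕ) : ℝ)) ^ c ∧
        ∀ ε : ℝ, ε < 1 / 2 →
          P.DetSuccessful ε (2 * ε / 2 ^ t) ε ∧
          (ε ≤ 2 ^ t / 2 ^ n → P.DetSuccessful ε (ε / 2 ^ t) ε)) ∧
    (∃ (C : ℝ) (c : ℕ), ∀ n : ℕ, 0 < n →
      ∃ P : Purification.GEPP (2 ^ (2 * n)) (2 ^ n + 1) (2 ^ n * (2 ^ n + 1)),
        (P.size : ℝ) ≤ C * (Real.logb 2 ((2 ^ (2 * n) : ℕ) : ℝ) +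
          Real.logb 2 ((2 ^ n + 1 : ℕ) : ℝ)) ^ c ∧
        ∀ ε : ℝ, ε < 1 / 2 →
          P.DetSuccessful ε (2 * ε / 2 ^ n) ε ∧
          (ε ≤ 2 ^ n / 2 ^ (2 * n) → P.DetSuccessful ε (ε / 2 ^ n) ε)) ∧
    (∃ (C : ℝ) (c : ℕ), ∀ d n : ℕ, 0 < d → 0 < n →
      ∃ P : Purification.GEPP (2 ^ (d * n)) ((2 ^ (d * n) - 1) / (2 ^ n - 1))
          (2 ^ ((d - 1) * n) * ((2 ^ (d * n) - 1) / (2 ^ n - 1))),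
        (P.size : ℝ) ≤ C * (Real.logb 2 ((2 ^ (d * n) : ℕ) : ℝ) +
          Real.logb 2 (((2 ^ (d * n) - 1) / (2 ^ n - 1) : ℕ) : ℝ)) ^ c ∧
        ∀ ε : ℝ, ε < 1 / 2 →
          P.DetSuccessful ε (2 * ε / 2 ^ n) ε ∧
          (ε ≤ 2 ^ n / 2 ^ (d * n) → P.DetSuccessful ε (ε / 2 ^ n) ε)) := by
  refine ⟨⟨501, 4, fun n t ht => ?_⟩, ⟨12176, 4, fun n hn => ?_⟩, ⟨761, 4, fun d n hd hn => ?_⟩⟩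
  · obtain ⟨P, h1, h2⟩ := Purification.exists_gepp_field ht
    exact ⟨P, by exact_mod_cast Purification.size_le_logb h1 rfl, h2⟩
  · have hK : (2 ^ n + 1) * (2 ^ n - 1) = 2 ^ (2 * n) - 1 := by
      rw [← Nat.sq_sub_sq, mul_comm 2 n, pow_mul, one_pow]
    obtain ⟨P, h1, h2⟩ := Purification.exists_gepp_lines (d := 2) (s := n) (by norm_num) hn
      (by ring) hK
    refine ⟨P, ?_, h2⟩
    -- 12176 = 761 · 2 ^ 4 is a generous choice: the exponent of N is already 2n, so 761 would do.
    exact_mod_cast Purification.size_le_logb (C := 12176) (h1.trans (by gcongr; norm_num)) rfl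
  · have h2n : 2 ≤ 2 ^ n := by
      calc 2 = 2 ^ 1 := rfl
        _ ≤ 2 ^ n := Nat.pow_le_pow_right (by norm_num) hn
    have hdvd : 2 ^ n - 1 ∣ 2 ^ (d * n) - 1 := by
      rw [mul_comm, pow_mul]
      simpa using Nat.sub_dvd_pow_sub_pow (2 ^ n) 1 d
    obtain ⟨P, h1, h2⟩ := Purification.exists_gepp_lines (s := (d - 1) * n) hd hn (by
      rw [← Nat.succ_mul]
      congr 1
      omega) (Nat.div_mul_cancel hdvd)
    exact ⟨P, by exact_mod_cast Purification.size_le_logb h1 rfl, h2⟩
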